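/- Let $M$ be a connected smooth 7-manifold with $b_1(M)=0$ (that is, $H^1(M,\mathbb{R})=0$), and let $\varphi$ be a torsion-free $G_2$-form on $M$: a smooth 3-form such that each tangent space admits a linear isomorphism to $\mathbb{R}^7$ carrying the standard $G_2$-form $\varphi_0=dx_{123}+dx_{145}+dx_{167}+dx_{246}-dx_{257}-dx_{347}-dx_{356}$ to $\varphi$, with $d\varphi=0$ and $d(*\varphi)=0$, where $*$ is taken with respect to the metric and orientation determined by $\varphi$. Let $SO(3)$ act smoothly on $M$ preserving $\varphi$. Let $e_1,e_2,e_3$ be the standard basis of $\mathfrak{so}(3)$, with $[e_1,e_2]=e_3$, $[e_2,e_3]=e_1$, $[e_3,e_1]=e_2$, and let $X_1,X_2,X_3$ be the corresponding vector fields on $M$. A point $m$ is called regular if $X_1,X_2,X_3$ are linearly independent at $m$; let $M'$ be the set of regular points. Assume that at least one point of $M$ is not regular and that $SO(3)$ acts freely on $M'$. Then there is a smooth $SO(3)$-invariant function $g$ on $M$ with $dg=i_{X_1}i_{X_2}i_{X_3}(*\varphi)$; its critical points are exactly the points of $M\setminus M'$; and the following holds. For a gradient line $\ell$ of $g$, i.e.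 a non-constant maximal trajectory of the flow of $\nabla g$ (the gradient for the metric of $\varphi$), let $SO(3)\cdot\ell\subset M$ be the union of the orbits through the points of $\ell$. Then (i) any two of the sets $SO(3)\cdot\ell$ are equal or disjoint, and their union is $M'$; (ii) each $SO(3)\cdot\ell$ is an embedded submanifold of $M$ diffeomorphic to $SO(3)\times\mathbb{R}$; more precisely, it is the image of a smooth embedding $F:SO(3)\times\mathbb{R}\to M$ with $F(A,s)=A\cdot F(1,s)$ and $F(\{1\}\times\mathbb{R})=\ell$; (iii) each $SO(3)\cdot\ell$ is coassociative, i.e. it is 4-dimensional and calibrated by $*\varphi$: on each of its tangent spaces $*\varphi$ is the Riemannian volume form for one of the two orientations. -/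

import Mathlib

open Set Function Topology Manifold
open scoped ContDiff Matrix

/-! ## The rotation group as a smooth manifold -/

/-- Euclidean 3-space. -/
abbrev E3 : Type := EuclideanSpace ℝ (Fin 3)

/-- Euclidean 7-space. -/
abbrev E7 : Type := EuclideanSpace ℝ (Fin 7)

/-- The group `SO(3)` of real orthogonal `3 × 3` matrices of determinant one. -/
abbrev SO3 : Type := Matrix.specialOrthogonalGroup (Fin 3) ℝ

namespace SO3

theorem mem_iff {A : Matrix (Fin 3) (Fin 3) ℝ} :
    A ∈ Matrix.specialOrthogonalGroup (Fin 3) ℝ ↔ A * Aᵀ = 1 ∧ A.det = 1 := by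
  rw [Matrix.mem_specialOrthogonalGroup_iff, Matrix.mem_orthogonalGroup_iff]

/-- The entries of a rotation matrix: orthonormality of rows and columns, and the fact that every
entry equals its cofactor. -/
theorem entries (A : SO3) :
    (A.1 * A.1ᵀ = 1 ∧ A.1ᵀ * A.1 = 1) ∧ A.1ᵀ = A.1.adjugate := by
  have h := mem_iff.1 A.2
  have h2 : A.1ᵀ * A.1 = 1 := mul_eq_one_comm.1 h.1
  refine ⟨⟨h.1, h2⟩, ?_⟩
  have h3 : A.1 * A.1.adjugate = 1 := by rw [Matrix.mul_adjugate, h.2, one_smul]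
  calc A.1ᵀ = A.1ᵀ * (A.1 * A.1.adjugate) := by rw [h3, mul_one]
    _ = A.1.adjugate := by rw [← mul_assoc, h2, one_mul]

/-- The skew-symmetric matrix of the linear map `y ↦ x × y`. -/
def hat (x : Fin 3 → ℝ) : Matrix (Fin 3) (Fin 3) ℝ :=
  !![0, -x 2, x 1; x 2, 0, -x 0; -x 1, x 0, 0]

/-- The Cayley parametrisation `x ↦ (1 + hat x) (1 - hat x)⁻¹` of the rotations of angle
different from `π`, written without the inverse matrix. -/
noncomputable def cayleyMatrix (x : E3) : Matrix (Fin 3) (Fin 3) ℝ :=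
  (1 + (x 0 ^ 2 + x 1 ^ 2 + x 2 ^ 2))⁻¹ •
    ((1 - (x 0 ^ 2 + x 1 ^ 2 + x 2 ^ 2)) • (1 : Matrix (Fin 3) (Fin 3) ℝ)
      + (2 : ℝ) • Matrix.vecMulVec x x + (2 : ℝ) • hat x)

theorem den_ne (x : E3) : (1 + (x 0 ^ 2 + x 1 ^ 2 + x 2 ^ 2)) ≠ 0 := by positivity

theorem cayleyMatrix_eq (x : E3) : cayleyMatrix x * (1 - hat x) = 1 + hat x := by
  have h := den_ne x
  ext i j
  fin_cases i <;> fin_cases j <;>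
    simp [cayleyMatrix, hat, Matrix.mul_apply, Fin.sum_univ_three, Matrix.vecMulVec_apply] <;>
    field_simp <;> ring

theorem cayleyMatrix_mem (x : E3) :
    cayleyMatrix x ∈ Matrix.specialOrthogonalGroup (Fin 3) ℝ := by
  have h := den_ne x
  refine mem_iff.2 ⟨?_, ?_⟩
  · ext i j
    fin_cases i <;> fin_cases j <;>
      simp [cayleyMatrix, hat, Matrix.mul_apply, Fin.sum_univ_three, Matrix.vecMulVec_apply] <;>
      field_simp <;> ring
  · simp [cayleyMatrix, hat, Matrix.det_fin_three, Matrix.vecMulVec_apply]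
    field_simp
    ring

/-- The inverse of the Cayley parametrisation, defined where `1 + tr A ≠ 0`. -/
noncomputable def cayleyInv (A : Matrix (Fin 3) (Fin 3) ℝ) : E3 :=
  (1 + A.trace)⁻¹ • !₂[A 2 1 - A 1 2, A 0 2 - A 2 0, A 1 0 - A 0 1]

theorem one_add_trace_cayley (x : E3) :
    1 + (cayleyMatrix x).trace = 4 / (1 + (x 0 ^ 2 + x 1 ^ 2 + x 2 ^ 2)) := by
  have h := den_ne x
  simp [cayleyMatrix, hat, Matrix.trace, Fin.sum_univ_three, Matrix.vecMulVec_apply]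
  field_simp
  ring

theorem cayleyInv_cayley (x : E3) : cayleyInv (cayleyMatrix x) = x := by
  have h := den_ne x
  unfold cayleyInv
  rw [one_add_trace_cayley]
  ext i
  fin_cases i <;> simp [cayleyMatrix, hat, Matrix.vecMulVec_apply] <;> field_simp <;> ring

theorem cayley_cayleyInv (A : SO3) (hA : 1 + A.1.trace ≠ 0) :
    cayleyMatrix (cayleyInv A.1) = A.1 := by
  obtain ⟨⟨h1, h2⟩, h3⟩ := entries A
  generalize A.1 = B at *
  have e1 := fun i j => congrFun (congrFun h1 i) j
  have e2 := fun i j => congrFun (congrFun h2 i) j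
  have e3 := fun i j => congrFun (congrFun h3 i) j
  simp [Fin.forall_fin_succ, Matrix.mul_apply, Fin.sum_univ_three] at e1 e2
  simp [Fin.forall_fin_succ, Matrix.adjugate_fin_three] at e3
  have ht : 1 + B.trace = 1 + (B 0 0 + B 1 1 + B 2 2) := by
    simp [Matrix.trace, Fin.sum_univ_three]
  rw [ht] at hA
  obtain ⟨⟨a1, a2, a3⟩, ⟨a4, a5, a6⟩, a7, a8, a9⟩ := e1
  obtain ⟨⟨b1, b2, b3⟩, ⟨b4, b5, b6⟩, b7, b8, b9⟩ := e2
  obtain ⟨⟨c1, c2, c3⟩, ⟨c4, c5, c6⟩, c7, c8, c9⟩ := e3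
  have hx0 : cayleyInv B 0 = (B 2 1 - B 1 2) / (1 + (B 0 0 + B 1 1 + B 2 2)) := by
    simp [cayleyInv, ht]; ring
  have hx1 : cayleyInv B 1 = (B 0 2 - B 2 0) / (1 + (B 0 0 + B 1 1 + B 2 2)) := by
    simp [cayleyInv, ht]; ring
  have hx2 : cayleyInv B 2 = (B 1 0 - B 0 1) / (1 + (B 0 0 + B 1 1 + B 2 2)) := by
    simp [cayleyInv, ht]; ring
  have hn : 1 + (cayleyInv B 0 ^ 2 + cayleyInv B 1 ^ 2 + cayleyInv B 2 ^ 2)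
      = 4 / (1 + (B 0 0 + B 1 1 + B 2 2)) := by
    rw [hx0, hx1, hx2]
    field_simp
    grind
  unfold cayleyMatrix hat
  rw [hn]
  ext i j
  fin_cases i <;> fin_cases j <;> simp [Matrix.vecMulVec_apply, hx0, hx1, hx2]
  all_goals field_simp
  all_goals grind

theorem contDiff_cayleyMatrix :
    ContDiff ℝ ∞ (fun (x : E3) (i j : Fin 3) => cayleyMatrix x i j) := by
  have h := den_ne
  refine contDiff_pi.2 fun i => contDiff_pi.2 fun j => ?_
  fin_cases i <;> fin_cases j <;> simp [cayleyMatrix, hat, Matrix.vecMulVec_apply] <;>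
    fun_prop (disch := assumption)

theorem contDiffOn_cayleyInv : ContDiffOn ℝ ∞
    (fun A : Fin 3 → Fin 3 → ℝ => cayleyInv (Matrix.of A))
    {A | 1 + (Matrix.of A).trace ≠ 0} := by
  refine contDiffOn_euclidean.2 fun i => ?_
  fin_cases i <;> simp [cayleyInv, Matrix.trace, Fin.sum_univ_three] <;>
    fun_prop (disch := simp)

/-- The Cayley chart of `SO(3)` at the identity. -/
noncomputable def cayleyChart : OpenPartialHomeomorph SO3 E3 where
  toFun A := cayleyInv A.1
  invFun x := ⟨cayleyMatrix x, cayleyMatrix_mem x⟩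
  source := {A | 1 + A.1.trace ≠ 0}
  target := univ
  map_source' _ _ := mem_univ _
  map_target' x _ := by
    change 1 + (cayleyMatrix x).trace ≠ 0
    rw [one_add_trace_cayley]
    exact div_ne_zero (by norm_num) (den_ne x)
  left_inv' A hA := Subtype.ext (cayley_cayleyInv A hA)
  right_inv' x _ := cayleyInv_cayley x
  open_source := isOpen_ne_fun
    (continuous_const.add (Continuous.matrix_trace continuous_subtype_val)) continuous_const
  open_target := isOpen_univ
  continuousOn_toFun := by
    exact contDiffOn_cayleyInv.continuousOn.comp
      (f := fun A : SO3 => fun i j => A.1 i j) (by fun_prop) (fun _ h => h)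
  continuousOn_invFun := by
    have h : Continuous cayleyMatrix := contDiff_cayleyMatrix.continuous
    exact (h.subtype_mk cayleyMatrix_mem).continuousOn

/-- The Cayley chart of `SO(3)` around the rotation `R`: the chart at the identity, precomposed with
left translation by `R⁻¹`. -/
noncomputable def chart (R : SO3) : OpenPartialHomeomorph SO3 E3 :=
  (Homeomorph.mulLeft R⁻¹).toOpenPartialHomeomorph.trans cayleyChart

theorem mem_chart_source (R : SO3) : R ∈ (chart R).source := by
  simp only [chart, cayleyChart, OpenPartialHomeomorph.trans_source,
    Homeomorph.toOpenPartialHomeomorph_source, univ_inter, mem_preimage, mem_ofPred_eq]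
  simp
  norm_num

noncomputable instance : ChartedSpace E3 SO3 where
  atlas := range chart
  chartAt := chart
  mem_chart_source := mem_chart_source
  chart_mem_atlas := mem_range_self

instance : IsManifold (𝓡 3) ∞ SO3 := by
  refine isManifold_of_contDiffOn _ _ _ ?_
  rintro _ _ ⟨R, rfl⟩ ⟨S, rfl⟩
  have hmul : ContDiff ℝ ∞ (fun (x : E3) (i j : Fin 3) =>
      ((S⁻¹ : SO3).1 * (R.1 * cayleyMatrix x)) i j) := by
    have h : ∀ i j, ContDiff ℝ ∞ (fun x : E3 => cayleyMatrix x i j) := fun i j =>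
      contDiff_pi.1 (contDiff_pi.1 contDiff_cayleyMatrix i) j
    refine contDiff_pi.2 fun i => contDiff_pi.2 fun j => ?_
    simp only [Matrix.mul_apply]
    exact ContDiff.sum fun k _ => contDiff_const.mul
      (ContDiff.sum fun l _ => contDiff_const.mul (h l j))
  refine (contDiffOn_cayleyInv.comp (s := (𝓡 3).symm ⁻¹' ((chart R).symm.trans (chart S)).source ∩
    range (𝓡 3)) hmul.contDiffOn ?_).congr ?_
  · intro x hx
    simp only [chart, cayleyChart, mfld_simps] at hx
    exact hx
  · intro x _
    simp only [chart, cayleyChart, mfld_simps]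
    rfl

/-- The rotation by the angle `t` about the `i`-th coordinate axis, as a matrix. -/
noncomputable def rotationMatrix (i : Fin 3) (t : ℝ) : Matrix (Fin 3) (Fin 3) ℝ :=
  ![!![1, 0, 0; 0, Real.cos t, -Real.sin t; 0, Real.sin t, Real.cos t],
    !![Real.cos t, 0, Real.sin t; 0, 1, 0; -Real.sin t, 0, Real.cos t],
    !![Real.cos t, -Real.sin t, 0; Real.sin t, Real.cos t, 0; 0, 0, 1]] i

theorem rotationMatrix_mem (i : Fin 3) (t : ℝ) :
    rotationMatrix i t ∈ Matrix.specialOrthogonalGroup (Fin 3) ℝ := by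
  have h := Real.sin_sq_add_cos_sq t
  refine mem_iff.2 ⟨?_, ?_⟩
  · ext j k
    fin_cases i <;> fin_cases j <;> fin_cases k <;>
      simp [rotationMatrix, Matrix.mul_apply, Fin.sum_univ_three] <;> linarith
  · fin_cases i <;> simp [rotationMatrix, Matrix.det_fin_three] <;> linarith

/-- The one-parameter subgroup `t ↦ exp (t eᵢ)` of `SO(3)`, where `eᵢ` is the `i`-th standard
basis vector of the Lie algebra, that is, the skew-symmetric matrix `liegen i`. -/
noncomputable def rotation (i : Fin 3) (t : ℝ) : SO3 :=
  ⟨rotationMatrix i t, rotationMatrix_mem i t⟩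

/-- The standard (orthonormal) basis of the Lie algebra `𝔰𝔬(3)`. -/
def liegen (i : Fin 3) : Matrix (Fin 3) (Fin 3) ℝ := hat (Pi.single i 1)

theorem liegen_bracket :
    ⁅liegen 0, liegen 1⁆ = liegen 2 ∧ ⁅liegen 1, liegen 2⁆ = liegen 0 ∧
      ⁅liegen 2, liegen 0⁆ = liegen 1 := by
  refine ⟨?_, ?_, ?_⟩ <;> ext j k <;> fin_cases j <;> fin_cases k <;>
    simp [Ring.lie_def, liegen, hat]

theorem rotation_zero (i : Fin 3) : rotation i 0 = 1 := by
  refine Subtype.ext ?_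
  ext j k
  fin_cases i <;> fin_cases j <;> fin_cases k <;> simp [rotation, rotationMatrix]

/-- `rotation i` is the one-parameter subgroup generated by `liegen i`: it starts at the identity
and solves `R' = R * liegen i`. -/
theorem hasDerivAt_rotation (i : Fin 3) (t : ℝ) (j k : Fin 3) :
    HasDerivAt (fun t => (rotation i t).1 j k) (((rotation i t).1 * liegen i) j k) t := by
  have h1 := Real.hasDerivAt_sin t
  have h2 := Real.hasDerivAt_cos t
  have h3 := h1.neg
  fin_cases i <;> fin_cases j <;> fin_cases k <;>
    simp [rotation, rotationMatrix, liegen, hat, Matrix.mul_apply, Fin.sum_univ_three,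
      hasDerivAt_const] <;> assumption

end SO3

/-! ## Differential forms on a 7-manifold -/

section Forms

variable {M : Type*} [TopologicalSpace M] [ChartedSpace E7 M]

variable (M) in
/-- A (not necessarily smooth) differential `k`-form on the 7-manifold `M`. -/
abbrev DForm (k : ℕ) : Type _ := (m : M) → (TangentSpace (𝓡 7) m) [⋀^Fin k]→L[ℝ] ℝ

/-- The expression of a differential form in the chart around `x`: its pullback to (the target of
the chart in) `ℝ⁷` by the inverse of the chart. -/
noncomputable def DForm.inChart {k : ℕ} (η : DForm M k) (x : M) (y : E7) :
    E7 [⋀^Fin k]→L[ℝ] ℝ :=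
  (η ((extChartAt (𝓡 7) x).symm y)).compContinuousLinearMap
    (mfderiv 𝓘(ℝ, E7) (𝓡 7) (extChartAt (𝓡 7) x).symm y)

/-- A differential form is smooth if its expressions in charts are. -/
def DForm.IsSmooth {k : ℕ} (η : DForm M k) : Prop :=
  ∀ x : M, ContDiffOn ℝ ∞ (DForm.inChart η x) (extChartAt (𝓡 7) x).target

/-- `dη = 0`, where the exterior derivative is computed in charts. -/
def DForm.IsClosed {k : ℕ} (η : DForm M k) : Prop :=
  ∀ x : M, ∀ y ∈ (extChartAt (𝓡 7) x).target, extDeriv (DForm.inChart η x) y = 0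

/-- The differential `dg` of a function at a point. -/
noncomputable def differential (g : M → ℝ) (m : M) : TangentSpace (𝓡 7) m →L[ℝ] ℝ :=
  mfderiv (𝓡 7) 𝓘(ℝ, ℝ) g m

variable (M) in
/-- `b₁(M) = 0`, that is `H¹(M, ℝ) = 0` in de Rham cohomology: every smooth closed 1-form is the
differential of a smooth function. -/
def FirstBettiNumberVanishes : Prop :=
  ∀ β : DForm M 1, DForm.IsSmooth β → DForm.IsClosed β →
    ∃ f : M → ℝ, ContMDiff (𝓡 7) 𝓘(ℝ, ℝ) ∞ f ∧ ∀ m w, β m ![w] = differential f m w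

end Forms

/-! ## `G₂`-structures -/

/-- The constant form `dx_{s 0} ∧ ⋯ ∧ dx_{s (k-1)}` on `ℝ⁷`. -/
noncomputable def dxWedge {k : ℕ} (s : Fin k → Fin 7) : E7 [⋀^Fin k]→L[ℝ] ℝ where
  toMultilinearMap := (Matrix.detRowAlternating (n := Fin k) (R := ℝ)).toMultilinearMap.compLinearMap
    fun _ => LinearMap.pi fun j => (EuclideanSpace.proj (𝕜 := ℝ) (s j)).toLinearMap
  cont := by
    change Continuous fun v : Fin k → E7 => Matrix.det (fun i j => v i (s j))
    exact Continuous.matrix_det (by fun_prop)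
  map_eq_zero_of_eq' v i j h hij :=
    Matrix.det_zero_of_row_eq hij (by ext l; simp [h])

theorem dxWedge_apply {k : ℕ} (s : Fin k → Fin 7) (v : Fin k → E7) :
    dxWedge s v = Matrix.det (Matrix.of fun i j => v i (s j)) := rfl

/-- The standard `G₂`-form
`φ₀ = dx₁₂₃ + dx₁₄₅ + dx₁₆₇ + dx₂₄₆ - dx₂₅₇ - dx₃₄₇ - dx₃₅₆` on `ℝ⁷`
(the indices in the code start at `0`). -/
noncomputable def phi0 : E7 [⋀^Fin 3]→L[ℝ] ℝ :=
  dxWedge ![0, 1, 2] + dxWedge ![0, 3, 4] + dxWedge ![0, 5, 6] + dxWedge ![1, 3, 5]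
    - dxWedge ![1, 4, 6] - dxWedge ![2, 3, 6] - dxWedge ![2, 4, 5]

/-- The Hodge dual of `phi0` for the standard metric and orientation of `ℝ⁷`,
`∗φ₀ = dx₄₅₆₇ + dx₂₃₆₇ + dx₂₃₄₅ + dx₁₃₅₇ - dx₁₃₄₆ - dx₁₂₅₆ - dx₁₂₄₇`
(the indices in the code start at `0`). -/
noncomputable def starPhi0 : E7 [⋀^Fin 4]→L[ℝ] ℝ :=
  dxWedge ![3, 4, 5, 6] + dxWedge ![1, 2, 5, 6] + dxWedge ![1, 2, 3, 4] + dxWedge ![0, 2, 4, 6]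
    - dxWedge ![0, 2, 3, 5] - dxWedge ![0, 1, 4, 5] - dxWedge ![0, 1, 3, 6]

/-- A `G₂`-form on a 7-manifold: a smooth 3-form which is at every point identified with `phi0` by
some linear isomorphism of the tangent space with `ℝ⁷`. -/
structure G2Structure (M : Type*) [TopologicalSpace M] [ChartedSpace E7 M] where
  /-- the 3-form `φ` -/
  form : DForm M 3
  smooth : DForm.IsSmooth form
  exists_frame : ∀ m : M, ∃ σ : TangentSpace (𝓡 7) m ≃L[ℝ] E7,
    form m = phi0.compContinuousLinearMap (σ : TangentSpace (𝓡 7) m →L[ℝ] E7)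

namespace G2Structure

variable {M : Type*} [TopologicalSpace M] [ChartedSpace E7 M] (P : G2Structure M)

/-- A linear isomorphism of the tangent space at `m` with `ℝ⁷` carrying `phi0` to `φ`. It is unique
up to the group `G₂` of linear automorphisms of `ℝ⁷` that preserve `phi0`; as these preserve the
Euclidean metric and `starPhi0` too, the notions defined below do not depend on the choice. -/
noncomputable def frame (m : M) : TangentSpace (𝓡 7) m ≃L[ℝ] E7 :=
  Classical.choose (P.exists_frame m)

theorem form_eq (m : M) :
    P.form m = phi0.compContinuousLinearMap (P.frame m : TangentSpace (𝓡 7) m →L[ℝ] E7) :=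
  Classical.choose_spec (P.exists_frame m)

/-- The Riemannian metric determined by `φ`. -/
noncomputable def metric (m : M) (u v : TangentSpace (𝓡 7) m) : ℝ :=
  inner ℝ (P.frame m u) (P.frame m v)

/-- The 4-form `∗φ`, the Hodge dual of `φ` for the metric and orientation determined by `φ`. -/
noncomputable def starForm : DForm M 4 := fun m =>
  starPhi0.compContinuousLinearMap (P.frame m : TangentSpace (𝓡 7) m →L[ℝ] E7)

/-- `φ` is closed and coclosed. -/
def TorsionFree : Prop := DForm.IsClosed P.form ∧ DForm.IsClosed P.starForm

/-- The gradient of a function for the metric of `φ`. -/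
noncomputable def gradient (g : M → ℝ) (m : M) : TangentSpace (𝓡 7) m :=
  (P.frame m).symm ((InnerProductSpace.toDual ℝ E7).symm
    ((differential g m).comp ((P.frame m).symm : E7 →L[ℝ] TangentSpace (𝓡 7) m)))

theorem metric_gradient (g : M → ℝ) (m : M) (w : TangentSpace (𝓡 7) m) :
    P.metric m (P.gradient g m) w = differential g m w := by
  simp [metric, gradient]

/-- A subspace of a tangent space is coassociative if it is 4-dimensional and calibrated by `∗φ`:
on it `∗φ` is, up to the choice of the orientation, the volume form of the metric. -/
def IsCoassociative {m : M} (W : Submodule ℝ (TangentSpace (𝓡 7) m)) : Prop :=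
  Module.finrank ℝ W = 4 ∧
    ∀ e : Fin 4 → TangentSpace (𝓡 7) m, (∀ i, e i ∈ W) →
      (∀ i j, P.metric m (e i) (e j) = if i = j then 1 else 0) → |P.starForm m e| = 1

/-- `γ`, restricted to the open interval `I`, is a non-constant maximal trajectory of the gradient
flow of `g` (the values of `γ` outside `I` are irrelevant). -/
structure IsGradientLine (g : M → ℝ) (γ : ℝ → M) (I : Set ℝ) : Prop where
  isOpen : IsOpen I
  ordConnected : I.OrdConnected
  integralCurve : IsMIntegralCurveOn (I := 𝓡 7) γ (P.gradient g) I
  maximal : ∀ (γ' : ℝ → M) (I' : Set ℝ), IsOpen I' → I'.OrdConnected → I ⊆ I' →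
    EqOn γ γ' I → IsMIntegralCurveOn (I := 𝓡 7) γ' (P.gradient g) I' → I' = I
  nonconstant : ∃ s ∈ I, ∃ t ∈ I, γ s ≠ γ t

end G2Structure

/-! ## Actions of `SO(3)` -/

section Action

variable {M : Type*} [TopologicalSpace M] [ChartedSpace E7 M] [MulAction SO3 M]

/-- The vector fields `X₁, X₂, X₃` on `M` generating the action, `Xᵢ = d/dt (exp (t eᵢ) • m)` at
`t = 0` (the indices in the code start at `0`). -/
noncomputable def actionField (i : Fin 3) (m : M) : TangentSpace (𝓡 7) m :=
  mfderiv 𝓘(ℝ, ℝ) (𝓡 7) (fun t : ℝ => SO3.rotation i t • m) 0 (1 : ℝ)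

/-- A point is regular if the differential of the action `𝔰𝔬(3) → T_m M`, which maps `eᵢ` to
`Xᵢ m`, is injective. -/
def IsRegularPoint (m : M) : Prop :=
  LinearIndependent ℝ (fun i : Fin 3 => (actionField i m : TangentSpace (𝓡 7) m))

/-- The action preserves the `G₂`-form. -/
def G2Structure.IsInvariant (P : G2Structure M) : Prop :=
  ∀ (A : SO3) (m : M), (P.form (A • m)).compContinuousLinearMap
    (mfderiv (𝓡 7) (𝓡 7) (fun x : M => A • x) m) = P.form m

/-- The subset `SO(3) · ℓ` of `M` swept out by the curve `ℓ = γ(I)`. -/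
def sweep (γ : ℝ → M) (I : Set ℝ) : Set M := {x | ∃ A : SO3, ∃ t ∈ I, x = A • γ t}

/-- The family of the subsets `SO(3) · ℓ`, for the gradient lines `ℓ` of `g`. -/
def G2Structure.sweptFamily (P : G2Structure M) (g : M → ℝ) : Set (Set M) :=
  {L | ∃ (γ : ℝ → M) (I : Set ℝ), P.IsGradientLine g γ I ∧ L = sweep γ I}

end Action

/-! Both forms `φ` and `∗φ` are closed and invariant, and the bracket of two of the fields `Xᵢ` is,
up to sign, the third. Expanding the exterior derivative of a contraction, every Lie derivative term
vanishes by invariance and every bracket term vanishes because it repeats a field. Hence the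
function `φ(X₁,X₂,X₃)` is locally constant (`contraction_const`) and the 1-form
`i_{X₁}i_{X₂}i_{X₃}(∗φ)` is closed (`contraction_closed`). The function vanishes at a non-regular
point, so on the connected manifold it vanishes everywhere. The 1-form is `dg` because `b₁ = 0`; it
kills the `Xᵢ`, so `g` is constant on orbits.

The remaining input is pointwise. If `φ₀(a,b,c) = 0`, the vector `n` dual to `∗φ₀(c,b,a,·)` is
orthogonal to `a, b, c` and `|n|²` is their Gram determinant. So `n ≠ 0` when they are independent,
and `∗φ₀(c,b,a,n) = |n|²` is the 4-volume of `c, b, a, n`: their span is coassociative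
(`coassociative_tripleCross`). At a regular point `n` is the gradient of `g`. This identifies the
critical points and makes the span of the `Xᵢ` and `∇g` coassociative.

The gradient is invariant, so rotations permute its trajectories; uniqueness of maximal integral
curves then makes the swept sets equal or disjoint. Along a gradient line `g` increases strictly.
For `F(A,s) = A • γ(r s)`, the value `g(F(A,s))` determines `s` and freeness determines `A`;
compactness of `SO(3)` makes `F` an embedding.

A technical obstacle is that the pointwise frames come from choice and need not vary smoothly. The
metric and `∗φ` are therefore written as explicit expressions in the coefficients of `φ` (`gramOf`,
`starCoeff`), whose smoothness is visible. -/

set_option linter.unusedSectionVars false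

/-! ### Algebra of `phi0`: the cross product and the dual 4-form. -/

theorem phi0_apply (a b c : E7) : phi0 ![a, b, c] =
    (dxWedge ![0, 1, 2] ![a,b,c]+ dxWedge ![0, 3, 4] ![a,b,c] + dxWedge ![0, 5, 6] ![a,b,c] + dxWedge ![1, 3, 5] ![a,b,c]
    - dxWedge ![1, 4, 6] ![a,b,c] - dxWedge ![2, 3, 6] ![a,b,c] - dxWedge ![2, 4, 5] ![a,b,c]) := rfl

theorem dxWedge_three (i j k : Fin 7) (a b c : E7) : dxWedge ![i, j, k] ![a, b, c] =
    a i * (b j * c k - b k * c j) - a j * (b i * c k - b k * c i) + a k * (b i * c j - b j * c i) := by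
  rw [dxWedge_apply, Matrix.det_fin_three]
  simp
  ring

theorem dxWedge_four (i j k l : Fin 7) (a b c d : E7) : dxWedge ![i, j, k, l] ![a, b, c, d] =
    a i * dxWedge ![j, k, l] ![b, c, d] - a j * dxWedge ![i, k, l] ![b, c, d]
    + a k * dxWedge ![i, j, l] ![b, c, d] - a l * dxWedge ![i, j, k] ![b, c, d] := by
  simp only [dxWedge_three]
  rw [dxWedge_apply, Matrix.det_succ_row_zero]
  simp [Fin.sum_univ_four, Matrix.det_fin_three, Matrix.submatrix, Fin.succAbove]
  ring

/-- The cross product of `ℝ⁷` defined by `phi0`. -/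
noncomputable def cross7 (a b : E7) : E7 :=
  WithLp.toLp 2 fun k => phi0 ![a, b, EuclideanSpace.single k 1]

theorem phi0_cross (a b c : E7) : inner ℝ (cross7 a b) c = phi0 ![a, b, c] := by
  simp only [cross7, PiLp.inner_apply, Fin.sum_univ_seven, phi0_apply, dxWedge_three]
  simp
  ring

-- A polynomial identity in the 28 coordinates. It expresses `∗φ₀` through the metric and the cross
-- product; since the left side is alternating, repeating an argument turns it into the metric
-- identities for `cross7` used below.
set_option maxHeartbeats 1000000 in
theorem starPhi0_eq (a b c d : E7) : starPhi0 ![a, b, c, d] =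
    inner ℝ (cross7 a b) (cross7 c d) - (inner ℝ a c * inner ℝ b d - inner ℝ a d * inner ℝ b c) := by
  have h : starPhi0 ![a, b, c, d] = dxWedge ![3, 4, 5, 6] ![a, b, c, d] + dxWedge ![1, 2, 5, 6] ![a, b, c, d]
    + dxWedge ![1, 2, 3, 4] ![a, b, c, d] + dxWedge ![0, 2, 4, 6] ![a, b, c, d]
    - dxWedge ![0, 2, 3, 5] ![a, b, c, d] - dxWedge ![0, 1, 4, 5] ![a, b, c, d]
    - dxWedge ![0, 1, 3, 6] ![a, b, c, d] := rfl
  rw [h]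
  simp only [dxWedge_four, dxWedge_three, cross7, PiLp.inner_apply, Fin.sum_univ_seven, phi0_apply]
  simp
  ring

/-! ### Recovering the metric and `∗φ` from the 3-form. -/

theorem det_one_add_vecMulVec {n : Type*} [Fintype n] [DecidableEq n] (x y : n → ℝ) :
    (1 + Matrix.vecMulVec x y).det = 1 + y ⬝ᵥ x := by
  rw [Matrix.vecMulVec_eq Unit, Matrix.det_one_add_replicateCol_mul_replicateRow]

theorem dotProduct_mulVec_self_of_skew {n : Type*} [Fintype n] {N : Matrix n n ℝ}
    (hT : Nᵀ = -N) (x : n → ℝ) : x ⬝ᵥ (N *ᵥ x) = 0 := by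
  have h : x ⬝ᵥ (N *ᵥ x) = -(x ⬝ᵥ (N *ᵥ x)) := by
    calc x ⬝ᵥ (N *ᵥ x) = x ⬝ᵥ (Nᵀ *ᵥ x) := by
          rw [Matrix.mulVec_transpose, dotProduct_comm x (x ᵥ* N), Matrix.dotProduct_mulVec]
      _ = _ := by rw [hT, Matrix.neg_mulVec, dotProduct_neg]
  linarith

/-- The matrix `N` is singular, having odd size, so it is shifted by `t`. Transposition gives `det
(N + t) = det (-N + t)`, and the product of these two matrices is a scalar matrix minus `w wᵀ`; the
matrix determinant lemma then handles `η ηᵀ`. -/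
theorem det_add_outer_sq_of_ne {N : Matrix (Fin 7) (Fin 7) ℝ} {w : Fin 7 → ℝ} (η : Fin 7 → ℝ)
    (hT : Nᵀ = -N) (hw : N *ᵥ w = 0)
    (h2 : N * N = Matrix.vecMulVec w w - (w ⬝ᵥ w) • (1 : Matrix (Fin 7) (Fin 7) ℝ))
    {t : ℝ} (ht : t ≠ 0) :
    (N + t • (1 : Matrix (Fin 7) (Fin 7) ℝ) + Matrix.vecMulVec η η).det ^ 2 =
      (t ^ 2 + w ⬝ᵥ w) ^ 4 *
        (t * (t ^ 2 + w ⬝ᵥ w) + t ^ 2 * (η ⬝ᵥ η) + (η ⬝ᵥ w) ^ 2) ^ 2 := by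
  set s := w ⬝ᵥ w with hs
  have hs0 : 0 ≤ s := by
    rw [hs]; simpa using dotProduct_star_self_nonneg w
  have hts : t ^ 2 + s ≠ 0 := by positivity
  set O : Matrix (Fin 7) (Fin 7) ℝ := 1 with hO
  have hNw : N * Matrix.vecMulVec w w = 0 := by
    rw [Matrix.mul_vecMulVec, hw, Matrix.zero_vecMulVec]
  have h1 : (N + t • O).det ^ 2 = (t ^ 2 + s) ^ 6 * t ^ 2 := by
    have hd : (N + t • O).det = (-N + t • O).det := by
      rw [← Matrix.det_transpose, Matrix.transpose_add, hT, Matrix.transpose_smul, hO,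
        Matrix.transpose_one]
    have hp : (N + t • O) * (-N + t • O) =
        (t ^ 2 + s) • (1 + Matrix.vecMulVec (-(t ^ 2 + s)⁻¹ • w) w) := by
      rw [add_mul, mul_add, mul_add, mul_neg, h2]
      simp only [hO, Matrix.smul_vecMulVec, smul_add, smul_smul, smul_mul_assoc, mul_smul_comm, mul_one,
        one_mul]
      rw [mul_neg, mul_inv_cancel₀ hts]
      module
    rw [sq]
    nth_rewrite 2 [hd]
    rw [← Matrix.det_mul, hp, Matrix.det_smul, det_one_add_vecMulVec, dotProduct_smul, ← hs]
    simp only [Fintype.card_fin, smul_eq_mul]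
    field_simp
    ring
  -- Up to the factor `t ^ 2 + s`, this is the inverse of `N + t`.
  set K : Matrix (Fin 7) (Fin 7) ℝ := -N + t • O + t⁻¹ • Matrix.vecMulVec w w with hK
  have hK1 : (N + t • O) * K = (t ^ 2 + s) • O := by
    rw [hK, mul_add, mul_add, add_mul, add_mul, add_mul, mul_neg, h2]
    simp only [hO, smul_mul_assoc, mul_smul_comm, mul_one, one_mul, smul_smul, hNw, smul_zero,
      inv_mul_cancel₀ ht]
    module
  have h3 : N + t • O + Matrix.vecMulVec η η =
      (N + t • O) * (1 + Matrix.vecMulVec ((t ^ 2 + s)⁻¹ • K *ᵥ η) η) := by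
    rw [mul_add, mul_one, Matrix.mul_vecMulVec, Matrix.mulVec_smul, Matrix.mulVec_mulVec, hK1,
      Matrix.smul_mulVec, smul_smul, inv_mul_cancel₀ hts, hO, Matrix.one_mulVec, one_smul]
  have h4 : η ⬝ᵥ (K *ᵥ η) = t * (η ⬝ᵥ η) + t⁻¹ * (η ⬝ᵥ w) ^ 2 := by
    rw [hK, Matrix.add_mulVec, Matrix.add_mulVec, dotProduct_add, dotProduct_add,
      Matrix.neg_mulVec, dotProduct_neg, dotProduct_mulVec_self_of_skew hT, hO, Matrix.smul_mulVec,
      Matrix.one_mulVec, Matrix.smul_mulVec, Matrix.vecMulVec_mulVec]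
    simp [dotProduct_smul, dotProduct_comm w η, -mul_eq_mul_left_iff]
    ring
  rw [h3, Matrix.det_mul, mul_pow, h1, det_one_add_vecMulVec, dotProduct_smul, h4, smul_eq_mul]
  have h5 : t * (1 + (t ^ 2 + s)⁻¹ * (t * (η ⬝ᵥ η) + t⁻¹ * (η ⬝ᵥ w) ^ 2)) =
      (t * (t ^ 2 + s) + t ^ 2 * (η ⬝ᵥ η) + (η ⬝ᵥ w) ^ 2) / (t ^ 2 + s) := by
    field_simp
    ring
  rw [mul_assoc, ← mul_pow, h5, div_pow]
  field_simp

/-- Both sides of the shifted identity are continuous in `t` and agree off `0`, hence also at `t =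
0`. -/
theorem det_add_outer_sq {N : Matrix (Fin 7) (Fin 7) ℝ} {w : Fin 7 → ℝ} (η : Fin 7 → ℝ)
    (hT : Nᵀ = -N) (hw : N *ᵥ w = 0)
    (h2 : N * N = Matrix.vecMulVec w w - (w ⬝ᵥ w) • (1 : Matrix (Fin 7) (Fin 7) ℝ)) :
    (N + Matrix.vecMulVec η η).det ^ 2 = (w ⬝ᵥ w) ^ 4 * (η ⬝ᵥ w) ^ 4 := by
  have h := Continuous.ext_on (dense_compl_singleton (0 : ℝ))
    (f := fun t => (N + t • (1 : Matrix (Fin 7) (Fin 7) ℝ) + Matrix.vecMulVec η η).det ^ 2)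
    (g := fun t => (t ^ 2 + w ⬝ᵥ w) ^ 4 *
        (t * (t ^ 2 + w ⬝ᵥ w) + t ^ 2 * (η ⬝ᵥ η) + (η ⬝ᵥ w) ^ 2) ^ 2)
    (by fun_prop) (by fun_prop) (fun t ht => det_add_outer_sq_of_ne η hT hw h2 ht)
  have h0 := congrFun h 0
  simp at h0
  rw [h0]
  ring

/-- The matrix of the 2-form `i_u α` in the standard basis. -/
noncomputable def contractionMatrix (α : E7 [⋀^Fin 3]→L[ℝ] ℝ) (u : E7) : Matrix (Fin 7) (Fin 7) ℝ :=
  Matrix.of fun i j => α ![u, EuclideanSpace.single i 1, EuclideanSpace.single j 1]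

theorem phi0_contraction_transpose (w : E7) :
    (contractionMatrix phi0 w)ᵀ = -contractionMatrix phi0 w := by
  ext i j
  simp only [contractionMatrix, Matrix.transpose_apply, Matrix.of_apply, Matrix.neg_apply,
    phi0_apply, dxWedge_three]
  ring

theorem phi0_contraction_self (w : E7) : contractionMatrix phi0 w *ᵥ w = 0 := by
  ext i
  have h : phi0 ![w, EuclideanSpace.single i 1, w] = 0 :=
    phi0.map_eq_zero_of_eq _ (i := 0) (j := 2) rfl (by decide)
  rw [← phi0_cross, PiLp.inner_apply] at h
  simpa [contractionMatrix, Matrix.mulVec, dotProduct, cross7, mul_comm] using h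

/-- This is `⟨w × x, w × y⟩ = |w|²⟨x,y⟩ - ⟨w,x⟩⟨w,y⟩`, from `starPhi0_eq` with `w` repeated, and
skewness of the contraction. -/
theorem phi0_contraction_sq (w : E7) : contractionMatrix phi0 w * contractionMatrix phi0 w =
    Matrix.vecMulVec w w - (w ⬝ᵥ w) • (1 : Matrix (Fin 7) (Fin 7) ℝ) := by
  have hT : contractionMatrix phi0 w * contractionMatrix phi0 w =
      -(contractionMatrix phi0 w * (contractionMatrix phi0 w)ᵀ) := by
    rw [phi0_contraction_transpose, mul_neg, neg_neg]
  rw [hT]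
  ext i j
  have h : starPhi0 ![w, EuclideanSpace.single i 1, w, EuclideanSpace.single j 1] = 0 :=
    starPhi0.map_eq_zero_of_eq _ (i := 0) (j := 2) rfl (by decide)
  rw [starPhi0_eq, PiLp.inner_apply, PiLp.inner_apply w w] at h
  simp [contractionMatrix, cross7, Matrix.mul_apply, Matrix.vecMulVec_apply, Matrix.one_apply,
    dotProduct, EuclideanSpace.inner_single_left, EuclideanSpace.inner_single_right, eq_comm (a := j)] at h ⊢
  simp only [← sq, mul_comm (phi0 ![w, EuclideanSpace.single j 1, _])] at h ⊢
  split_ifs at h ⊢ <;> linarith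

theorem phi0_eq_dotProduct (w x y : E7) :
    phi0 ![w, x, y] = x ⬝ᵥ (contractionMatrix phi0 w *ᵥ y) := by
  simp only [contractionMatrix, Matrix.mulVec, dotProduct, Fin.sum_univ_seven, Matrix.of_apply,
    phi0_apply, dxWedge_three]
  simp
  ring

/-- The standard basis vectors of `ℝ⁷`. -/
noncomputable abbrev stdE (i : Fin 7) : E7 := EuclideanSpace.single i 1

theorem sum_smul_stdE (u : E7) : ∑ i, u i • stdE i = u := by
  ext j
  simp [stdE, Pi.single_apply]

/-- The matrix of a linear endomorphism of `ℝ⁷`. -/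
noncomputable def matE (L : E7 →L[ℝ] E7) : Matrix (Fin 7) (Fin 7) ℝ :=
  Matrix.of fun i j => L (stdE j) i

theorem matE_mulVec (L : E7 →L[ℝ] E7) (u : E7) : matE L *ᵥ u = (L u).ofLp := by
  ext i
  conv_rhs => rw [← sum_smul_stdE u]
  simp [matE, Matrix.mulVec, dotProduct, mul_comm]

theorem matE_mul_symm (σ : E7 ≃L[ℝ] E7) :
    matE (σ : E7 →L[ℝ] E7) * matE (σ.symm : E7 →L[ℝ] E7) = 1 := by
  ext i j
  have h := congrFun (matE_mulVec (σ : E7 →L[ℝ] E7) (σ.symm (stdE j))) i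
  simp [Matrix.mulVec, dotProduct] at h
  simp [Matrix.mul_apply, Matrix.one_apply]
  rw [← h]
  rfl

theorem det_matE_ne (σ : E7 ≃L[ℝ] E7) : (matE (σ : E7 →L[ℝ] E7)).det ≠ 0 := by
  intro h
  have h1 := congrArg Matrix.det (matE_mul_symm σ)
  rw [Matrix.det_mul, h, zero_mul, Matrix.det_one] at h1
  exact zero_ne_one h1

theorem inner_E7 (u v : E7) : inner ℝ u v = u.ofLp ⬝ᵥ v.ofLp := by
  simp [PiLp.inner_apply, dotProduct, mul_comm]

theorem contractionMatrix_comp (L : E7 →L[ℝ] E7) (u : E7) :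
    contractionMatrix (phi0.compContinuousLinearMap L) u =
      (matE L)ᵀ * contractionMatrix phi0 (L u) * matE L := by
  ext i j
  have h : contractionMatrix (phi0.compContinuousLinearMap L) u i j =
      phi0 ![L u, L (stdE i), L (stdE j)] := by
    simp only [contractionMatrix, Matrix.of_apply, ContinuousAlternatingMap.compContinuousLinearMap_apply]
    congr 1
    ext k
    fin_cases k <;> rfl
  rw [h, phi0_eq_dotProduct, Matrix.mul_assoc]
  simp [Matrix.mul_apply, dotProduct, Matrix.mulVec, matE]

/-- For `α = σ^* phi0` this is `|det σ| ⟨σ u, σ u⟩`. -/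
noncomputable def scaledNormSq (α : E7 [⋀^Fin 3]→L[ℝ] ℝ) (u : E7) : ℝ :=
  -- The contraction alone is singular, whence the added `u uᵀ`. Squaring the determinant first
  -- makes the fourth root independent of its sign; division by `u ⬝ᵥ u` removes the contribution of
  -- the added term.
  √√((contractionMatrix α u + Matrix.vecMulVec u u).det ^ 2) / (u ⬝ᵥ u)

theorem dot_self_pos {u : E7} (hu : u ≠ 0) : 0 < u.ofLp ⬝ᵥ u.ofLp := by
  rw [← inner_E7]
  exact real_inner_self_pos.2 hu

/-- With `η = σ⁻ᵀ u` the matrix is `σᵀ (N + η ηᵀ) σ`, where `N` is the contraction of `phi0` with `σ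
u`, and `η · σ u = u · u`; so `det_add_outer_sq` applies. -/
theorem det_contraction_sq (σ : E7 ≃L[ℝ] E7) (u : E7) :
    (contractionMatrix (phi0.compContinuousLinearMap (σ : E7 →L[ℝ] E7)) u +
      Matrix.vecMulVec u u).det ^ 2 =
    ((matE (σ : E7 →L[ℝ] E7)).det * inner ℝ (σ u) (σ u) * (u ⬝ᵥ u) ^ 2
        * inner ℝ (σ u) (σ u) * (matE (σ : E7 →L[ℝ] E7)).det) ^ 2 := by
  set A := matE (σ : E7 →L[ℝ] E7) with hA
  set B := matE (σ.symm : E7 →L[ℝ] E7) with hB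
  have hAB : A * B = 1 := matE_mul_symm σ
  have hBA : B * A = 1 := mul_eq_one_comm.1 hAB
  set η : Fin 7 → ℝ := Bᵀ *ᵥ u with hη
  have h1 : Matrix.vecMulVec u u = Aᵀ * Matrix.vecMulVec η η * A := by
    rw [Matrix.mul_vecMulVec, Matrix.vecMulVec_mul, hη, Matrix.mulVec_mulVec, ← Matrix.transpose_mul,
      hBA, Matrix.transpose_one, Matrix.one_mulVec, ← Matrix.mulVec_transpose, Matrix.mulVec_mulVec, ← Matrix.transpose_mul,
      hBA, Matrix.transpose_one, Matrix.one_mulVec]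
  have h2 : η ⬝ᵥ (σ u).ofLp = u ⬝ᵥ u := by
    have : (σ u).ofLp = A *ᵥ u := (matE_mulVec (σ : E7 →L[ℝ] E7) u).symm
    rw [this, hη, Matrix.mulVec_transpose, ← Matrix.dotProduct_mulVec, Matrix.mulVec_mulVec, hBA, Matrix.one_mulVec]
  rw [contractionMatrix_comp, h1, ← add_mul, ← mul_add, Matrix.det_mul, Matrix.det_mul,
    Matrix.det_transpose, mul_pow, mul_pow]
  have h3 := det_add_outer_sq η (phi0_contraction_transpose (σ u)) (phi0_contraction_self (σ u))
    (phi0_contraction_sq (σ u))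
  rw [ContinuousLinearEquiv.coe_coe, h3, h2, inner_E7]
  ring

theorem scaledNormSq_eq (σ : E7 ≃L[ℝ] E7) {u : E7} (hu : u ≠ 0) :
    scaledNormSq (phi0.compContinuousLinearMap (σ : E7 →L[ℝ] E7)) u =
      |(matE (σ : E7 →L[ℝ] E7)).det| * inner ℝ (σ u) (σ u) := by
  have hp := dot_self_pos hu
  have h0 : 0 ≤ inner ℝ (σ u) (σ u) := real_inner_self_nonneg
  rw [scaledNormSq, det_contraction_sq, div_eq_iff hp.ne', Real.sqrt_sq_eq_abs,
    Real.sqrt_eq_iff_mul_self_eq (abs_nonneg _) (by positivity)]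
  rw [abs_mul, abs_mul, abs_mul, abs_mul, abs_of_nonneg h0, abs_of_nonneg (sq_nonneg (u.ofLp ⬝ᵥ u.ofLp))]
  ring

theorem det_contraction_sq_pos (σ : E7 ≃L[ℝ] E7) {u : E7} (hu : u ≠ 0) :
    0 < (contractionMatrix (phi0.compContinuousLinearMap (σ : E7 →L[ℝ] E7)) u +
      Matrix.vecMulVec u u).det ^ 2 := by
  have hp := dot_self_pos hu
  have h0 : 0 < inner ℝ (σ u) (σ u) := real_inner_self_pos.2 (by simpa using hu)
  have hd := det_matE_ne σ
  rw [det_contraction_sq]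
  exact pow_pos (abs_pos.2 (by positivity)) 2 |>.trans_eq (sq_abs _)

theorem stdE_ne (i : Fin 7) : stdE i ≠ 0 := by simp [stdE]

theorem stdE_add_ne (i j : Fin 7) : stdE i + stdE j ≠ 0 := by
  intro h
  have h1 := congrArg (fun v : E7 => v.ofLp i) h
  by_cases hij : i = j
  · subst hij; norm_num at h1
  · norm_num [hij] at h1

/-- For `α = σ^* phi0` this is `|det σ|` times the Gram matrix of `σ`. -/
noncomputable def scaledGram (α : E7 [⋀^Fin 3]→L[ℝ] ℝ) : Matrix (Fin 7) (Fin 7) ℝ :=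
  Matrix.of fun i j => (scaledNormSq α (stdE i + stdE j) - scaledNormSq α (stdE i) - scaledNormSq α (stdE j)) / 2

/-- The Gram matrix of the metric determined by a 3-form. -/
noncomputable def gramOf (α : E7 [⋀^Fin 3]→L[ℝ] ℝ) : Matrix (Fin 7) (Fin 7) ℝ :=
  -- For `α = σ^* phi0` the scaled Gram matrix has determinant `|det σ| ^ 9`: the power 7 comes from
  -- the scalar factor in dimension 7, the power 2 from `σᵀ σ`. This exponent therefore cancels the
  -- factor `|det σ|`.
  (scaledGram α).det ^ (-(1 / 9) : ℝ) • scaledGram α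

theorem scaledGram_eq (σ : E7 ≃L[ℝ] E7) :
    scaledGram (phi0.compContinuousLinearMap (σ : E7 →L[ℝ] E7)) =
      |(matE (σ : E7 →L[ℝ] E7)).det| • ((matE (σ : E7 →L[ℝ] E7))ᵀ * matE (σ : E7 →L[ℝ] E7)) := by
  ext i j
  have h : ((matE (σ : E7 →L[ℝ] E7))ᵀ * matE (σ : E7 →L[ℝ] E7)) i j = inner ℝ (σ (stdE i)) (σ (stdE j)) := by
    rw [inner_E7]; rfl
  rw [Matrix.smul_apply, h, scaledGram, Matrix.of_apply, scaledNormSq_eq σ (stdE_add_ne i j),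
    scaledNormSq_eq σ (stdE_ne i), scaledNormSq_eq σ (stdE_ne j), map_add, inner_add_left, inner_add_right,
    inner_add_right, real_inner_comm (σ (stdE i)) (σ (stdE j)), smul_eq_mul]
  ring

theorem det_scaledGram (σ : E7 ≃L[ℝ] E7) :
    (scaledGram (phi0.compContinuousLinearMap (σ : E7 →L[ℝ] E7))).det =
      |(matE (σ : E7 →L[ℝ] E7)).det| ^ 9 := by
  rw [scaledGram_eq, Matrix.det_smul, Matrix.det_mul, Matrix.det_transpose, Fintype.card_fin, ← abs_mul_abs_self (Matrix.det _)]
  ring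

theorem gramOf_eq (σ : E7 ≃L[ℝ] E7) :
    gramOf (phi0.compContinuousLinearMap (σ : E7 →L[ℝ] E7)) =
      (matE (σ : E7 →L[ℝ] E7))ᵀ * matE (σ : E7 →L[ℝ] E7) := by
  have hd : 0 < |(matE (σ : E7 →L[ℝ] E7)).det| := abs_pos.2 (det_matE_ne σ)
  have h9 : (|(matE (σ : E7 →L[ℝ] E7)).det| ^ 9) ^ (-(1 / 9) : ℝ) = |(matE (σ : E7 →L[ℝ] E7)).det|⁻¹ := by
    rw [← Real.rpow_natCast, ← Real.rpow_mul hd.le, ← Real.rpow_neg_one]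
    norm_num
  rw [gramOf, det_scaledGram, scaledGram_eq, h9, smul_smul, inv_mul_cancel₀ hd.ne', one_smul]

theorem gramOf_apply (σ : E7 ≃L[ℝ] E7) (i j : Fin 7) :
    gramOf (phi0.compContinuousLinearMap (σ : E7 →L[ℝ] E7)) i j =
      inner ℝ (σ (stdE i)) (σ (stdE j)) := by
  rw [gramOf_eq, inner_E7]; rfl

/-- The coefficients of the 4-form determined by a 3-form. -/
noncomputable def starCoeff (α : E7 [⋀^Fin 3]→L[ℝ] ℝ) (s : Fin 4 → Fin 7) : ℝ :=
  (fun p => α ![stdE (s 0), stdE (s 1), stdE p]) ⬝ᵥ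
      ((gramOf α)⁻¹ *ᵥ fun q => α ![stdE (s 2), stdE (s 3), stdE q]) -
    (gramOf α (s 0) (s 2) * gramOf α (s 1) (s 3) - gramOf α (s 0) (s 3) * gramOf α (s 1) (s 2))

/-- This is `starPhi0_eq` pulled back by `σ`. The covectors `α(a,b,·)` are dual to the cross
products, so their inner product is taken with the inverse Gram matrix. -/
theorem starCoeff_eq (σ : E7 ≃L[ℝ] E7) (s : Fin 4 → Fin 7) :
    starCoeff (phi0.compContinuousLinearMap (σ : E7 →L[ℝ] E7)) s =
      starPhi0.compContinuousLinearMap (σ : E7 →L[ℝ] E7) (fun k => stdE (s k)) := by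
  have hs : starPhi0.compContinuousLinearMap (σ : E7 →L[ℝ] E7) (fun k => stdE (s k)) =
      starPhi0 ![σ (stdE (s 0)), σ (stdE (s 1)), σ (stdE (s 2)), σ (stdE (s 3))] := by
    rw [ContinuousAlternatingMap.compContinuousLinearMap_apply]
    congr 1
    ext k
    fin_cases k <;> rfl
  have hα : ∀ a b : E7, (fun p => phi0.compContinuousLinearMap (σ : E7 →L[ℝ] E7) ![a, b, stdE p]) =
      (matE (σ : E7 →L[ℝ] E7))ᵀ *ᵥ (cross7 (σ a) (σ b)) := by
    intro a b
    ext p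
    have : phi0.compContinuousLinearMap (σ : E7 →L[ℝ] E7) ![a, b, stdE p] = phi0 ![σ a, σ b, σ (stdE p)] := by
      rw [ContinuousAlternatingMap.compContinuousLinearMap_apply]
      congr 1
      ext k
      fin_cases k <;> rfl
    rw [this, ← phi0_cross, inner_E7, dotProduct_comm]
    rfl
  have hinv : (matE (σ : E7 →L[ℝ] E7)) * ((matE (σ : E7 →L[ℝ] E7))ᵀ * matE (σ : E7 →L[ℝ] E7))⁻¹ *
      (matE (σ : E7 →L[ℝ] E7))ᵀ = 1 := by
    have hu := isUnit_iff_ne_zero.2 (det_matE_ne σ)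
    rw [Matrix.mul_inv_rev, ← mul_assoc, Matrix.mul_nonsing_inv _ hu, one_mul,
      Matrix.nonsing_inv_mul _ (by rwa [Matrix.det_transpose])]
  rw [hs, starPhi0_eq, starCoeff, hα, hα]
  simp only [gramOf_apply]
  rw [gramOf_eq, Matrix.mulVec_transpose (matE (σ : E7 →L[ℝ] E7)) (cross7 (σ (stdE (s 0))) (σ (stdE (s 1)))).ofLp,
    ← Matrix.dotProduct_mulVec, Matrix.mulVec_mulVec, Matrix.mulVec_mulVec, hinv,
    Matrix.one_mulVec, inner_E7 (cross7 _ _)]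

theorem alternating_expand {k : ℕ} (α : E7 [⋀^Fin k]→L[ℝ] ℝ) (V : Fin k → E7) :
    α V = ∑ s : Fin k → Fin 7, (∏ i, V i (s i)) * α (fun i => stdE (s i)) := by
  conv_lhs => rw [show V = fun i => ∑ j, V i j • stdE j from funext fun i => (sum_smul_stdE (V i)).symm]
  have h := (α.toMultilinearMap).map_sum (fun i j => V i j • stdE j)
  refine h.trans (Finset.sum_congr rfl fun s _ => ?_)
  exact (α.toMultilinearMap).map_smul_univ (fun i => V i (s i)) (fun i => stdE (s i))

theorem alternating_ext_stdE {k : ℕ} {α β : E7 [⋀^Fin k]→L[ℝ] ℝ}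
    (h : ∀ s : Fin k → Fin 7, α (fun i => stdE (s i)) = β (fun i => stdE (s i))) : α = β := by
  ext V
  rw [alternating_expand, alternating_expand β]
  simp only [h]

theorem inner_map_eq (σ : E7 ≃L[ℝ] E7) (u v : E7) : inner ℝ (σ u) (σ v) =
    u ⬝ᵥ (gramOf (phi0.compContinuousLinearMap (σ : E7 →L[ℝ] E7)) *ᵥ v) := by
  rw [gramOf_eq, ← Matrix.mulVec_mulVec, matE_mulVec, inner_E7, Matrix.mulVec_transpose,
    dotProduct_comm u.ofLp, ← Matrix.dotProduct_mulVec, matE_mulVec, dotProduct_comm]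
  rfl

/-- The Gram matrix is a function of the 3-form alone, so the metric does not depend on the frame.
The same argument with `starCoeff` covers the 4-form. -/
theorem inner_eq_of_phi0_comp_eq {σ τ : E7 ≃L[ℝ] E7}
    (h : phi0.compContinuousLinearMap (σ : E7 →L[ℝ] E7) = phi0.compContinuousLinearMap (τ : E7 →L[ℝ] E7))
    (u v : E7) : inner ℝ (σ u) (σ v) = inner ℝ (τ u) (τ v) := by
  rw [inner_map_eq, inner_map_eq, h]

theorem starPhi0_comp_eq {σ τ : E7 ≃L[ℝ] E7}
    (h : phi0.compContinuousLinearMap (σ : E7 →L[ℝ] E7) = phi0.compContinuousLinearMap (τ : E7 →L[ℝ] E7)) :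
    starPhi0.compContinuousLinearMap (σ : E7 →L[ℝ] E7) =
      starPhi0.compContinuousLinearMap (τ : E7 →L[ℝ] E7) :=
  alternating_ext_stdE fun s => by rw [← starCoeff_eq, ← starCoeff_eq, h]

/-! ### Smooth dependence of the metric and of `∗φ` on the 3-form. -/

section Smooth
variable {E : Type*} [NormedAddCommGroup E] [NormedSpace ℝ E] {n : WithTop ℕ∞} {U : Set E}

theorem contDiffOn_alternating_apply {k : ℕ} {α : E → E7 [⋀^Fin k]→L[ℝ] ℝ} {V : Fin k → E → E7}
    (hα : ContDiffOn ℝ n α U) (hV : ∀ i, ContDiffOn ℝ n (V i) U) :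
    ContDiffOn ℝ n (fun y => α y (fun i => V i y)) U := by
  simp only [fun y => alternating_expand (α y) (fun i => V i y)]
  refine ContDiffOn.sum fun s _ => ContDiffOn.mul (contDiffOn_prod fun i _ => ?_) ?_
  · exact contDiffOn_euclidean.1 (hV i) (s i)
  · exact (ContinuousAlternatingMap.apply ℝ E7 ℝ (fun i => stdE (s i))).contDiff.comp_contDiffOn hα

/-- Evaluation on tuples of basis vectors is an injective linear map into a finite-dimensional
space, so a linear left inverse reconstructs the form from its coefficients. -/
theorem contDiffOn_alternating {k : ℕ} {α : E → E7 [⋀^Fin k]→L[ℝ] ℝ}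
    (h : ∀ s : Fin k → Fin 7, ContDiffOn ℝ n (fun y => α y (fun i => stdE (s i))) U) :
    ContDiffOn ℝ n α U := by
  let ev : (E7 [⋀^Fin k]→L[ℝ] ℝ) →ₗ[ℝ] ((Fin k → Fin 7) → ℝ) :=
    { toFun := fun β s => β (fun i => stdE (s i))
      map_add' := fun _ _ => rfl
      map_smul' := fun _ _ => rfl }
  have hinj : LinearMap.ker ev = ⊥ := LinearMap.ker_eq_bot.2 fun β γ hβ =>
    alternating_ext_stdE fun s => congrFun hβ s
  obtain ⟨R, hR⟩ := ev.exists_leftInverse_of_injective hinj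
  have h2 : α = fun y => LinearMap.toContinuousLinearMap R (fun s => α y (fun i => stdE (s i))) := by
    ext1 y
    exact (LinearMap.congr_fun hR (α y)).symm
  rw [h2]
  exact (LinearMap.toContinuousLinearMap R).contDiff.comp_contDiffOn (contDiffOn_pi.2 h)

theorem contDiffOn_det {ι : Type*} [Fintype ι] [DecidableEq ι] {A : E → Matrix ι ι ℝ}
    (h : ∀ i j, ContDiffOn ℝ n (fun y => A y i j) U) : ContDiffOn ℝ n (fun y => (A y).det) U := by
  simp only [Matrix.det_apply]
  exact ContDiffOn.sum fun s _ => (contDiffOn_prod fun i _ => h _ _).const_smul _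

theorem contDiffOn_inv_entry {ι : Type*} [Fintype ι] [DecidableEq ι] {A : E → Matrix ι ι ℝ}
    (h : ∀ i j, ContDiffOn ℝ n (fun y => A y i j) U) (hd : ∀ y ∈ U, (A y).det ≠ 0) (i j : ι) :
    ContDiffOn ℝ n (fun y => (A y)⁻¹ i j) U := by
  simp only [Matrix.inv_def, Ring.inverse_eq_inv', Matrix.smul_apply, Matrix.adjugate_apply, smul_eq_mul]
  refine ((contDiffOn_det h).inv hd).mul (contDiffOn_det fun k l => ?_)
  by_cases hk : k = j
  · subst hk; simp only [Matrix.updateRow_self]; exact contDiffOn_const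
  · simp only [Matrix.updateRow_ne hk]; exact h k l

variable {α : E → E7 [⋀^Fin 3]→L[ℝ] ℝ}

theorem contDiffOn_const_apply {k : ℕ} {α : E → E7 [⋀^Fin k]→L[ℝ] ℝ} (hα : ContDiffOn ℝ n α U) (v : Fin k → E7) :
    ContDiffOn ℝ n (fun y => α y v) U :=
  contDiffOn_alternating_apply hα fun _ => contDiffOn_const

theorem contDiffOn_gramOf (hα : ContDiffOn ℝ n α U)
    (hσ : ∀ y ∈ U, ∃ σ : E7 ≃L[ℝ] E7, α y = phi0.compContinuousLinearMap (σ : E7 →L[ℝ] E7))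
    (i j : Fin 7) : ContDiffOn ℝ n (fun y => gramOf (α y) i j) U := by
  have h1 : ∀ u : E7, u ≠ 0 → ContDiffOn ℝ n (fun y => scaledNormSq (α y) u) U := by
    intro u hu
    -- Strict positivity keeps both square roots away from the point where they fail to be smooth;
    -- this is where `u ≠ 0` matters.
    have hpos : ∀ y ∈ U, 0 < (contractionMatrix (α y) u + Matrix.vecMulVec u u).det ^ 2 := by
      intro y hy
      obtain ⟨σ, h⟩ := hσ y hy
      rw [h]
      exact det_contraction_sq_pos σ hu
    refine ContDiffOn.div_const (ContDiffOn.sqrt (ContDiffOn.sqrt ((contDiffOn_det fun k l => ?_).pow 2) ?_) ?_) _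
    · exact (contDiffOn_const_apply hα _).add contDiffOn_const
    · exact fun y hy => (hpos y hy).ne'
    · exact fun y hy => (Real.sqrt_pos.2 (hpos y hy)).ne'
  have h2 : ∀ i j, ContDiffOn ℝ n (fun y => scaledGram (α y) i j) U := fun i j =>
    (((h1 _ (stdE_add_ne i j)).sub (h1 _ (stdE_ne i))).sub (h1 _ (stdE_ne j))).div_const _
  refine ContDiffOn.mul (ContDiffOn.rpow_const_of_ne (contDiffOn_det h2) fun y hy => ?_) (h2 i j)
  obtain ⟨σ, h⟩ := hσ y hy
  rw [h, det_scaledGram]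
  exact (pow_pos (abs_pos.2 (det_matE_ne σ)) 9).ne'

theorem det_gramOf_ne (σ : E7 ≃L[ℝ] E7) :
    (gramOf (phi0.compContinuousLinearMap (σ : E7 →L[ℝ] E7))).det ≠ 0 := by
  rw [gramOf_eq, Matrix.det_mul, Matrix.det_transpose]
  exact mul_ne_zero (det_matE_ne σ) (det_matE_ne σ)

theorem contDiffOn_starCoeff (hα : ContDiffOn ℝ n α U)
    (hσ : ∀ y ∈ U, ∃ σ : E7 ≃L[ℝ] E7, α y = phi0.compContinuousLinearMap (σ : E7 →L[ℝ] E7))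
    (s : Fin 4 → Fin 7) : ContDiffOn ℝ n (fun y => starCoeff (α y) s) U := by
  have hg := contDiffOn_gramOf hα hσ
  have hi := contDiffOn_inv_entry hg fun y hy => by
    obtain ⟨σ, h⟩ := hσ y hy
    rw [h]
    exact det_gramOf_ne σ
  refine ContDiffOn.sub ?_ (((hg _ _).mul (hg _ _)).sub ((hg _ _).mul (hg _ _)))
  simp only [dotProduct, Matrix.mulVec]
  exact ContDiffOn.sum fun p _ => (contDiffOn_const_apply hα _).mul
    (ContDiffOn.sum fun q _ => (hi p q).mul (contDiffOn_const_apply hα _))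

end Smooth

/-! ### Coassociative subspaces of `ℝ⁷`. -/

theorem inner_cross_self_zero (a b c : E7) : inner ℝ (cross7 a b) (cross7 c b) =
    inner ℝ a c * inner ℝ b b - inner ℝ a b * inner ℝ b c := by
  have h := starPhi0_eq a b c b
  rw [starPhi0.map_eq_zero_of_eq ![a, b, c, b] (i := 1) (j := 3) rfl (by decide)] at h
  linarith

theorem phi0_rotate (a b c : E7) : phi0 ![a, b, c] = phi0 ![b, c, a] := by
  simp only [phi0_apply, dxWedge_three]; ring

theorem phi0_swap (a b c : E7) : phi0 ![a, b, c] = -phi0 ![b, a, c] := by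
  simp only [phi0_apply, dxWedge_three]; ring

/-- The vector dual to `starPhi0 (c, b, a, ·)`. -/
noncomputable def tripleCross (a b c : E7) : E7 :=
  cross7 (cross7 c b) a - (inner ℝ c a : ℝ) • b + (inner ℝ b a : ℝ) • c

theorem inner_tripleCross (a b c v : E7) : inner ℝ (tripleCross a b c) v = starPhi0 ![c, b, a, v] := by
  rw [starPhi0_eq, tripleCross, inner_add_left, inner_sub_left, real_inner_smul_left, real_inner_smul_left,
    phi0_cross, real_inner_comm (cross7 a v), phi0_cross, phi0_rotate]
  ring

/-- The vanishing case of the associator equality `|n|² + φ₀(a,b,c)² = det Gram(a,b,c)`. Each inner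
product of double cross products reduces to the metric by repeating an argument in `starPhi0_eq`. -/
theorem inner_tripleCross_self {a b c : E7} (h : phi0 ![a, b, c] = 0) :
    inner ℝ (tripleCross a b c) (tripleCross a b c) = (Matrix.gram ℝ ![a, b, c]).det := by
  have h1 : inner ℝ (cross7 (cross7 c b) a) (cross7 (cross7 c b) a) =
      (inner ℝ c c * inner ℝ b b - inner ℝ c b * inner ℝ b c) * inner ℝ a a := by
    rw [inner_cross_self_zero, inner_cross_self_zero, phi0_cross, phi0_rotate, phi0_swap, phi0_rotate, ← phi0_rotate a, h]
    ring
  have h2 : inner ℝ (cross7 (cross7 c b) a) b = inner ℝ a c * inner ℝ b b - inner ℝ a b * inner ℝ b c := by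
    rw [phi0_cross, phi0_rotate, ← phi0_cross, inner_cross_self_zero]
  have h3 : inner ℝ (cross7 (cross7 c b) a) c = inner ℝ a c * inner ℝ b c - inner ℝ a b * inner ℝ c c := by
    rw [phi0_cross, phi0_rotate, ← phi0_cross]
    have := starPhi0_eq a c c b
    rw [starPhi0.map_eq_zero_of_eq ![a, c, c, b] (i := 1) (j := 2) rfl (by decide)] at this
    rw [real_inner_comm b c] at this
    linarith
  rw [tripleCross, Matrix.det_fin_three]
  simp only [Matrix.gram, Matrix.of_apply, inner_add_left, inner_sub_left, real_inner_smul_left, inner_add_right, inner_sub_right, real_inner_smul_right, h1, h2, h3, real_inner_comm (cross7 (cross7 c b) a)]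
  simp
  rw [real_inner_comm b a, real_inner_comm c a, real_inner_comm c b]
  ring

/-- The triple cross product is orthogonal to `a, b, c` because `starPhi0` is alternating, so the
Gram matrix splits into blocks, each of determinant `|n|²`. -/
theorem det_gram_tripleCross {a b c : E7} (h : phi0 ![a, b, c] = 0) :
    (Matrix.gram ℝ ![c, b, a, tripleCross a b c]).det =
      inner ℝ (tripleCross a b c) (tripleCross a b c) ^ 2 := by
  have ha : inner ℝ (tripleCross a b c) a = 0 := by
    rw [inner_tripleCross]
    exact starPhi0.map_eq_zero_of_eq ![c, b, a, a] (i := 2) (j := 3) rfl (by decide)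
  have hb : inner ℝ (tripleCross a b c) b = 0 := by
    rw [inner_tripleCross]
    exact starPhi0.map_eq_zero_of_eq ![c, b, a, b] (i := 1) (j := 3) rfl (by decide)
  have hc : inner ℝ (tripleCross a b c) c = 0 := by
    rw [inner_tripleCross]
    exact starPhi0.map_eq_zero_of_eq ![c, b, a, c] (i := 0) (j := 3) rfl (by decide)
  have hn := inner_tripleCross_self h
  rw [sq]
  nth_rewrite 2 [hn]
  set n := tripleCross a b c
  rw [Matrix.det_succ_row_zero, Matrix.det_fin_three]
  simp [Fin.sum_univ_four, Matrix.det_fin_three, Fin.succAbove, Matrix.gram_apply, ha, hb, hc,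
    real_inner_comm n]
  rw [real_inner_comm b a, real_inner_comm c a, real_inner_comm c b]
  ring

/-- Three independent vectors on which `phi0` vanishes, together with the dual of
`starPhi0 (c, b, a, ·)`, span a coassociative subspace. -/
theorem coassociative_tripleCross {a b c : E7} (h : phi0 ![a, b, c] = 0)
    (hn : tripleCross a b c ≠ 0) :
    LinearIndependent ℝ ![c, b, a, tripleCross a b c] ∧
      ∀ e : Fin 4 → E7, (∀ i, e i ∈ Submodule.span ℝ (range ![c, b, a, tripleCross a b c])) →
        (∀ i j, inner ℝ (e i) (e j) = if i = j then (1 : ℝ) else 0) → |starPhi0 e| = 1 := by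
  have hd := det_gram_tripleCross h
  have hpos : 0 < inner ℝ (tripleCross a b c) (tripleCross a b c) := real_inner_self_pos.2 hn
  refine ⟨Matrix.linearIndependent_of_det_gram_ne_zero (𝕜 := ℝ) (by rw [hd]; positivity), ?_⟩
  intro e he ho
  set v := ![c, b, a, tripleCross a b c] with hv
  have hP : ∀ i, ∃ p : Fin 4 → ℝ, ∑ j, p j • v j = e i := fun i =>
    (Submodule.mem_span_range_iff_exists_fun ℝ).1 (he i)
  choose p hp using hP
  set P : Matrix (Fin 4) (Fin 4) ℝ := Matrix.of p with hPdef
  let T : (Fin 4 → ℝ) →ₗ[ℝ] E7 := Fintype.linearCombination ℝ v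
  have hT : ∀ i, T (p i) = e i := fun i => by
    rw [← hp i]; exact Fintype.linearCombination_apply ℝ v (p i)
  -- A 4-form on a 4-dimensional space is a multiple of the determinant.
  have h1 : starPhi0 e = starPhi0 v * P.det := by
    have h2 := (starPhi0.toAlternatingMap.compLinearMap T).eq_smul_basis_det (Pi.basisFun ℝ (Fin 4))
    have h3 := DFunLike.congr_fun h2 p
    simp only [AlternatingMap.compLinearMap_apply, AlternatingMap.smul_apply, smul_eq_mul, Pi.basisFun_det_apply] at h3
    have h4 : (fun i => T (p i)) = e := funext hT
    have h5 : (fun i => T (Pi.basisFun ℝ (Fin 4) i)) = v := by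
      ext1 i
      simp [T, Fintype.linearCombination_apply, Pi.single_apply]
    rw [h4, h5] at h3
    exact h3
  have h2 : starPhi0 v = inner ℝ (tripleCross a b c) (tripleCross a b c) := by
    rw [inner_tripleCross]
  -- Orthonormality of `e` in the basis `v`. Taking determinants gives `(det P)² |n|⁴ = 1`, while
  -- `starPhi0 v = |n|²`.
  have h3 : P * Matrix.gram ℝ v * Pᵀ = 1 := by
    ext i j
    rw [Matrix.one_apply, ← ho i j, ← hp i, ← hp j, sum_inner]
    simp only [inner_sum, real_inner_smul_left, real_inner_smul_right, Matrix.mul_apply, Matrix.gram_apply,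
      Matrix.transpose_apply, Finset.sum_mul]
    rw [Finset.sum_comm]
    refine Finset.sum_congr rfl fun k _ => Finset.sum_congr rfl fun l _ => ?_
    simp only [hPdef, Matrix.of_apply]
    ring
  have h4 := congrArg Matrix.det h3
  rw [Matrix.det_mul, Matrix.det_mul, Matrix.det_transpose, Matrix.det_one, hd, ← h2] at h4
  have h5 : (starPhi0 e) ^ 2 = 1 := by rw [h1]; linarith
  exact (pow_eq_one_iff_of_nonneg (abs_nonneg _) two_ne_zero).1 (by rw [sq_abs, h5])

theorem tripleCross_ne_zero {a b c : E7} (h : phi0 ![a, b, c] = 0)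
    (hi : LinearIndependent ℝ ![a, b, c]) : tripleCross a b c ≠ 0 := by
  rw [← inner_self_ne_zero (𝕜 := ℝ), inner_tripleCross_self h]
  exact Matrix.det_gram_ne_zero_iff_linearIndependent.2 hi

/-! ### Smooth curves in `SO(3)` and the adjoint representation. -/

namespace SO3

theorem contMDiff_of_entries {c : ℝ → SO3} (hc : ∀ j k, ContDiff ℝ ∞ fun t => (c t).1 j k) :
    ContMDiff 𝓘(ℝ, ℝ) (𝓡 3) ∞ c := by
  have hcont : Continuous c := by
    refine Continuous.subtype_mk (f := fun t => (c t).1) ?_ _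
    exact continuous_pi fun j => continuous_pi fun k => (hc j k).continuous
  intro t
  rw [contMDiffAt_iff]
  refine ⟨hcont.continuousAt, ?_⟩
  -- The chart around `c t` is the Cayley chart after left translation by `(c t)⁻¹`.
  have hm : ContDiff ℝ ∞ (fun t' (j k : Fin 3) => ((c t)⁻¹ * c t').1 j k) := by
    refine contDiff_pi.2 fun j => contDiff_pi.2 fun k => ?_
    have : ∀ t', ((c t)⁻¹ * c t').1 j k = ∑ l, (c t)⁻¹.1 j l * (c t').1 l k := fun t' => rfl
    simp only [this]
    exact ContDiff.sum fun l _ => contDiff_const.mul (hc l k)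
  have h1 : ContDiffAt ℝ ∞ (fun A : Fin 3 → Fin 3 → ℝ => cayleyInv (Matrix.of A))
      (fun j k => ((c t)⁻¹ * c t).1 j k) := by
    refine contDiffOn_cayleyInv.contDiffAt (IsOpen.mem_nhds ?_ ?_)
    · exact isOpen_ne_fun (by simp only [Matrix.trace, Matrix.diag, Matrix.of_apply]; fun_prop) continuous_const
    · have : (Matrix.of fun j k => ((c t)⁻¹ * c t).1 j k) = (1 : Matrix (Fin 3) (Fin 3) ℝ) := by
        rw [inv_mul_cancel]; rfl
      rw [mem_ofPred_eq, this]
      norm_num [Matrix.trace_one]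
  exact (h1.comp t hm.contDiffAt).contDiffWithinAt

/-- The factor `1/2` comes from the Cayley parametrisation, which is `1 + 2 hat x` to first order.
-/
theorem hasMFDerivAt_of_entries {c : ℝ → SO3} (hc : ∀ j k, ContDiff ℝ ∞ fun t => (c t).1 j k)
    (h1 : c 0 = 1) {x : E3} (hx : ∀ j k, HasDerivAt (fun t => (c t).1 j k) (hat x j k) 0) :
    HasMFDerivAt 𝓘(ℝ, ℝ) (𝓡 3) c 0
      ((1 : ℝ →L[ℝ] ℝ).smulRight ((2 : ℝ)⁻¹ • x) : ℝ →L[ℝ] E3) := by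
  refine ⟨(contMDiff_of_entries hc).continuous.continuousAt, ?_⟩
  have hw : writtenInExtChartAt 𝓘(ℝ, ℝ) (𝓡 3) 0 c = fun t => cayleyInv (c t).1 := by
    ext1 t
    change cayleyInv ((c 0)⁻¹ * c t).1 = _
    rw [h1, inv_one, one_mul]
  rw [hw]
  refine hasFDerivWithinAt_euclidean.2 fun i => HasFDerivAt.hasFDerivWithinAt ?_
  have ht : HasDerivAt (fun t => 1 + (c t).1.trace) 0 0 := by
    have h := (hasDerivAt_const (0 : ℝ) (1 : ℝ)).add (((hx 0 0).add (hx 1 1)).add (hx 2 2))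
    refine (h.congr_deriv (by simp [hat])).congr_of_eventuallyEq (Filter.Eventually.of_forall fun t => ?_)
    simp [Matrix.trace, Fin.sum_univ_three]
  have ht0 : 1 + (c 0).1.trace = 4 := by
    rw [h1]; norm_num [Matrix.trace_one]
  have hti := ht.fun_inv (by rw [ht0]; norm_num)
  have key : ∀ j k : Fin 3, j ≠ k → HasDerivAt (fun t => (1 + (c t).1.trace)⁻¹ * ((c t).1 j k - (c t).1 k j))
      (4⁻¹ * (hat x j k - hat x k j)) 0 := by
    intro j k hjk
    refine (hti.mul ((hx j k).sub (hx k j))).congr_deriv ?_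
    simp [h1, Matrix.trace_one]
    norm_num
  refine HasDerivAt.hasFDerivAt (f' := ((2 : ℝ)⁻¹ • x) i) ?_ |>.congr_fderiv ?_
  · fin_cases i
    · refine ((key 2 1 (by decide)).congr_deriv ?_).congr_of_eventuallyEq (Filter.Eventually.of_forall fun t => ?_)
      · simp [hat]; ring
      · simp [cayleyInv]
    · refine ((key 0 2 (by decide)).congr_deriv ?_).congr_of_eventuallyEq (Filter.Eventually.of_forall fun t => ?_)
      · simp [hat]; ring
      · simp [cayleyInv]
    · refine ((key 1 0 (by decide)).congr_deriv ?_).congr_of_eventuallyEq (Filter.Eventually.of_forall fun t => ?_)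
      · simp [hat]; ring
      · simp [cayleyInv]
  · ext; simp

/-- In the charts of `SO(3)`, left translations are the identity. -/
theorem hasMFDerivAt_inv_mul (A : SO3) :
    HasMFDerivAt (𝓡 3) (𝓡 3) (fun B : SO3 => A⁻¹ * B) A (ContinuousLinearMap.id ℝ E3) := by
  refine ⟨(continuous_const_mul A⁻¹).continuousAt, ?_⟩
  refine HasFDerivAt.hasFDerivWithinAt ?_
  refine (hasFDerivAt_id _).congr_of_eventuallyEq (Filter.Eventually.of_forall fun x => ?_)
  change cayleyInv ((A⁻¹ * A)⁻¹ * (A⁻¹ * (A⁻¹⁻¹ * ⟨cayleyMatrix x, cayleyMatrix_mem x⟩)) : SO3).1 = x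
  rw [inv_mul_cancel, inv_one, one_mul, inv_inv, inv_mul_cancel_left]
  exact cayleyInv_cayley x

theorem contMDiff_rotation (i : Fin 3) : ContMDiff 𝓘(ℝ, ℝ) (𝓡 3) ∞ (rotation i) := by
  refine contMDiff_of_entries fun j k => ?_
  fin_cases i <;> fin_cases j <;> fin_cases k <;> simp [rotation, rotationMatrix] <;> fun_prop

theorem contDiff_rotation_entries (i j k : Fin 3) : ContDiff ℝ ∞ fun t => (rotation i t).1 j k := by
  fin_cases i <;> fin_cases j <;> fin_cases k <;> simp [rotation, rotationMatrix] <;> fun_prop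

/-- Equivalent to `A (x × y) = A x × A y`; entrywise it says that a rotation equals its own cofactor
matrix. -/
theorem conj_hat (A : SO3) (x : E3) : A.1 * hat x * A.1ᵀ = hat (WithLp.toLp 2 (A.1 *ᵥ x) : E3) := by
  obtain ⟨-, h3⟩ := entries A
  generalize A.1 = B at *
  have e3 := fun i j => congrFun (congrFun h3 i) j
  simp [Fin.forall_fin_succ, Matrix.adjugate_fin_three] at e3
  obtain ⟨⟨c1, c2, c3⟩, ⟨c4, c5, c6⟩, c7, c8, c9⟩ := e3
  ext i j
  fin_cases i <;> fin_cases j <;>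
    simp [hat, Matrix.mul_apply, Fin.sum_univ_three, Matrix.mulVec, dotProduct] <;> grind

theorem hasDerivAt_conj_rotation (A : SO3) (i j k : Fin 3) :
    HasDerivAt (fun t => (A * rotation i t * A⁻¹).1 j k)
      (hat (WithLp.toLp 2 (fun l => A.1 l i) : E3) j k) 0 := by
  have h1 : (fun l => A.1 l i) = A.1 *ᵥ (EuclideanSpace.single i (1 : ℝ) : E3).ofLp := by
    ext l; simp
  have h2 : hat (EuclideanSpace.single i (1 : ℝ) : E3) = liegen i := rfl
  rw [h1, ← conj_hat, h2]
  have h3 : ∀ t, (A * rotation i t * A⁻¹).1 j k = ∑ l, (∑ m, A.1 j m * (rotation i t).1 m l) * A.1ᵀ l k :=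
    fun t => rfl
  simp only [h3]
  simp only [Matrix.mul_apply]
  refine HasDerivAt.fun_sum fun l _ => HasDerivAt.mul_const (HasDerivAt.fun_sum fun m _ => HasDerivAt.const_mul _ ?_) _
  refine (hasDerivAt_rotation i 0 m l).congr_deriv ?_
  rw [rotation_zero]; exact congrFun (congrFun (one_mul (liegen i)) m) l

theorem contDiff_conj_rotation (A : SO3) (i j k : Fin 3) :
    ContDiff ℝ ∞ (fun t => (A * rotation i t * A⁻¹).1 j k) := by
  have h3 : ∀ t, (A * rotation i t * A⁻¹).1 j k = ∑ l, (∑ m, A.1 j m * (rotation i t).1 m l) * A.1ᵀ l k :=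
    fun t => rfl
  simp only [h3]
  exact ContDiff.sum fun l _ => (ContDiff.sum fun m _ => contDiff_const.mul (contDiff_rotation_entries i m l)).mul contDiff_const

instance : CompactSpace SO3 := by
  refine isCompact_iff_compactSpace.1 ?_
  have hK : IsCompact (Set.univ.pi fun _ : Fin 3 => Set.univ.pi fun _ : Fin 3 => Icc (-1 : ℝ) 1) :=
    isCompact_univ_pi fun _ => isCompact_univ_pi fun _ => isCompact_Icc
  refine IsCompact.of_isClosed_subset (s := Set.univ.pi fun _ : Fin 3 => Set.univ.pi fun _ : Fin 3 => Icc (-1 : ℝ) 1) hK ?_ ?_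
  · have : (Matrix.specialOrthogonalGroup (Fin 3) ℝ : Set (Matrix (Fin 3) (Fin 3) ℝ)) =
        {A | A * Aᵀ = 1} ∩ {A | A.det = 1} := by
      ext A; exact mem_iff
    rw [this]
    exact (isClosed_eq (by fun_prop) continuous_const).inter (isClosed_eq (by fun_prop) continuous_const)
  · intro A hA j _ k _
    have h1 := congrFun (congrFun (mem_iff.1 hA).1 j) j
    simp only [Matrix.mul_apply, Matrix.transpose_apply, Matrix.one_apply_eq] at h1
    have h2 : A j k * A j k ≤ 1 := by
      rw [← h1]
      exact Finset.single_le_sum (f := fun l => A j l * A j l) (fun l _ => mul_self_nonneg _) (Finset.mem_univ k)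
    exact abs_le.1 (abs_le_one_iff_mul_self_le_one.2 h2)

/-- The half-turns are `diag(1,-1,-1)` and its permutations; with the identity they sum to zero. If
all four numbers `1 + tr` vanished, their sum, which is `4`, would be zero. -/
theorem exists_rotation_pi (A : SO3) (hA : 1 + A.1.trace = 0) :
    ∃ i, 1 + (A * rotation i Real.pi).1.trace ≠ 0 := by
  by_contra! h
  have h0 := h 0
  have h1 := h 1
  have h2 := h 2
  have hm : ∀ i, (A * rotation i Real.pi).1 = A.1 * rotationMatrix i Real.pi := fun i => rfl
  rw [hm] at h0 h1 h2
  simp [rotationMatrix, Matrix.trace, Fin.sum_univ_three, Matrix.mul_apply] at hA h0 h1 h2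
  linarith

/-- A function on `SO(3)` which is constant along smooth curves is constant. -/
theorem eq_of_const_along_curves {h : SO3 → ℝ}
    (hc : ∀ c : ℝ → SO3, (∀ j k, ContDiff ℝ ∞ fun t => (c t).1 j k) → ∀ s t, h (c s) = h (c t))
    (A : SO3) : h A = h 1 := by
  have h1 : ∀ A : SO3, 1 + A.1.trace ≠ 0 → h A = h 1 := by
    intro A hA
    have := hc (fun t => ⟨cayleyMatrix (t • cayleyInv A.1), cayleyMatrix_mem _⟩) (fun j k => ?_) 1 0
    · convert this using 2
      · exact Subtype.ext (by simp only [one_smul]; exact (cayley_cayleyInv A hA).symm)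
      · refine Subtype.ext ?_
        ext j k
        fin_cases j <;> fin_cases k <;> simp [cayleyMatrix, hat]
    · exact (contDiff_pi.1 (contDiff_pi.1 contDiff_cayleyMatrix j) k).comp (by fun_prop)
  by_cases hA : 1 + A.1.trace = 0
  -- Outside the Cayley chart at `1`, a path of rotations about a coordinate axis first leads back
  -- into it.
  · obtain ⟨i, hi⟩ := exists_rotation_pi A hA
    have h2 := hc (fun t => A * rotation i t) (fun j k => ?_) 0 Real.pi
    · rw [rotation_zero, mul_one] at h2
      rw [h2, h1 _ hi]
    · have h3 : ∀ t, (A * rotation i t).1 j k = ∑ l, A.1 j l * (rotation i t).1 l k := fun t => rfl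
      simp only [h3]
      exact ContDiff.sum fun l _ => contDiff_const.mul (contDiff_rotation_entries i l k)
  · exact h1 A hA

end SO3

/-! ### Local flows and the Lie derivative in a normed space. -/

section FlowPackage
variable {E : Type*} [NormedAddCommGroup E] [NormedSpace ℝ E]

/-- The infinitesimal generator of a local flow. -/
noncomputable def generator (Φ : ℝ × E → E) (y : E) : E := fderiv ℝ Φ (0, y) (1, 0)

theorem hasDerivAt_flow {Φ : ℝ × E → E} {y : E} (h : ContDiffAt ℝ ∞ Φ (0, y)) :
    HasDerivAt (fun t => Φ (t, y)) (generator Φ y) 0 := by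
  have h1 : HasFDerivAt Φ (fderiv ℝ Φ (0, y)) (0, y) := (h.differentiableAt (by simp)).hasFDerivAt
  have h2 : HasDerivAt (fun t : ℝ => (t, y)) ((1 : ℝ), (0 : E)) 0 :=
    (hasDerivAt_id (0 : ℝ)).prodMk (hasDerivAt_const _ _)
  exact h1.comp_hasDerivAt (0 : ℝ) h2

theorem hasFDerivAt_generator {Φ : ℝ × E → E} {y : E} (h : ContDiffAt ℝ ∞ Φ (0, y)) :
    HasFDerivAt (generator Φ) ((fderiv ℝ (fderiv ℝ Φ) (0, y)).flip (1, 0) ∘L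
      ContinuousLinearMap.inr ℝ ℝ E) y := by
  have h1 : HasFDerivAt (fderiv ℝ Φ) (fderiv ℝ (fderiv ℝ Φ) (0, y)) (0, y) :=
    ((h.fderiv_right (m := ∞) (by simp)).differentiableAt (by simp)).hasFDerivAt
  have h2 : HasFDerivAt (fun z : E => ((0 : ℝ), z)) (ContinuousLinearMap.inr ℝ ℝ E) y :=
    (hasFDerivAt_const _ _).prodMk (hasFDerivAt_id _)
  have h3 := (h1.comp y h2).clm_apply (hasFDerivAt_const ((1 : ℝ), (0 : E)) y)
  refine h3.congr_fderiv ?_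
  ext v
  simp

/-- Symmetry of the second derivative of `Φ` interchanges the time derivative with the space
derivative. -/
theorem hasDerivAt_fderiv_flow {Φ : ℝ × E → E} {y : E} (h : ContDiffAt ℝ ∞ Φ (0, y)) (v : E) :
    HasDerivAt (fun t => fderiv ℝ Φ (t, y) (0, v)) (fderiv ℝ (generator Φ) y v) 0 := by
  have h1 : HasFDerivAt (fderiv ℝ Φ) (fderiv ℝ (fderiv ℝ Φ) (0, y)) (0, y) :=
    ((h.fderiv_right (m := ∞) (by simp)).differentiableAt (by simp)).hasFDerivAt
  have h2 : HasDerivAt (fun t : ℝ => (t, y)) ((1 : ℝ), (0 : E)) 0 :=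
    (hasDerivAt_id (0 : ℝ)).prodMk (hasDerivAt_const _ _)
  have h3 : HasDerivAt (fun t : ℝ => fderiv ℝ Φ (t, y)) (fderiv ℝ (fderiv ℝ Φ) (0, y) (1, 0)) 0 :=
    h1.comp_hasDerivAt (0 : ℝ) h2
  have h5 := h3.clm_apply (hasDerivAt_const (0 : ℝ) ((0 : ℝ), v))
  have hs : IsSymmSndFDerivAt ℝ Φ (0, y) := h.isSymmSndFDerivAt (by
    rw [minSmoothness_of_isRCLikeNormedField]; exact WithTop.coe_le_coe.2 le_top)
  have h4 : fderiv ℝ (generator Φ) y v = fderiv ℝ (fderiv ℝ Φ) (0, y) (0, v) (1, 0) := by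
    rw [(hasFDerivAt_generator h).fderiv]
    rfl
  rw [h4, ← hs.eq (1, 0) (0, v)]
  simpa using h5

theorem fderiv_flow_zero {Φ : ℝ × E → E} {y : E} (h : ContDiffAt ℝ ∞ Φ (0, y))
    (h0 : ∀ᶠ z in 𝓝 y, Φ (0, z) = z) (v : E) : fderiv ℝ Φ (0, y) (0, v) = v := by
  have h1 : HasFDerivAt Φ (fderiv ℝ Φ (0, y)) (0, y) := (h.differentiableAt (by simp)).hasFDerivAt
  have h2 : HasFDerivAt (fun z : E => ((0 : ℝ), z)) (ContinuousLinearMap.inr ℝ ℝ E) y :=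
    (hasFDerivAt_const _ _).prodMk (hasFDerivAt_id _)
  have h3 := h1.comp y h2
  have h4 : HasFDerivAt (fun z : E => Φ (0, z)) (ContinuousLinearMap.id ℝ E) y :=
    (hasFDerivAt_id y).congr_of_eventuallyEq h0
  have h5 := h3.unique h4
  simpa using DFunLike.congr_fun h5 v

/-- An invariant form has vanishing Lie derivative. -/
theorem lieDerivative_eq_zero {k : ℕ} {Φ : ℝ × E → E} {y : E} (h : ContDiffAt ℝ ∞ Φ (0, y))
    (h0 : ∀ᶠ z in 𝓝 y, Φ (0, z) = z) {α : E → E [⋀^Fin k]→L[ℝ] ℝ} (hα : DifferentiableAt ℝ α y)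
    (hinv : ∀ v : Fin k → E, ∀ᶠ t in 𝓝 (0 : ℝ),
      α (Φ (t, y)) (fun i => fderiv ℝ Φ (t, y) (0, v i)) = α y v) (v : Fin k → E) :
    fderiv ℝ α y (generator Φ y) v +
      ∑ i, α y (update v i (fderiv ℝ (generator Φ) y (v i))) = 0 := by
  have hy : Φ (0, y) = y := h0.self_of_nhds
  have h1 : HasDerivAt (fun t => α (Φ (t, y))) (fderiv ℝ α y (generator Φ y)) 0 := by
    have : HasFDerivAt α (fderiv ℝ α y) (Φ (0, y)) := by rw [hy]; exact hα.hasFDerivAt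
    exact this.comp_hasDerivAt (0 : ℝ) (hasDerivAt_flow h)
  have h2 : ∀ i, HasDerivAt (fun t => fderiv ℝ Φ (t, y) (0, v i)) (fderiv ℝ (generator Φ) y (v i)) 0 :=
    fun i => hasDerivAt_fderiv_flow h (v i)
  have h3 := (h1.hasFDerivAt.continuousAlternatingMap_apply fun i => (h2 i).hasFDerivAt).hasDerivAt
  have h4 : HasDerivAt (fun t => α (Φ (t, y)) (fun i => fderiv ℝ Φ (t, y) (0, v i))) 0 0 :=
    (hasDerivAt_const (0 : ℝ) (α y v)).congr_of_eventuallyEq (hinv v)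
  have h5 := h3.unique h4
  simp [hy, fderiv_flow_zero h h0] at h5
  exact h5
end FlowPackage

/-! ### Derivatives of charts, and frames in charts. -/

section Charts
variable {M : Type*} [TopologicalSpace M] [ChartedSpace E7 M]

/-- The derivative of the inverse of the chart around `x`. -/
noncomputable def symmD (x : M) (y : E7) : E7 →L[ℝ] E7 :=
  mfderiv 𝓘(ℝ, E7) (𝓡 7) (extChartAt (𝓡 7) x).symm y

/-- The derivative of the chart around `x`. -/
noncomputable def chartD (x m : M) : E7 →L[ℝ] E7 :=
  mfderiv (𝓡 7) 𝓘(ℝ, E7) (extChartAt (𝓡 7) x) m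

/-- The value of a form, with the tangent space identified with `ℝ⁷`. -/
noncomputable def DForm.valE {k : ℕ} (η : DForm M k) (m : M) : E7 [⋀^Fin k]→L[ℝ] ℝ := η m

theorem comp_one_smulRight {V W : Type*} [NormedAddCommGroup V] [NormedSpace ℝ V]
    [NormedAddCommGroup W] [NormedSpace ℝ W] (L : V →L[ℝ] W) (v : V) :
    L.comp ((1 : ℝ →L[ℝ] ℝ).smulRight v) = (1 : ℝ →L[ℝ] ℝ).smulRight (L v) := by
  ext; simp

theorem inChart_eq {k : ℕ} (η : DForm M k) (x : M) (y : E7) : DForm.inChart η x y =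
    (DForm.valE η ((extChartAt (𝓡 7) x).symm y)).compContinuousLinearMap (symmD x y) := rfl

theorem isOpen_target (x : M) : IsOpen (extChartAt (𝓡 7) x).target := isOpen_extChartAt_target x

theorem target_mem_nhds {x : M} {y : E7} (hy : y ∈ (extChartAt (𝓡 7) x).target) :
    (extChartAt (𝓡 7) x).target ∈ 𝓝 y := (isOpen_target x).mem_nhds hy

variable [IsManifold (𝓡 7) ∞ M]

theorem hasMFDerivAt_symm {x : M} {y : E7} (hy : y ∈ (extChartAt (𝓡 7) x).target) :
    HasMFDerivAt 𝓘(ℝ, E7) (𝓡 7) (extChartAt (𝓡 7) x).symm y (symmD x y) := by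
  have : MDifferentiableAt 𝓘(ℝ, E7) (𝓡 7) (extChartAt (𝓡 7) x).symm y :=
    ((contMDiffOn_extChartAt_symm (n := ∞) x).contMDiffAt (target_mem_nhds hy)).mdifferentiableAt (by simp)
  exact this.hasMFDerivAt

theorem hasMFDerivAt_chart {x m : M} (hm : m ∈ (extChartAt (𝓡 7) x).source) :
    HasMFDerivAt (𝓡 7) 𝓘(ℝ, E7) (extChartAt (𝓡 7) x) m (chartD x m) :=
  (mdifferentiableAt_extChartAt (by rwa [← extChartAt_source (𝓡 7)])).hasMFDerivAt

theorem chartD_comp_symmD {x : M} {y : E7} (hy : y ∈ (extChartAt (𝓡 7) x).target) :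
    (chartD x ((extChartAt (𝓡 7) x).symm y)).comp (symmD x y) = ContinuousLinearMap.id ℝ E7 := by
  have h1 := (hasMFDerivAt_chart ((extChartAt (𝓡 7) x).map_target hy)).comp y (hasMFDerivAt_symm hy)
  have h2 : HasMFDerivAt 𝓘(ℝ, E7) 𝓘(ℝ, E7) ((extChartAt (𝓡 7) x) ∘ (extChartAt (𝓡 7) x).symm) y
      (ContinuousLinearMap.id ℝ E7) := by
    refine (hasMFDerivAt_id (I := 𝓘(ℝ, E7)) y).congr_of_eventuallyEq ?_
    filter_upwards [target_mem_nhds hy] with z hz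
    exact (extChartAt (𝓡 7) x).right_inv hz
  exact hasMFDerivAt_unique h1 h2

/-- The derivative of the inverse of the chart around `x` as an isomorphism. -/
theorem exists_equiv_symmD {x : M} {y : E7} (hy : y ∈ (extChartAt (𝓡 7) x).target) :
    ∃ τ : E7 ≃L[ℝ] E7, (τ : E7 →L[ℝ] E7) = symmD x y ∧
      (τ.symm : E7 →L[ℝ] E7) = chartD x ((extChartAt (𝓡 7) x).symm y) := by
  have h1 := chartD_comp_symmD hy
  have h2 : (symmD x y).comp (chartD x ((extChartAt (𝓡 7) x).symm y)) = ContinuousLinearMap.id ℝ E7 := by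
    have h3 := hasMFDerivAt_symm hy
    rw [← (extChartAt (𝓡 7) x).right_inv hy] at h3
    have h4 := h3.comp _ (hasMFDerivAt_chart ((extChartAt (𝓡 7) x).map_target hy))
    rw [(extChartAt (𝓡 7) x).right_inv hy] at h4
    have h5 : HasMFDerivAt (𝓡 7) (𝓡 7) ((extChartAt (𝓡 7) x).symm ∘ (extChartAt (𝓡 7) x))
        ((extChartAt (𝓡 7) x).symm y) (ContinuousLinearMap.id ℝ E7) := by
      refine (hasMFDerivAt_id (I := 𝓡 7) _).congr_of_eventuallyEq ?_
      filter_upwards [(isOpen_extChartAt_source (I := 𝓡 7) x).mem_nhds ((extChartAt (𝓡 7) x).map_target hy)] with z hz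
      exact (extChartAt (𝓡 7) x).left_inv hz
    exact hasMFDerivAt_unique h4 h5
  exact ⟨ContinuousLinearEquiv.equivOfInverse (symmD x y) _ (fun v => DFunLike.congr_fun h1 v)
    (fun v => DFunLike.congr_fun h2 v), rfl, rfl⟩

namespace G2Structure
variable (P : G2Structure M)

/-- The frame at `m`, with the tangent space identified with `ℝ⁷`. -/
noncomputable def frameE (m : M) : E7 ≃L[ℝ] E7 := P.frame m

theorem valE_form (m : M) : P.form.valE m = phi0.compContinuousLinearMap (P.frameE m : E7 →L[ℝ] E7) :=
  P.form_eq m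

theorem valE_starForm (m : M) :
    P.starForm.valE m = starPhi0.compContinuousLinearMap (P.frameE m : E7 →L[ℝ] E7) := rfl

/-- The frame `σ` need not depend continuously on `y`; it serves only to verify pointwise identities
between expressions known to be smooth. -/
theorem exists_chart_frame {x : M} {y : E7} (hy : y ∈ (extChartAt (𝓡 7) x).target) :
    ∃ σ : E7 ≃L[ℝ] E7, (∀ v, σ v = P.frameE ((extChartAt (𝓡 7) x).symm y) (symmD x y v)) ∧
      DForm.inChart P.form x y = phi0.compContinuousLinearMap (σ : E7 →L[ℝ] E7) ∧
      DForm.inChart P.starForm x y = starPhi0.compContinuousLinearMap (σ : E7 →L[ℝ] E7) := by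
  obtain ⟨τ, hτ, -⟩ := exists_equiv_symmD hy
  refine ⟨τ.trans (P.frameE ((extChartAt (𝓡 7) x).symm y)), fun v => ?_, ?_, ?_⟩
  · rw [← hτ]; rfl
  · rw [inChart_eq, P.valE_form, ← hτ]; rfl
  · rw [inChart_eq, P.valE_starForm, ← hτ]; rfl

theorem starForm_smooth : DForm.IsSmooth P.starForm := by
  intro x
  refine contDiffOn_alternating fun s => ?_
  have hσ : ∀ y ∈ (extChartAt (𝓡 7) x).target, ∃ σ : E7 ≃L[ℝ] E7,
      DForm.inChart P.form x y = phi0.compContinuousLinearMap (σ : E7 →L[ℝ] E7) := fun y hy => by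
    obtain ⟨σ, -, h, -⟩ := P.exists_chart_frame hy
    exact ⟨σ, h⟩
  refine (contDiffOn_starCoeff (P.smooth x) hσ s).congr fun y hy => ?_
  obtain ⟨σ, -, h1, h2⟩ := P.exists_chart_frame hy
  rw [h1, h2, starCoeff_eq]

end G2Structure
end Charts

/-! ### Derivatives of the action and of the orbit maps. -/

section Action
variable {M : Type*} [TopologicalSpace M] [ChartedSpace E7 M] [MulAction SO3 M]

/-- The field `actionField i`, with the tangent space identified with `ℝ⁷`. -/
noncomputable def fieldE (i : Fin 3) (m : M) : E7 := actionField i m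

/-- The derivative of the action of a rotation. -/
noncomputable def actD (A : SO3) (m : M) : E7 →L[ℝ] E7 := mfderiv (𝓡 7) (𝓡 7) (fun x : M => A • x) m

/-- The derivative at the identity of the orbit map of `m`. -/
noncomputable def orbitD (m : M) : E3 →L[ℝ] E7 := mfderiv (𝓡 3) (𝓡 7) (fun A : SO3 => A • m) 1

variable [IsManifold (𝓡 7) ∞ M] [ContMDiffSMul (𝓡 3) (𝓡 7) ∞ SO3 M]

theorem contMDiff_act (A : SO3) : ContMDiff (𝓡 7) (𝓡 7) ∞ (fun x : M => A • x) :=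
  ContMDiffSMul.contMDiff_const_smul (I := 𝓡 3) A

theorem contMDiff_orbit (m : M) : ContMDiff (𝓡 3) (𝓡 7) ∞ (fun A : SO3 => A • m) :=
  (contMDiff_smul (I := 𝓡 3) (I' := 𝓡 7) (n := ∞) (G := SO3) (M := M)).comp (contMDiff_id.prodMk contMDiff_const)

theorem hasMFDerivAt_act (A : SO3) (m : M) :
    HasMFDerivAt (𝓡 7) (𝓡 7) (fun x : M => A • x) m (actD A m) :=
  ((contMDiff_act A).mdifferentiableAt (by simp)).hasMFDerivAt

theorem hasMFDerivAt_orbit (m : M) :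
    HasMFDerivAt (𝓡 3) (𝓡 7) (fun A : SO3 => A • m) 1 (orbitD m) :=
  ((contMDiff_orbit m).mdifferentiableAt (by simp)).hasMFDerivAt

theorem actD_comp (A B : SO3) (m : M) : actD (A * B) m = (actD A (B • m)).comp (actD B m) := by
  have h1 := (hasMFDerivAt_act A (B • m)).comp m (hasMFDerivAt_act B m)
  have h2 : (fun x : M => A • x) ∘ (fun x : M => B • x) = fun x : M => (A * B) • x := by
    ext x; simp [mul_smul]
  rw [h2] at h1
  exact hasMFDerivAt_unique (hasMFDerivAt_act (A * B) m) h1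

theorem actD_one (m : M) : actD (1 : SO3) m = ContinuousLinearMap.id ℝ E7 := by
  have h2 : (fun x : M => (1 : SO3) • x) = id := by ext x; simp
  have h1 := hasMFDerivAt_act (1 : SO3) m
  rw [h2] at h1
  exact hasMFDerivAt_unique h1 (hasMFDerivAt_id m)

theorem exists_equiv_actD (A : SO3) (m : M) : ∃ τ : E7 ≃L[ℝ] E7, (τ : E7 →L[ℝ] E7) = actD A m := by
  have h1 := actD_comp A⁻¹ A m
  have h2 := actD_comp A A⁻¹ (A • m)
  rw [inv_mul_cancel, actD_one] at h1
  rw [mul_inv_cancel, actD_one, inv_smul_smul] at h2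
  exact ⟨ContinuousLinearEquiv.equivOfInverse (actD A m) (actD A⁻¹ (A • m))
    (fun v => (DFunLike.congr_fun h1 v).symm) (fun v => (DFunLike.congr_fun h2 v).symm), rfl⟩

theorem mfderiv_curve_smul {c : ℝ → SO3} (hc : ∀ j k, ContDiff ℝ ∞ fun t => (c t).1 j k)
    (h1 : c 0 = 1) {x : E3} (hx : ∀ j k, HasDerivAt (fun t => (c t).1 j k) (SO3.hat x j k) 0) (m : M) :
    HasMFDerivAt 𝓘(ℝ, ℝ) (𝓡 7) (fun t => c t • m) 0
      ((1 : ℝ →L[ℝ] ℝ).smulRight (orbitD m ((2 : ℝ)⁻¹ • x)) : ℝ →L[ℝ] E7) := by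
  have h := SO3.hasMFDerivAt_of_entries hc h1 hx
  have h3 := hasMFDerivAt_orbit m
  rw [← h1] at h3
  have hk := comp_one_smulRight (orbitD m) ((2 : ℝ)⁻¹ • x)
  exact (h3.comp 0 h).congr_mfderiv hk

theorem fieldE_eq (i : Fin 3) (m : M) : fieldE i m = orbitD m ((2 : ℝ)⁻¹ • EuclideanSpace.single i 1) := by
  have h := mfderiv_curve_smul (SO3.contDiff_rotation_entries i) (SO3.rotation_zero i)
    (x := EuclideanSpace.single i 1) (fun j k => ?_) m
  · have h2 : fieldE i m = (mfderiv 𝓘(ℝ, ℝ) (𝓡 7) (fun t : ℝ => SO3.rotation i t • m) 0) (1 : ℝ) := rfl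
    rw [h2, h.mfderiv]
    exact one_smul ℝ _
  · refine (SO3.hasDerivAt_rotation i 0 j k).congr_deriv ?_
    rw [SO3.rotation_zero]
    exact congrFun (congrFun (one_mul (SO3.liegen i)) j) k

theorem hasMFDerivAt_rotation_smul (i : Fin 3) (m : M) :
    HasMFDerivAt 𝓘(ℝ, ℝ) (𝓡 7) (fun t => SO3.rotation i t • m) 0
      ((1 : ℝ →L[ℝ] ℝ).smulRight (fieldE i m) : ℝ →L[ℝ] E7) := by
  rw [fieldE_eq]
  refine mfderiv_curve_smul (SO3.contDiff_rotation_entries i) (SO3.rotation_zero i) (fun j k => ?_) m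
  refine (SO3.hasDerivAt_rotation i 0 j k).congr_deriv ?_
  rw [SO3.rotation_zero]
  exact congrFun (congrFun (one_mul (SO3.liegen i)) j) k

/-- The fields generating the action are permuted by the action according to the adjoint
representation. -/
theorem actD_fieldE (A : SO3) (j : Fin 3) (m : M) :
    actD A m (fieldE j m) = ∑ k, A.1 k j • fieldE k (A • m) := by
  have h1 : HasMFDerivAt 𝓘(ℝ, ℝ) (𝓡 7) (fun t => A • (SO3.rotation j t • m)) 0
      ((1 : ℝ →L[ℝ] ℝ).smulRight (actD A m (fieldE j m)) : ℝ →L[ℝ] E7) := by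
    have h3 := hasMFDerivAt_act A m
    have h4 : SO3.rotation j 0 • m = m := by rw [SO3.rotation_zero, one_smul]
    rw [← h4] at h3
    rw [← show actD A (SO3.rotation j 0 • m) (fieldE j m) = actD A m (fieldE j m) by rw [h4]]
    have hk := comp_one_smulRight (actD A (SO3.rotation j 0 • m)) (fieldE j m)
    exact (h3.comp 0 (hasMFDerivAt_rotation_smul j m)).congr_mfderiv hk
  -- The curve `A exp(t eⱼ) m` is also `(A exp(t eⱼ) A⁻¹)(A m)`, whose generator at `A m`
  -- corresponds to the `j`-th column of `A`.
  have h2 := mfderiv_curve_smul (SO3.contDiff_conj_rotation A j)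
    (by rw [SO3.rotation_zero, mul_one, mul_inv_cancel]) (SO3.hasDerivAt_conj_rotation A j) (A • m)
  have h3 : (fun t => (A * SO3.rotation j t * A⁻¹) • (A • m)) = fun t => A • (SO3.rotation j t • m) := by
    ext t
    rw [smul_smul, smul_smul, inv_mul_cancel_right]
  rw [h3] at h2
  have h4 := DFunLike.congr_fun (hasMFDerivAt_unique h1 h2) (1 : ℝ)
  have h5 : actD A m (fieldE j m) = orbitD (A • m) ((2 : ℝ)⁻¹ • (WithLp.toLp 2 (fun l => A.1 l j) : E3)) := by
    have h6 : ((1 : ℝ) • actD A m (fieldE j m) : E7) =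
        (1 : ℝ) • orbitD (A • m) ((2 : ℝ)⁻¹ • (WithLp.toLp 2 (fun l => A.1 l j) : E3)) := h4
    rwa [one_smul, one_smul] at h6
  rw [h5]
  have h7 : (WithLp.toLp 2 (fun l => A.1 l j) : E3) = ∑ k, A.1 k j • EuclideanSpace.single k (1 : ℝ) := by
    ext l; simp [Pi.single_apply]
  rw [h7, Finset.smul_sum, map_sum]
  refine Finset.sum_congr rfl fun k _ => ?_
  rw [fieldE_eq, smul_comm, map_smul]

end Action

/-! ### The generating fields in charts: Lie derivatives and brackets. -/

section ChartFlow
variable {M : Type*} [TopologicalSpace M] [ChartedSpace E7 M] [MulAction SO3 M]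

/-- The rotations about the `i`-th axis in the chart around `x`. -/
noncomputable def chartFlow (i : Fin 3) (x : M) (p : ℝ × E7) : E7 :=
  extChartAt (𝓡 7) x (SO3.rotation i p.1 • (extChartAt (𝓡 7) x).symm p.2)

/-- The field `actionField i` in the chart around `x`. -/
noncomputable def chartField (i : Fin 3) (x : M) (y : E7) : E7 := generator (chartFlow i x) y

/-- Invariance of a form under the action. -/
def DForm.ActInvariant {k : ℕ} (η : DForm M k) : Prop :=
  ∀ (A : SO3) (m : M), (η.valE (A • m)).compContinuousLinearMap (actD A m) = η.valE m

variable [IsManifold (𝓡 7) ∞ M] [ContMDiffSMul (𝓡 3) (𝓡 7) ∞ SO3 M]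

theorem contDiffAt_chartFlow {i : Fin 3} {x : M} {p : ℝ × E7}
    (hp : p.2 ∈ (extChartAt (𝓡 7) x).target)
    (hs : SO3.rotation i p.1 • (extChartAt (𝓡 7) x).symm p.2 ∈ (extChartAt (𝓡 7) x).source) :
    ContDiffAt ℝ ∞ (chartFlow i x) p := by
  have h1 : ContMDiffAt 𝓘(ℝ, ℝ × E7) (𝓡 3) ∞ (fun p : ℝ × E7 => SO3.rotation i p.1) p :=
    ((SO3.contMDiff_rotation i).comp contDiff_fst.contMDiff).contMDiffAt
  have h2 : ContMDiffAt 𝓘(ℝ, ℝ × E7) (𝓡 7) ∞ (fun p : ℝ × E7 => (extChartAt (𝓡 7) x).symm p.2) p :=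
    ((contMDiffOn_extChartAt_symm x).contMDiffAt (target_mem_nhds hp)).comp p contDiff_snd.contMDiff.contMDiffAt
  have h3 := h1.smul h2
  have h4 : ContMDiffAt (𝓡 7) 𝓘(ℝ, E7) ∞ (extChartAt (𝓡 7) x)
      (SO3.rotation i p.1 • (extChartAt (𝓡 7) x).symm p.2) :=
    contMDiffAt_extChartAt' (by rwa [← extChartAt_source (𝓡 7)])
  exact contMDiffAt_iff_contDiffAt.1 (h4.comp p h3)

theorem chartFlow_zero {i : Fin 3} {x : M} {y : E7} (hy : y ∈ (extChartAt (𝓡 7) x).target) :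
    chartFlow i x (0, y) = y := by
  simp only [chartFlow, SO3.rotation_zero, one_smul]
  exact (extChartAt (𝓡 7) x).right_inv hy

theorem zero_rotation_mem {i : Fin 3} {x : M} {y : E7} (hy : y ∈ (extChartAt (𝓡 7) x).target) :
    SO3.rotation i 0 • (extChartAt (𝓡 7) x).symm y ∈ (extChartAt (𝓡 7) x).source := by
  rw [SO3.rotation_zero, one_smul]
  exact (extChartAt (𝓡 7) x).map_target hy

theorem contDiffAt_chartFlow_zero {i : Fin 3} {x : M} {y : E7} (hy : y ∈ (extChartAt (𝓡 7) x).target) :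
    ContDiffAt ℝ ∞ (chartFlow i x) (0, y) :=
  contDiffAt_chartFlow hy (zero_rotation_mem hy)

theorem eventually_rotation_mem (i : Fin 3) {x : M} {y : E7} (hy : y ∈ (extChartAt (𝓡 7) x).target) :
    ∀ᶠ t in 𝓝 (0 : ℝ), SO3.rotation i t • (extChartAt (𝓡 7) x).symm y ∈ (extChartAt (𝓡 7) x).source := by
  have h1 : ContMDiff 𝓘(ℝ, ℝ) (𝓡 7) ∞ (fun t => SO3.rotation i t • (extChartAt (𝓡 7) x).symm y) :=
    (contMDiff_orbit _).comp (SO3.contMDiff_rotation i)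
  exact h1.continuous.continuousAt.eventually_mem
    ((isOpen_extChartAt_source (I := 𝓡 7) x).mem_nhds (zero_rotation_mem hy))

theorem symmD_chartFlow {i : Fin 3} {x : M} {t : ℝ} {y : E7}
    (hy : y ∈ (extChartAt (𝓡 7) x).target)
    (hs : SO3.rotation i t • (extChartAt (𝓡 7) x).symm y ∈ (extChartAt (𝓡 7) x).source) (v : E7) :
    symmD x (chartFlow i x (t, y)) (fderiv ℝ (chartFlow i x) (t, y) (0, v)) =
      actD (SO3.rotation i t) ((extChartAt (𝓡 7) x).symm y) (symmD x y v) := by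
  have hΦ : HasFDerivAt (fun z => chartFlow i x (t, z))
      ((fderiv ℝ (chartFlow i x) (t, y)).comp (ContinuousLinearMap.inr ℝ ℝ E7)) y :=
    ((contDiffAt_chartFlow (p := (t, y)) hy hs).differentiableAt (by simp)).hasFDerivAt.comp y
      ((hasFDerivAt_const _ _).prodMk (hasFDerivAt_id _))
  have ht : chartFlow i x (t, y) ∈ (extChartAt (𝓡 7) x).target := (extChartAt (𝓡 7) x).map_source hs
  have h1 := (hasMFDerivAt_symm ht).comp y hΦ.hasMFDerivAt
  have h2 := (hasMFDerivAt_act (SO3.rotation i t) ((extChartAt (𝓡 7) x).symm y)).comp y (hasMFDerivAt_symm hy)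
  have h3 : ((fun m : M => SO3.rotation i t • m) ∘ (extChartAt (𝓡 7) x).symm) =ᶠ[𝓝 y]
      (extChartAt (𝓡 7) x).symm ∘ fun z => chartFlow i x (t, z) := by
    have hc : ContinuousAt (fun z => SO3.rotation i t • (extChartAt (𝓡 7) x).symm z) y := h2.continuousAt
    filter_upwards [hc.eventually_mem ((isOpen_extChartAt_source (I := 𝓡 7) x).mem_nhds hs)] with z hz
    exact ((extChartAt (𝓡 7) x).left_inv hz).symm
  have h4 := hasMFDerivAt_unique (h1.congr_of_eventuallyEq h3) h2
  exact DFunLike.congr_fun h4 v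

theorem symmD_chartField {i : Fin 3} {x : M} {y : E7} (hy : y ∈ (extChartAt (𝓡 7) x).target) :
    symmD x y (chartField i x y) = fieldE i ((extChartAt (𝓡 7) x).symm y) := by
  have h0 := (hasDerivAt_flow (contDiffAt_chartFlow_zero (i := i) hy)).hasFDerivAt.hasMFDerivAt
  have h1 := hasMFDerivAt_symm hy
  rw [← chartFlow_zero (i := i) hy] at h1
  have h2 := h1.comp (0 : ℝ) h0
  have h3 := hasMFDerivAt_rotation_smul i ((extChartAt (𝓡 7) x).symm y)
  have h4 : (fun t => SO3.rotation i t • (extChartAt (𝓡 7) x).symm y) =ᶠ[𝓝 0]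
      (extChartAt (𝓡 7) x).symm ∘ fun t => chartFlow i x (t, y) := by
    filter_upwards [eventually_rotation_mem i hy] with t ht
    exact ((extChartAt (𝓡 7) x).left_inv ht).symm
  have h5 := DFunLike.congr_fun (hasMFDerivAt_unique (h2.congr_of_eventuallyEq h4) h3) (1 : ℝ)
  have h6 : symmD x (chartFlow i x (0, y)) ((1 : ℝ) • generator (chartFlow i x) y) =
    (1 : ℝ) • fieldE i ((extChartAt (𝓡 7) x).symm y) := h5
  rwa [one_smul, one_smul, chartFlow_zero hy] at h6

theorem contDiffOn_chartField (i : Fin 3) (x : M) :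
    ContDiffOn ℝ ∞ (chartField i x) (extChartAt (𝓡 7) x).target := by
  intro y hy
  have h := (contDiffAt_chartFlow_zero (i := i) hy).fderiv_right (m := ∞) (by simp)
  have h2 : ContDiffAt ℝ ∞ (fun z : E7 => fderiv ℝ (chartFlow i x) (0, z)) y :=
    h.comp y (contDiffAt_const.prodMk contDiffAt_id)
  exact (h2.clm_apply contDiffAt_const).contDiffWithinAt

theorem differentiableAt_chartField (i : Fin 3) {x : M} {y : E7} (hy : y ∈ (extChartAt (𝓡 7) x).target) :
    DifferentiableAt ℝ (chartField i x) y :=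
  (contDiffOn_chartField i x).contDiffAt (target_mem_nhds hy) |>.differentiableAt (by simp)

theorem differentiableAt_inChart {k : ℕ} {η : DForm M k} (hη : η.IsSmooth) {x : M} {y : E7}
    (hy : y ∈ (extChartAt (𝓡 7) x).target) : DifferentiableAt ℝ (η.inChart x) y :=
  (hη x).contDiffAt (target_mem_nhds hy) |>.differentiableAt (by simp)

theorem lieDerivative_inChart {k : ℕ} {η : DForm M k} (hη : η.IsSmooth) (hinv : η.ActInvariant)
    (i : Fin 3) {x : M} {y : E7} (hy : y ∈ (extChartAt (𝓡 7) x).target) (v : Fin k → E7) :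
    fderiv ℝ (η.inChart x) y (chartField i x y) v +
      ∑ l, η.inChart x y (update v l (fderiv ℝ (chartField i x) y (v l))) = 0 := by
  refine lieDerivative_eq_zero (contDiffAt_chartFlow_zero hy) ?_ (differentiableAt_inChart hη hy) ?_ v
  · filter_upwards [target_mem_nhds hy] with z hz using chartFlow_zero hz
  · intro v
    filter_upwards [eventually_rotation_mem i hy] with t ht
    have h1 : (extChartAt (𝓡 7) x).symm (chartFlow i x (t, y)) =
        SO3.rotation i t • (extChartAt (𝓡 7) x).symm y := (extChartAt (𝓡 7) x).left_inv ht
    rw [inChart_eq, inChart_eq, h1, ContinuousAlternatingMap.compContinuousLinearMap_apply,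
      ContinuousAlternatingMap.compContinuousLinearMap_apply, ← hinv (SO3.rotation i t) ((extChartAt (𝓡 7) x).symm y)]
    rw [ContinuousAlternatingMap.compContinuousLinearMap_apply]
    refine congrArg _ (funext fun l => ?_)
    exact symmD_chartFlow hy ht (v l)

/-- The infinitesimal form of `actD_fieldE` along `exp(t eᵢ)`. The coefficients are those of
`[eᵢ,eⱼ]`, but the difference of derivatives is the bracket `[Xⱼ,Xᵢ]`: a left action induces an
anti-homomorphism. -/
theorem bracket_chartField (i j : Fin 3) {x : M} {y : E7} (hy : y ∈ (extChartAt (𝓡 7) x).target) :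
    fderiv ℝ (chartField i x) y (chartField j x y) =
      ∑ k, SO3.liegen i k j • chartField k x y + fderiv ℝ (chartField j x) y (chartField i x y) := by
  have hΦ := contDiffAt_chartFlow_zero (i := i) hy
  have h1 := hasDerivAt_fderiv_flow hΦ (chartField j x y)
  -- Equivariance for finite `t`; the bracket formula results from differentiating both sides at `t
  -- = 0`.
  have hev : (fun t => fderiv ℝ (chartFlow i x) (t, y) (0, chartField j x y)) =ᶠ[𝓝 0]
      fun t => ∑ k, (SO3.rotation i t).1 k j • chartField k x (chartFlow i x (t, y)) := by
    filter_upwards [eventually_rotation_mem i hy] with t ht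
    have ht' : chartFlow i x (t, y) ∈ (extChartAt (𝓡 7) x).target := (extChartAt (𝓡 7) x).map_source ht
    have h2 : (extChartAt (𝓡 7) x).symm (chartFlow i x (t, y)) =
        SO3.rotation i t • (extChartAt (𝓡 7) x).symm y := (extChartAt (𝓡 7) x).left_inv ht
    obtain ⟨τ, hτ, -⟩ := exists_equiv_symmD ht'
    apply τ.injective
    change (τ : E7 →L[ℝ] E7) _ = (τ : E7 →L[ℝ] E7) _
    rw [hτ, symmD_chartFlow hy ht, symmD_chartField hy, actD_fieldE, map_sum]
    refine Finset.sum_congr rfl fun k _ => ?_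
    rw [map_smul, symmD_chartField ht', h2]
  have h3 : HasDerivAt (fun t => ∑ k, (SO3.rotation i t).1 k j • chartField k x (chartFlow i x (t, y)))
      (∑ k, ((SO3.rotation i 0).1 k j • fderiv ℝ (chartField k x) y (chartField i x y) +
        SO3.liegen i k j • chartField k x (chartFlow i x (0, y)))) 0 := by
    refine HasDerivAt.fun_sum fun k _ => HasDerivAt.fun_smul ?_ ?_
    · refine (SO3.hasDerivAt_rotation i 0 k j).congr_deriv ?_
      rw [SO3.rotation_zero]
      exact congrFun (congrFun (one_mul (SO3.liegen i)) k) j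
    · have h4 : HasFDerivAt (chartField k x) (fderiv ℝ (chartField k x) y) (chartFlow i x (0, y)) := by
        rw [chartFlow_zero hy]
        exact (differentiableAt_chartField k hy).hasFDerivAt
      exact h4.comp_hasDerivAt (0 : ℝ) (hasDerivAt_flow hΦ)
  have h5 := h1.unique (h3.congr_of_eventuallyEq hev)
  have h6 : ∀ k, (SO3.rotation i 0).1 k j = if k = j then (1 : ℝ) else 0 := fun k => by
    rw [SO3.rotation_zero]; exact Matrix.one_apply
  simp only [h6, chartFlow_zero hy, Finset.sum_add_distrib, ite_smul, one_smul, zero_smul, Finset.sum_ite_eq',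
    Finset.mem_univ, if_true] at h5
  rw [add_comm] at h5
  exact h5

end ChartFlow

/-! ### Contractions of closed invariant forms, as multilinear algebra. -/

section LieAlgebraic
variable {E : Type*} [NormedAddCommGroup E] [NormedSpace ℝ E]

theorem alt3_swap01 (α : E [⋀^Fin 3]→L[ℝ] ℝ) (a b c : E) : α ![b, a, c] = -α ![a, b, c] := by
  refine Eq.trans (congrArg α (funext fun i => ?_))
    (α.toAlternatingMap.map_swap ![a, b, c] (i := 0) (j := 1) (by decide))
  fin_cases i <;> rfl

theorem alt3_swap12 (α : E [⋀^Fin 3]→L[ℝ] ℝ) (a b c : E) : α ![a, c, b] = -α ![a, b, c] := by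
  refine Eq.trans (congrArg α (funext fun i => ?_))
    (α.toAlternatingMap.map_swap ![a, b, c] (i := 1) (j := 2) (by decide))
  fin_cases i <;> rfl

theorem alt4_swap01 (α : E [⋀^Fin 4]→L[ℝ] ℝ) (a b c d : E) : α ![b, a, c, d] = -α ![a, b, c, d] := by
  refine Eq.trans (congrArg α (funext fun i => ?_))
    (α.toAlternatingMap.map_swap ![a, b, c, d] (i := 0) (j := 1) (by decide))
  fin_cases i <;> rfl

theorem alt4_swap12 (α : E [⋀^Fin 4]→L[ℝ] ℝ) (a b c d : E) : α ![a, c, b, d] = -α ![a, b, c, d] := by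
  refine Eq.trans (congrArg α (funext fun i => ?_))
    (α.toAlternatingMap.map_swap ![a, b, c, d] (i := 1) (j := 2) (by decide))
  fin_cases i <;> rfl

theorem alt4_swap23 (α : E [⋀^Fin 4]→L[ℝ] ℝ) (a b c d : E) : α ![a, b, d, c] = -α ![a, b, c, d] := by
  refine Eq.trans (congrArg α (funext fun i => ?_))
    (α.toAlternatingMap.map_swap ![a, b, c, d] (i := 2) (j := 3) (by decide))
  fin_cases i <;> rfl

theorem alt3_update (α : E [⋀^Fin 3]→L[ℝ] ℝ) (A : E → E) (a b c : E) :
    ∑ l, α (update ![a, b, c] l (A (![a, b, c] l))) =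
      α ![A a, b, c] + α ![a, A b, c] + α ![a, b, A c] := by
  have h0 : update ![a, b, c] 0 (A a) = ![A a, b, c] := by ext i; fin_cases i <;> rfl
  have h1 : update ![a, b, c] 1 (A b) = ![a, A b, c] := by ext i; fin_cases i <;> rfl
  have h2 : update ![a, b, c] 2 (A c) = ![a, b, A c] := by ext i; fin_cases i <;> rfl
  rw [Fin.sum_univ_three, ← h0, ← h1, ← h2]
  rfl

theorem alt4_update (α : E [⋀^Fin 4]→L[ℝ] ℝ) (A : E → E) (a b c d : E) :
    ∑ l, α (update ![a, b, c, d] l (A (![a, b, c, d] l))) =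
      α ![A a, b, c, d] + α ![a, A b, c, d] + α ![a, b, A c, d] + α ![a, b, c, A d] := by
  have h0 : update ![a, b, c, d] 0 (A a) = ![A a, b, c, d] := by ext i; fin_cases i <;> rfl
  have h1 : update ![a, b, c, d] 1 (A b) = ![a, A b, c, d] := by ext i; fin_cases i <;> rfl
  have h2 : update ![a, b, c, d] 2 (A c) = ![a, b, A c, d] := by ext i; fin_cases i <;> rfl
  have h3 : update ![a, b, c, d] 3 (A d) = ![a, b, c, A d] := by ext i; fin_cases i <;> rfl
  rw [Fin.sum_univ_four, ← h0, ← h1, ← h2, ← h3]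
  rfl

theorem closed4 {ψ' : E →L[ℝ] E [⋀^Fin 4]→L[ℝ] ℝ}
    (h : ContinuousAlternatingMap.alternatizeUncurryFin ψ' = 0) (a b c d e : E) :
    ψ' a ![b, c, d, e] - ψ' b ![a, c, d, e] + ψ' c ![a, b, d, e] - ψ' d ![a, b, c, e]
      + ψ' e ![a, b, c, d] = 0 := by
  have h1 := DFunLike.congr_fun h ![a, b, c, d, e]
  rw [ContinuousAlternatingMap.alternatizeUncurryFin_apply] at h1
  have h0 : (0 : Fin 5).removeNth ![a, b, c, d, e] = ![b, c, d, e] := by ext i; fin_cases i <;> rfl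
  have h2 : (1 : Fin 5).removeNth ![a, b, c, d, e] = ![a, c, d, e] := by ext i; fin_cases i <;> rfl
  have h3 : (2 : Fin 5).removeNth ![a, b, c, d, e] = ![a, b, d, e] := by ext i; fin_cases i <;> rfl
  have h4 : (3 : Fin 5).removeNth ![a, b, c, d, e] = ![a, b, c, e] := by ext i; fin_cases i <;> rfl
  have h5 : (4 : Fin 5).removeNth ![a, b, c, d, e] = ![a, b, c, d] := by ext i; fin_cases i <;> rfl
  rw [Fin.sum_univ_five, h0, h2, h3, h4, h5] at h1
  simp at h1
  linarith

theorem closed3 {ψ' : E →L[ℝ] E [⋀^Fin 3]→L[ℝ] ℝ}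
    (h : ContinuousAlternatingMap.alternatizeUncurryFin ψ' = 0) (a b c d : E) :
    ψ' a ![b, c, d] - ψ' b ![a, c, d] + ψ' c ![a, b, d] - ψ' d ![a, b, c] = 0 := by
  have h1 := DFunLike.congr_fun h ![a, b, c, d]
  rw [ContinuousAlternatingMap.alternatizeUncurryFin_apply] at h1
  have h0 : (0 : Fin 4).removeNth ![a, b, c, d] = ![b, c, d] := by ext i; fin_cases i <;> rfl
  have h2 : (1 : Fin 4).removeNth ![a, b, c, d] = ![a, c, d] := by ext i; fin_cases i <;> rfl
  have h3 : (2 : Fin 4).removeNth ![a, b, c, d] = ![a, b, d] := by ext i; fin_cases i <;> rfl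
  have h4 : (3 : Fin 4).removeNth ![a, b, c, d] = ![a, b, c] := by ext i; fin_cases i <;> rfl
  rw [Fin.sum_univ_four, h0, h2, h3, h4] at h1
  simp at h1
  linarith

variable {X : Fin 3 → E} {A : Fin 3 → E →L[ℝ] E}

/-- The contraction of a closed invariant 4-form with three fields spanning `𝔰𝔬(3)` is closed. -/
theorem contraction_closed {ψ : E [⋀^Fin 4]→L[ℝ] ℝ} {ψ' : E →L[ℝ] E [⋀^Fin 4]→L[ℝ] ℝ}
    (hcl : ContinuousAlternatingMap.alternatizeUncurryFin ψ' = 0)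
    (hlie : ∀ i (v : Fin 4 → E), ψ' (X i) v + ∑ l, ψ (update v l (A i (v l))) = 0)
    (h01 : A 0 (X 1) = X 2 + A 1 (X 0)) (h12 : A 1 (X 2) = X 0 + A 2 (X 1))
    (h20 : A 2 (X 0) = X 1 + A 0 (X 2)) (v w : E) :
    ψ' v ![X 2, X 1, X 0, w] + ψ ![A 2 v, X 1, X 0, w] + ψ ![X 2, A 1 v, X 0, w] + ψ ![X 2, X 1, A 0 v, w] =
    ψ' w ![X 2, X 1, X 0, v] + ψ ![A 2 w, X 1, X 0, v] + ψ ![X 2, A 1 w, X 0, v] + ψ ![X 2, X 1, A 0 w, v] := by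
  have e1 := closed4 hcl (X 2) (X 1) (X 0) w v
  have e2 := hlie 2 ![X 1, X 0, w, v]
  have e3 := hlie 1 ![X 2, X 0, w, v]
  have e4 := hlie 0 ![X 2, X 1, w, v]
  rw [alt4_update] at e2 e3 e4
  have z : ∀ a b c, ψ ![a, a, b, c] = 0 := fun a b c =>
    ψ.map_eq_zero_of_eq ![a, a, b, c] (i := 0) (j := 1) rfl (by decide)
  have add0 : ∀ a a' b c d, ψ ![a + a', b, c, d] = ψ ![a, b, c, d] + ψ ![a', b, c, d] :=
    fun a a' b c d => ψ.toMultilinearMap.cons_add ![b, c, d] a a'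
  have add1 : ∀ a b b' c d, ψ ![a, b + b', c, d] = ψ ![a, b, c, d] + ψ ![a, b', c, d] := fun a b b' c d => by
    rw [alt4_swap01, add0, alt4_swap01 ψ a b, alt4_swap01 ψ a b']; ring
  -- In each of the three Lie derivative identities the bracket produces a field already present
  -- among the arguments, so its term vanishes.
  rw [h20, add1, z] at e2
  rw [h12, add0, z] at e3
  rw [h01, add1, z] at e4
  have s1 := alt4_swap01 ψ (X 1) (A 0 (X 2)) w v
  have s2 := alt4_swap01 ψ (X 0) (A 2 (X 1)) w v
  have s3 := alt4_swap01 ψ (X 2) (A 1 (X 0)) w v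
  have p1 : ∀ a b c d, ψ ![a, b, c, d] = ψ ![b, c, a, d] := fun a b c d => by
    rw [alt4_swap01, alt4_swap12]; ring
  have p2 : ∀ a b c d, ψ ![a, b, c, d] = -ψ ![b, c, d, a] := fun a b c d => by
    rw [p1, alt4_swap23]
  have t1 := p1 (A 2 w) (X 1) (X 0) v
  have t2 := p2 (A 2 v) (X 1) (X 0) w
  have t3 := alt4_swap12 ψ (X 2) (X 0) (A 1 w) v
  have t4 := alt4_swap12 ψ (X 2) (X 0) (A 1 v) w
  have t5 := alt4_swap23 ψ (X 2) (X 0) (A 1 v) w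
  have t6 := alt4_swap23 ψ (X 2) (X 1) (A 0 v) w
  linarith

/-- The complete contraction of a closed invariant 3-form with three fields spanning `𝔰𝔬(3)` is
locally constant. -/
theorem contraction_const {ψ : E [⋀^Fin 3]→L[ℝ] ℝ} {ψ' : E →L[ℝ] E [⋀^Fin 3]→L[ℝ] ℝ}
    (hcl : ContinuousAlternatingMap.alternatizeUncurryFin ψ' = 0)
    (hlie : ∀ i (v : Fin 3 → E), ψ' (X i) v + ∑ l, ψ (update v l (A i (v l))) = 0)
    (h01 : A 0 (X 1) = X 2 + A 1 (X 0)) (h12 : A 1 (X 2) = X 0 + A 2 (X 1))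
    (h20 : A 2 (X 0) = X 1 + A 0 (X 2)) (v : E) :
    ψ' v ![X 0, X 1, X 2] + (ψ ![A 0 v, X 1, X 2] + ψ ![X 0, A 1 v, X 2] + ψ ![X 0, X 1, A 2 v]) = 0 := by
  have e1 := closed3 hcl v (X 0) (X 1) (X 2)
  have e2 := hlie 0 ![v, X 1, X 2]
  have e3 := hlie 1 ![v, X 0, X 2]
  have e4 := hlie 2 ![v, X 0, X 1]
  rw [alt3_update] at e2 e3 e4
  have z : ∀ a b, ψ ![b, a, a] = 0 := fun a b =>
    ψ.map_eq_zero_of_eq ![b, a, a] (i := 1) (j := 2) rfl (by decide)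
  have add0 : ∀ a a' b c, ψ ![a + a', b, c] = ψ ![a, b, c] + ψ ![a', b, c] :=
    fun a a' b c => ψ.toMultilinearMap.cons_add ![b, c] a a'
  have add1 : ∀ a b b' c, ψ ![a, b + b', c] = ψ ![a, b, c] + ψ ![a, b', c] := fun a b b' c => by
    rw [alt3_swap01, add0, alt3_swap01 ψ a b, alt3_swap01 ψ a b']; ring
  have add2 : ∀ a b c c', ψ ![a, b, c + c'] = ψ ![a, b, c] + ψ ![a, b, c'] := fun a b c c' => by
    rw [alt3_swap12, add1, alt3_swap12 ψ a b, alt3_swap12 ψ a b c']; ring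
  rw [h01, add1, z] at e2
  rw [h12, add2, z] at e3
  rw [h20, add1, z] at e4
  have s1 := alt3_swap12 ψ v (X 1) (A 0 (X 2))
  have t1 := alt3_swap01 ψ (X 0) (A 1 v) (X 2)
  have t2 := alt3_swap01 ψ (X 0) (A 2 v) (X 1)
  have t3 := alt3_swap12 ψ (X 0) (X 1) (A 2 v)
  linarith

end LieAlgebraic

/-! ### The 1-form `i_{X₁}i_{X₂}i_{X₃}(∗φ)` and the function `φ(X₁,X₂,X₃)`. -/

section Invariance
variable {M : Type*} [TopologicalSpace M] [ChartedSpace E7 M] [MulAction SO3 M]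
  [IsManifold (𝓡 7) ∞ M] [ContMDiffSMul (𝓡 3) (𝓡 7) ∞ SO3 M] {P : G2Structure M}

namespace G2Structure

theorem IsInvariant.form_actInvariant (h : P.IsInvariant) : P.form.ActInvariant := h

theorem IsInvariant.exists_frames (h : P.IsInvariant) (A : SO3) (m : M) :
    ∃ σ : E7 ≃L[ℝ] E7, (∀ v, σ v = P.frameE (A • m) (actD A m v)) ∧
      phi0.compContinuousLinearMap (σ : E7 →L[ℝ] E7) =
        phi0.compContinuousLinearMap (P.frameE m : E7 →L[ℝ] E7) := by
  obtain ⟨τ, hτ⟩ := exists_equiv_actD A m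
  refine ⟨τ.trans (P.frameE (A • m)), fun v => by rw [← hτ]; rfl, ?_⟩
  have h1 := h.form_actInvariant A m
  rw [valE_form, valE_form, ← hτ] at h1
  rw [← h1]
  rfl

/-- The frame at `A • m` composed with the derivative of `A` is a second frame at `m` for the same
3-form, and `∗φ` does not depend on the frame. -/
theorem IsInvariant.starForm_actInvariant (h : P.IsInvariant) : P.starForm.ActInvariant := by
  intro A m
  obtain ⟨σ, hσ, h1⟩ := h.exists_frames A m
  rw [valE_starForm, valE_starForm, ← starPhi0_comp_eq h1]
  ext v
  simp only [ContinuousAlternatingMap.compContinuousLinearMap_apply]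
  refine congrArg _ (funext fun i => ?_)
  exact (hσ (v i)).symm

theorem IsInvariant.inner_actD (h : P.IsInvariant) (A : SO3) (m : M) (u v : E7) :
    inner ℝ (P.frameE (A • m) (actD A m u)) (P.frameE (A • m) (actD A m v)) =
      inner ℝ (P.frameE m u) (P.frameE m v) := by
  obtain ⟨σ, hσ, h1⟩ := h.exists_frames A m
  rw [← hσ, ← hσ, inner_eq_of_phi0_comp_eq h1]

/-- The linear form `i_{X₁} i_{X₂} i_{X₃} (∗φ)`. -/
noncomputable def momentLinear (P : G2Structure M) (m : M) : E7 →L[ℝ] ℝ :=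
  (P.starForm.valE m).toContinuousLinearMap ![fieldE 2 m, fieldE 1 m, fieldE 0 m, 0] 3

theorem momentLinear_apply (P : G2Structure M) (m : M) (w : E7) :
    P.momentLinear m w = P.starForm.valE m ![fieldE 2 m, fieldE 1 m, fieldE 0 m, w] := by
  rw [momentLinear, ContinuousAlternatingMap.toContinuousLinearMap_apply]
  refine congrArg _ (funext fun i => ?_)
  fin_cases i <;> rfl

/-- The 1-form `i_{X₁} i_{X₂} i_{X₃} (∗φ)`. -/
noncomputable def momentForm (P : G2Structure M) : DForm M 1 := fun m =>
  (ContinuousAlternatingMap.ofSubsingleton ℝ E7 ℝ (0 : Fin 1) (P.momentLinear m) : E7 [⋀^Fin 1]→L[ℝ] ℝ)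

theorem momentForm_valE (P : G2Structure M) (m : M) (v : Fin 1 → E7) :
    P.momentForm.valE m v = P.momentLinear m (v 0) := rfl

theorem momentForm_inChart (P : G2Structure M) {x : M} {y : E7} (hy : y ∈ (extChartAt (𝓡 7) x).target)
    (v : Fin 1 → E7) : P.momentForm.inChart x y v =
      P.starForm.inChart x y ![chartField 2 x y, chartField 1 x y, chartField 0 x y, v 0] := by
  rw [inChart_eq, inChart_eq, ContinuousAlternatingMap.compContinuousLinearMap_apply,
    ContinuousAlternatingMap.compContinuousLinearMap_apply, momentForm_valE, momentLinear_apply]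
  refine congrArg _ (funext fun i => ?_)
  fin_cases i
  · exact (symmD_chartField hy).symm
  · exact (symmD_chartField hy).symm
  · exact (symmD_chartField hy).symm
  · rfl

theorem momentForm_smooth (P : G2Structure M) : P.momentForm.IsSmooth := by
  intro x
  refine contDiffOn_alternating fun s => ?_
  have h := contDiffOn_alternating_apply (P.starForm_smooth x)
    (V := ![chartField 2 x, chartField 1 x, chartField 0 x, fun _ => stdE (s 0)]) (fun i => by
      fin_cases i
      · exact contDiffOn_chartField 2 x
      · exact contDiffOn_chartField 1 x
      · exact contDiffOn_chartField 0 x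
      · exact contDiffOn_const)
  refine h.congr fun y hy => ?_
  rw [momentForm_inChart P hy]
  refine congrArg _ (funext fun i => ?_)
  fin_cases i <;> rfl

theorem bracket_explicit {x : M} {y : E7} (hy : y ∈ (extChartAt (𝓡 7) x).target) :
    fderiv ℝ (chartField 0 x) y (chartField 1 x y) =
        chartField 2 x y + fderiv ℝ (chartField 1 x) y (chartField 0 x y) ∧
      fderiv ℝ (chartField 1 x) y (chartField 2 x y) =
        chartField 0 x y + fderiv ℝ (chartField 2 x) y (chartField 1 x y) ∧
      fderiv ℝ (chartField 2 x) y (chartField 0 x y) =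
        chartField 1 x y + fderiv ℝ (chartField 0 x) y (chartField 2 x y) := by
  refine ⟨?_, ?_, ?_⟩
  · rw [bracket_chartField 0 1 hy, Fin.sum_univ_three]; simp [SO3.liegen, SO3.hat]
  · rw [bracket_chartField 1 2 hy, Fin.sum_univ_three]; simp [SO3.liegen, SO3.hat]
  · rw [bracket_chartField 2 0 hy, Fin.sum_univ_three]; simp [SO3.liegen, SO3.hat]

theorem fderiv_contraction {k : ℕ} {η : DForm M k} (hη : η.IsSmooth) {x : M} {y : E7}
    (hy : y ∈ (extChartAt (𝓡 7) x).target) {V : Fin k → E7 → E7}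
    (hV : ∀ i, DifferentiableAt ℝ (V i) y) (v : E7) :
    fderiv ℝ (fun z => η.inChart x z (fun i => V i z)) y v =
      fderiv ℝ (η.inChart x) y v (fun i => V i y) +
        ∑ i, η.inChart x y (update (fun i => V i y) i (fderiv ℝ (V i) y v)) := by
  have h := ((differentiableAt_inChart hη hy).hasFDerivAt.continuousAlternatingMap_apply
    fun i => (hV i).hasFDerivAt)
  rw [h.fderiv]
  simp

theorem momentForm_closed (hP : P.TorsionFree) (h : P.IsInvariant) : P.momentForm.IsClosed := by
  intro x y hy
  ext v
  rw [extDeriv_apply (differentiableAt_inChart P.momentForm_smooth hy), Fin.sum_univ_two]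
  have hval : ∀ w : E7, ∀ u : Fin 1 → E7, (u 0 = w) → ∀ u' : E7,
      fderiv ℝ (fun z => P.momentForm.inChart x z u) y u' =
        fderiv ℝ (P.starForm.inChart x) y u' ![chartField 2 x y, chartField 1 x y, chartField 0 x y, w] +
        P.starForm.inChart x y ![fderiv ℝ (chartField 2 x) y u', chartField 1 x y, chartField 0 x y, w] +
        P.starForm.inChart x y ![chartField 2 x y, fderiv ℝ (chartField 1 x) y u', chartField 0 x y, w] +
        P.starForm.inChart x y ![chartField 2 x y, chartField 1 x y, fderiv ℝ (chartField 0 x) y u', w] := by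
    intro w u hu u'
    set V : Fin 4 → E7 → E7 := ![chartField 2 x, chartField 1 x, chartField 0 x, fun _ => w] with hV
    have hVd : ∀ i, DifferentiableAt ℝ (V i) y := fun i => by
      fin_cases i
      · exact differentiableAt_chartField 2 hy
      · exact differentiableAt_chartField 1 hy
      · exact differentiableAt_chartField 0 hy
      · exact differentiableAt_const _
    have hev : (fun z => P.momentForm.inChart x z u) =ᶠ[𝓝 y]
        fun z => P.starForm.inChart x z (fun i => V i z) := by
      filter_upwards [target_mem_nhds hy] with z hz
      rw [momentForm_inChart P hz, hu]
      refine congrArg _ (funext fun i => ?_)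
      fin_cases i <;> rfl
    have hVy : (fun i => V i y) = ![chartField 2 x y, chartField 1 x y, chartField 0 x y, w] := by
      ext1 i; fin_cases i <;> rfl
    rw [hev.fderiv_eq, fderiv_contraction P.starForm_smooth hy hVd, hVy, Fin.sum_univ_four]
    have h3 : fderiv ℝ (V 3) y u' = 0 := by
      change fderiv ℝ (fun _ : E7 => w) y u' = 0
      rw [fderiv_fun_const]; rfl
    rw [h3]
    have z3 : P.starForm.inChart x y (update ![chartField 2 x y, chartField 1 x y, chartField 0 x y, w] 3 0) = 0 :=
      (P.starForm.inChart x y).map_coord_zero 3 (update_self ..)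
    have e0 : update ![chartField 2 x y, chartField 1 x y, chartField 0 x y, w] 0 (fderiv ℝ (V 0) y u') =
      ![fderiv ℝ (chartField 2 x) y u', chartField 1 x y, chartField 0 x y, w] := by
      ext1 i; fin_cases i <;> rfl
    have e1 : update ![chartField 2 x y, chartField 1 x y, chartField 0 x y, w] 1 (fderiv ℝ (V 1) y u') =
      ![chartField 2 x y, fderiv ℝ (chartField 1 x) y u', chartField 0 x y, w] := by
      ext1 i; fin_cases i <;> rfl
    have e2 : update ![chartField 2 x y, chartField 1 x y, chartField 0 x y, w] 2 (fderiv ℝ (V 2) y u') =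
      ![chartField 2 x y, chartField 1 x y, fderiv ℝ (chartField 0 x) y u', w] := by
      ext1 i; fin_cases i <;> rfl
    rw [z3, e0, e1, e2]
    ring
  rw [hval (v 1) _ rfl, hval (v 0) _ rfl]
  obtain ⟨h01, h12, h20⟩ := bracket_explicit (M := M) hy
  have key := contraction_closed (X := fun i => chartField i x y) (A := fun i => fderiv ℝ (chartField i x) y)
    (hP.2 x y hy) (fun i v => lieDerivative_inChart P.starForm_smooth h.starForm_actInvariant i hy v)
    h01 h12 h20 (v 0) (v 1)
  simp
  linarith

/-- The function `φ(X₁, X₂, X₃)`. -/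
noncomputable def formOnFields (P : G2Structure M) (m : M) : ℝ :=
  P.form.valE m ![fieldE 0 m, fieldE 1 m, fieldE 2 m]

theorem formOnFields_chart (P : G2Structure M) {x : M} {y : E7} (hy : y ∈ (extChartAt (𝓡 7) x).target) :
    P.formOnFields ((extChartAt (𝓡 7) x).symm y) =
      P.form.inChart x y (fun i => chartField i x y) := by
  rw [inChart_eq, ContinuousAlternatingMap.compContinuousLinearMap_apply]
  refine congrArg _ (funext fun i => ?_)
  fin_cases i <;> exact (symmD_chartField hy).symm

theorem formOnFields_locallyConstant (hP : P.TorsionFree) (h : P.IsInvariant) :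
    IsLocallyConstant P.formOnFields := by
  rw [IsLocallyConstant.iff_eventually_eq]
  intro x
  have hx := mem_extChartAt_target (I := 𝓡 7) x
  -- A ball is convex, so on it vanishing of the derivative, proved by `contraction_const`, forces
  -- constancy.
  obtain ⟨r, hr, hball⟩ := Metric.isOpen_iff.1 (isOpen_target x) _ hx
  have hd : ∀ y ∈ (extChartAt (𝓡 7) x).target,
      HasFDerivAt (fun z => P.form.inChart x z (fun i => chartField i x z)) (0 : E7 →L[ℝ] ℝ) y := by
    intro y hy
    have h1 : DifferentiableAt ℝ (fun z => P.form.inChart x z (fun i => chartField i x z)) y :=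
      (differentiableAt_inChart P.smooth hy).continuousAlternatingMap_apply
        fun i => differentiableAt_chartField i hy
    have h2 : fderiv ℝ (fun z => P.form.inChart x z (fun i => chartField i x z)) y = 0 := by
      ext v
      rw [fderiv_contraction P.smooth hy fun i => differentiableAt_chartField i hy]
      obtain ⟨h01, h12, h20⟩ := bracket_explicit (M := M) hy
      have key := contraction_const (X := fun i => chartField i x y) (A := fun i => fderiv ℝ (chartField i x) y)
        (hP.1 x y hy) (fun i v => lieDerivative_inChart P.smooth h.form_actInvariant i hy v)
        h01 h12 h20 v
      have hX : (fun i => chartField i x y) = ![chartField 0 x y, chartField 1 x y, chartField 2 x y] := by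
        ext1 i; fin_cases i <;> rfl
      have e0 : update ![chartField 0 x y, chartField 1 x y, chartField 2 x y] 0 (fderiv ℝ (chartField 0 x) y v) =
        ![fderiv ℝ (chartField 0 x) y v, chartField 1 x y, chartField 2 x y] := by
        ext1 i; fin_cases i <;> rfl
      have e1 : update ![chartField 0 x y, chartField 1 x y, chartField 2 x y] 1 (fderiv ℝ (chartField 1 x) y v) =
        ![chartField 0 x y, fderiv ℝ (chartField 1 x) y v, chartField 2 x y] := by
        ext1 i; fin_cases i <;> rfl
      have e2 : update ![chartField 0 x y, chartField 1 x y, chartField 2 x y] 2 (fderiv ℝ (chartField 2 x) y v) =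
        ![chartField 0 x y, chartField 1 x y, fderiv ℝ (chartField 2 x) y v] := by
        ext1 i; fin_cases i <;> rfl
      rw [hX, Fin.sum_univ_three, e0, e1, e2]
      exact key
    rw [← h2]
    exact h1.hasFDerivAt
  have hs : ∀ᶠ m in 𝓝 x, m ∈ (extChartAt (𝓡 7) x).source := extChartAt_source_mem_nhds (I := 𝓡 7) x
  have hmem := hs.and
    ((continuousAt_extChartAt (I := 𝓡 7) x).eventually_mem (Metric.ball_mem_nhds _ hr))
  filter_upwards [hmem] with m hm
  have h1 := P.formOnFields_chart (hball hm.2)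
  have h2 := P.formOnFields_chart hx
  rw [(extChartAt (𝓡 7) x).left_inv hm.1] at h1
  rw [extChartAt_to_inv] at h2
  rw [h1, h2]
  refine (convex_ball _ r).is_const_of_fderivWithin_eq_zero (𝕜 := ℝ)
    (f := fun z => P.form.inChart x z (fun i => chartField i x z))
    (fun z hz => (hd z (hball hz)).hasFDerivWithinAt.differentiableWithinAt) (fun z hz => ?_) hm.2 (Metric.mem_ball_self hr)
  exact (hd z (hball hz)).hasFDerivWithinAt.fderivWithin (Metric.isOpen_ball.uniqueDiffWithinAt hz)

end G2Structure
end Invariance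

/-! ### The potential `g`: invariance and critical points. -/

section Gradient
variable {M : Type*} [TopologicalSpace M] [ChartedSpace E7 M]

/-- The differential of a function, with the tangent space identified with `ℝ⁷`. -/
noncomputable def diffE (g : M → ℝ) (m : M) : E7 →L[ℝ] ℝ := differential g m

theorem hasMFDerivAt_diffE {g : M → ℝ} (hg : ContMDiff (𝓡 7) 𝓘(ℝ, ℝ) ∞ g) (m : M) :
    HasMFDerivAt (𝓡 7) 𝓘(ℝ, ℝ) g m (diffE g m) :=
  (hg.mdifferentiableAt (by simp)).hasMFDerivAt

/-- The gradient, with the tangent space identified with `ℝ⁷`. -/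
noncomputable def G2Structure.gradE (P : G2Structure M) (g : M → ℝ) (m : M) : E7 := P.gradient g m

theorem G2Structure.inner_frameE_gradE (P : G2Structure M) (g : M → ℝ) (m : M) (w : E7) :
    inner ℝ (P.frameE m (P.gradE g m)) (P.frameE m w) = diffE g m w :=
  P.metric_gradient g m w

end Gradient

section Moment
variable {M : Type*} [TopologicalSpace M] [ChartedSpace E7 M] [MulAction SO3 M]
  [IsManifold (𝓡 7) ∞ M] [ContMDiffSMul (𝓡 3) (𝓡 7) ∞ SO3 M] {P : G2Structure M} {g : M → ℝ}

theorem hasMFDerivAt_smul_at (A : SO3) (m : M) : HasMFDerivAt (𝓡 3) (𝓡 7) (fun C : SO3 => C • m) A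
    ((actD A m).comp (orbitD m)) := by
  have h2 := hasMFDerivAt_orbit m
  rw [← inv_mul_cancel A] at h2
  have h4 := hasMFDerivAt_act A ((A⁻¹ * A) • m)
  have h5 := h4.comp A (h2.comp A (SO3.hasMFDerivAt_inv_mul A))
  have h7 : ((fun x : M => A • x) ∘ (fun C : SO3 => C • m) ∘ fun C => A⁻¹ * C) = fun C : SO3 => C • m := by
    ext C
    simp [smul_smul]
  rw [h7] at h5
  refine h5.congr_mfderiv ?_
  change (actD A ((A⁻¹ * A) • m)).comp ((orbitD m).comp (ContinuousLinearMap.id ℝ E3)) = _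
  rw [inv_mul_cancel, one_smul]
  rfl

theorem isRegularPoint_iff (m : M) :
    IsRegularPoint m ↔ LinearIndependent ℝ ![fieldE 0 m, fieldE 1 m, fieldE 2 m] := by
  have h : ![fieldE 0 m, fieldE 1 m, fieldE 2 m] = fun i => fieldE i m := by
    ext1 i; fin_cases i <;> rfl
  rw [h]
  exact Iff.rfl

/-- The derivative of `A` is injective and carries the three fields into the span of the fields at
`A • m`, which therefore has dimension three. -/
theorem isRegularPoint_smul {m : M} (h : IsRegularPoint m) (A : SO3) : IsRegularPoint (A • m) := by
  have h' : LinearIndependent ℝ (fun i => fieldE i m) := h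
  have h0 : LinearIndependent ℝ (fun j => actD A m (fieldE j m)) := by
    obtain ⟨τ, hτ⟩ := exists_equiv_actD A m
    rw [← hτ]
    exact h'.map' (τ : E7 →ₗ[ℝ] E7) (LinearMap.ker_eq_bot.2 τ.injective)
  have h1 : ∀ j, actD A m (fieldE j m) ∈ Submodule.span ℝ (range fun k => fieldE k (A • m)) := fun j => by
    rw [actD_fieldE]
    exact Submodule.sum_mem _ fun k _ => Submodule.smul_mem _ _ (Submodule.subset_span ⟨k, rfl⟩)
  have h2 : LinearIndependent ℝ (fun k => fieldE k (A • m)) := by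
    rw [linearIndependent_iff_card_le_finrank_span]
    rw [linearIndependent_iff_card_eq_finrank_span] at h0
    rw [h0]
    exact Submodule.finrank_mono (Submodule.span_le.2 (by rintro _ ⟨j, rfl⟩; exact h1 j))
  exact h2

namespace G2Structure

/-- A smooth function with differential `i_{X₁} i_{X₂} i_{X₃} (∗φ)`. -/
structure IsMoment (P : G2Structure M) (g : M → ℝ) : Prop where
  smooth : ContMDiff (𝓡 7) 𝓘(ℝ, ℝ) ∞ g
  diffE_apply : ∀ m w, diffE g m w = P.momentLinear m w

theorem exists_isMoment (hP : P.TorsionFree) (h : P.IsInvariant) (hb : FirstBettiNumberVanishes M) :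
    ∃ g, P.IsMoment g := by
  obtain ⟨g, hg, hd⟩ := hb P.momentForm P.momentForm_smooth (momentForm_closed hP h)
  exact ⟨g, hg, fun m w => (hd m w).symm⟩

/-- At a non-regular point the fields are dependent and an alternating form vanishes on them; local
constancy and connectedness spread the zero. -/
theorem formOnFields_eq_zero [ConnectedSpace M] (hP : P.TorsionFree) (h : P.IsInvariant)
    (hnonreg : ∃ m : M, ¬ IsRegularPoint m) (m : M) : P.formOnFields m = 0 := by
  obtain ⟨m₀, hm₀⟩ := hnonreg
  rw [(formOnFields_locallyConstant hP h).apply_eq_of_preconnectedSpace m m₀]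
  rw [isRegularPoint_iff] at hm₀
  exact (P.form.valE m₀).toAlternatingMap.map_linearDependent _ hm₀

theorem starForm_eq (P : G2Structure M) (m : M) (a b c d : E7) : P.starForm.valE m ![a, b, c, d] =
    starPhi0 ![P.frameE m a, P.frameE m b, P.frameE m c, P.frameE m d] := by
  rw [valE_starForm, ContinuousAlternatingMap.compContinuousLinearMap_apply]
  refine congrArg _ (funext fun i => ?_)
  fin_cases i <;> rfl

theorem form_frame_eq (P : G2Structure M) (m : M) :
    phi0 ![P.frameE m (fieldE 0 m), P.frameE m (fieldE 1 m), P.frameE m (fieldE 2 m)] = P.formOnFields m := by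
  rw [formOnFields, valE_form, ContinuousAlternatingMap.compContinuousLinearMap_apply]
  refine congrArg _ (funext fun i => ?_)
  fin_cases i <;> rfl

/-- The vector dual to `i_{X₁} i_{X₂} i_{X₃} (∗φ)` in the frame at `m`. -/
noncomputable def momentVector (P : G2Structure M) (m : M) : E7 :=
  tripleCross (P.frameE m (fieldE 0 m)) (P.frameE m (fieldE 1 m)) (P.frameE m (fieldE 2 m))

theorem inner_momentVector (P : G2Structure M) (m : M) (w : E7) :
    inner ℝ (P.momentVector m) (P.frameE m w) = P.momentLinear m w := by
  rw [momentVector, inner_tripleCross, momentLinear_apply, starForm_eq]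

theorem momentVector_ne_zero {m : M} (h0 : P.formOnFields m = 0) (hm : IsRegularPoint m) :
    P.momentVector m ≠ 0 := by
  refine tripleCross_ne_zero (by rw [form_frame_eq, h0]) ?_
  rw [isRegularPoint_iff] at hm
  have h := hm.map' (P.frameE m : E7 →ₗ[ℝ] E7) (LinearMap.ker_eq_bot.2 (P.frameE m).injective)
  have e : ![P.frameE m (fieldE 0 m), P.frameE m (fieldE 1 m), P.frameE m (fieldE 2 m)] =
      (P.frameE m : E7 →ₗ[ℝ] E7) ∘ ![fieldE 0 m, fieldE 1 m, fieldE 2 m] := by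
    ext1 i; fin_cases i <;> rfl
  rw [e]
  exact h

theorem momentLinear_eq_zero {m : M} (hm : ¬ IsRegularPoint m) : P.momentLinear m = 0 := by
  ext w
  rw [momentLinear_apply]
  refine (P.starForm.valE m).toAlternatingMap.map_linearDependent _ fun h => hm ?_
  rw [isRegularPoint_iff]
  have h2 := h.comp (![2, 1, 0] : Fin 3 → Fin 4) (by decide)
  have e : ![fieldE 0 m, fieldE 1 m, fieldE 2 m] =
      ![fieldE 2 m, fieldE 1 m, fieldE 0 m, w] ∘ (![2, 1, 0] : Fin 3 → Fin 4) := by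
    ext1 i; fin_cases i <;> rfl
  rw [e]
  exact h2

theorem momentLinear_field (P : G2Structure M) (m : M) (i : Fin 3) : P.momentLinear m (fieldE i m) = 0 := by
  rw [momentLinear_apply]
  fin_cases i
  · exact (P.starForm.valE m).map_eq_zero_of_eq _ (i := 2) (j := 3) rfl (by decide)
  · exact (P.starForm.valE m).map_eq_zero_of_eq _ (i := 1) (j := 3) rfl (by decide)
  · exact (P.starForm.valE m).map_eq_zero_of_eq _ (i := 0) (j := 3) rfl (by decide)

namespace IsMoment
variable (hg : P.IsMoment g)
include hg

theorem diffE_eq (m : M) : diffE g m = P.momentLinear m := ContinuousLinearMap.ext (hg.diffE_apply m)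

theorem frameE_gradE (m : M) : P.frameE m (P.gradE g m) = P.momentVector m := by
  refine ext_inner_right ℝ fun v => ?_
  obtain ⟨w, rfl⟩ := (P.frameE m).surjective v
  rw [inner_frameE_gradE, hg.diffE_apply, inner_momentVector]

theorem isRegularPoint_iff_differential_ne (h0 : ∀ m, P.formOnFields m = 0) (m : M) :
    IsRegularPoint m ↔ differential g m ≠ 0 := by
  change _ ↔ diffE g m ≠ 0
  rw [hg.diffE_eq]
  refine ⟨fun h h1 => momentVector_ne_zero (h0 m) h ?_, fun h => by_contra fun h1 => h (momentLinear_eq_zero h1)⟩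
  rw [← inner_self_eq_zero (𝕜 := ℝ), ← hg.frameE_gradE, inner_frameE_gradE, hg.diffE_eq, h1]
  rfl

theorem gradE_ne_zero (h0 : ∀ m, P.formOnFields m = 0) {m : M} (hm : IsRegularPoint m) :
    P.gradE g m ≠ 0 := fun h => by
  have := hg.frameE_gradE m
  rw [h, map_zero] at this
  exact momentVector_ne_zero (h0 m) hm this.symm

theorem gradE_eq_zero {m : M} (hm : ¬ IsRegularPoint m) : P.gradE g m = 0 := by
  apply (P.frameE m).injective
  rw [map_zero, ← inner_self_eq_zero (𝕜 := ℝ), inner_frameE_gradE, hg.diffE_eq, momentLinear_eq_zero hm]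
  rfl

theorem diffE_gradE_pos (h0 : ∀ m, P.formOnFields m = 0) {m : M} (hm : IsRegularPoint m) :
    0 < diffE g m (P.gradE g m) := by
  rw [← inner_frameE_gradE]
  exact real_inner_self_pos.2 fun h => hg.gradE_ne_zero h0 hm ((P.frameE m).injective (by rw [h, map_zero]))

/-- The tangent space of an orbit is spanned by the `Xᵢ`, which `dg` kills; hence `g` is constant
along smooth curves of rotations, and these connect `SO(3)`. -/
theorem smul_eq (A : SO3) (m : M) : g (A • m) = g m := by
  have key : ∀ B : SO3, HasMFDerivAt (𝓡 3) 𝓘(ℝ, ℝ) (fun C : SO3 => g (C • m)) B (0 : E3 →L[ℝ] ℝ) := by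
    intro B
    have h6 := (hasMFDerivAt_diffE hg.smooth (B • m)).comp B (hasMFDerivAt_smul_at B m)
    refine h6.congr_mfderiv ?_
    change (diffE g (B • m)).comp ((actD B m).comp (orbitD m)) = 0
    have h8 : ∀ i, diffE g (B • m) (actD B m (orbitD m (EuclideanSpace.single i 1))) = 0 := by
      intro i
      -- The `2` undoes the factor `1/2` of the Cayley chart.
      have h9 : orbitD m (EuclideanSpace.single i 1) = (2 : ℝ) • fieldE i m := by
        rw [fieldE_eq, map_smul, smul_smul]; norm_num
      rw [h9, map_smul, map_smul, actD_fieldE, map_sum]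
      simp [hg.diffE_eq, momentLinear_field]
    ext v
    have h9 : v = ∑ k, v k • EuclideanSpace.single k (1 : ℝ) := by
      ext l; simp [Pi.single_apply]
    rw [h9]
    simp only [map_sum, map_smul, ContinuousLinearMap.comp_apply, h8]
    simp
  have h1 := SO3.eq_of_const_along_curves (h := fun C : SO3 => g (C • m)) (fun c hc s t => ?_) A
  · simpa using h1
  · refine is_const_of_deriv_eq_zero (f := fun t => g (c t • m)) ?_ ?_ s t
    · intro t
      have h2 := ((key (c t)).mdifferentiableAt.comp t ((SO3.contMDiff_of_entries hc).mdifferentiableAt (by simp)))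
      exact h2.differentiableAt
    · intro t
      have h2 := (key (c t)).comp t ((SO3.contMDiff_of_entries hc).mdifferentiableAt (x := t) (by simp)).hasMFDerivAt
      have h3 : HasFDerivAt (fun t => g (c t • m)) (0 : ℝ →L[ℝ] ℝ) t := by
        refine hasMFDerivAt_iff_hasFDerivAt.1 (h2.congr_mfderiv ?_)
        exact ContinuousLinearMap.zero_comp _
      simpa using h3.hasDerivAt.deriv

/-- Both the metric and `g` are invariant, so the gradient is; it suffices to test against vectors
`dA w`. -/
theorem actD_gradE (h : P.IsInvariant) (A : SO3) (m : M) :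
    actD A m (P.gradE g m) = P.gradE g (A • m) := by
  apply (P.frameE (A • m)).injective
  refine ext_inner_right ℝ fun v => ?_
  obtain ⟨u, rfl⟩ := (P.frameE (A • m)).surjective v
  obtain ⟨τ, hτ⟩ := exists_equiv_actD A m
  obtain ⟨w, rfl⟩ := τ.surjective u
  change inner ℝ _ (P.frameE (A • m) ((τ : E7 →L[ℝ] E7) w)) = inner ℝ _ (P.frameE (A • m) ((τ : E7 →L[ℝ] E7) w))
  rw [hτ, h.inner_actD, inner_frameE_gradE, inner_frameE_gradE]
  have h1 := (hasMFDerivAt_diffE hg.smooth (A • m)).comp m (hasMFDerivAt_act A m)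
  have h2 : g ∘ (fun x : M => A • x) = g := by ext x; exact hg.smul_eq A x
  rw [h2] at h1
  exact DFunLike.congr_fun (hasMFDerivAt_unique (hasMFDerivAt_diffE hg.smooth m) h1) w

end IsMoment
end G2Structure
end Moment

/-! ### Smoothness of the gradient. -/

section Gradient
variable {M : Type*} [TopologicalSpace M] [ChartedSpace E7 M] [IsManifold (𝓡 7) ∞ M]
  {P : G2Structure M} {g : M → ℝ}

namespace G2Structure

/-- The gradient in the chart around `x`. -/
noncomputable def chartGradient (P : G2Structure M) (g : M → ℝ) (x : M) (y : E7) : E7 :=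
  chartD x ((extChartAt (𝓡 7) x).symm y) (P.gradE g ((extChartAt (𝓡 7) x).symm y))

theorem symmD_chartGradient {x : M} {y : E7} (hy : y ∈ (extChartAt (𝓡 7) x).target) :
    symmD x y (P.chartGradient g x y) = P.gradE g ((extChartAt (𝓡 7) x).symm y) := by
  obtain ⟨τ, h1, h2⟩ := exists_equiv_symmD hy
  rw [chartGradient, ← h1, ← h2]
  exact τ.apply_symm_apply _

theorem contDiffOn_chartGradient (hg : ContMDiff (𝓡 7) 𝓘(ℝ, ℝ) ∞ g) (x : M) :
    ContDiffOn ℝ ∞ (P.chartGradient g x) (extChartAt (𝓡 7) x).target := by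
  set U := (extChartAt (𝓡 7) x).target
  have hσ : ∀ y ∈ U, ∃ σ : E7 ≃L[ℝ] E7,
      DForm.inChart P.form x y = phi0.compContinuousLinearMap (σ : E7 →L[ℝ] E7) := fun y hy => by
    obtain ⟨σ, -, h, -⟩ := P.exists_chart_frame hy
    exact ⟨σ, h⟩
  have hd : ∀ y ∈ U, (gramOf (DForm.inChart P.form x y)).det ≠ 0 := fun y hy => by
    obtain ⟨σ, h⟩ := hσ y hy
    rw [h]
    exact det_gramOf_ne σ
  have hi := contDiffOn_inv_entry (contDiffOn_gramOf (P.smooth x) hσ) hd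
  have hf : ContDiffOn ℝ ∞ (g ∘ (extChartAt (𝓡 7) x).symm) U :=
    (hg.comp_contMDiffOn (contMDiffOn_extChartAt_symm x)).contDiffOn
  have hf' : ContDiffOn ℝ ∞ (fderiv ℝ (g ∘ (extChartAt (𝓡 7) x).symm)) U :=
    hf.fderiv_of_isOpen (isOpen_target x) (by simp)
  refine contDiffOn_euclidean.2 fun i => ?_
  have h2 : ContDiffOn ℝ ∞ (fun y => ∑ k, (gramOf (DForm.inChart P.form x y))⁻¹ k i *
      fderiv ℝ (g ∘ (extChartAt (𝓡 7) x).symm) y (stdE k)) U :=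
    ContDiffOn.sum fun k _ => (hi k i).mul (hf'.clm_apply contDiffOn_const)
  refine h2.congr fun y hy => ?_
  obtain ⟨σ, h3, h4, -⟩ := P.exists_chart_frame hy
  set G := gramOf (DForm.inChart P.form x y) with hG
  have h5 : ∀ v : E7, (P.chartGradient g x y).ofLp ⬝ᵥ (G *ᵥ v.ofLp) =
      fderiv ℝ (g ∘ (extChartAt (𝓡 7) x).symm) y v := by
    intro v
    rw [hG, h4, ← inner_map_eq, h3, h3, symmD_chartGradient hy, inner_frameE_gradE]
    have h6 := (hasMFDerivAt_diffE hg ((extChartAt (𝓡 7) x).symm y)).comp y (hasMFDerivAt_symm hy)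
    have h7 : HasFDerivAt (g ∘ (extChartAt (𝓡 7) x).symm)
        ((diffE g ((extChartAt (𝓡 7) x).symm y)).comp (symmD x y)) y := hasMFDerivAt_iff_hasFDerivAt.1 h6
    rw [h7.fderiv]
    rfl
  -- Testing against `G⁻¹ eᵢ` reads off the `i`-th coordinate of the gradient.
  have h6 := h5 (WithLp.toLp 2 (G⁻¹ *ᵥ Pi.single i 1))
  rw [Matrix.mulVec_mulVec, Matrix.mul_nonsing_inv _ (isUnit_iff_ne_zero.2 (hd y hy)), Matrix.one_mulVec,
    dotProduct_single, mul_one] at h6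
  rw [h6, ← sum_smul_stdE (WithLp.toLp 2 (G⁻¹ *ᵥ Pi.single i 1)), map_sum]
  refine Finset.sum_congr rfl fun k _ => ?_
  rw [map_smul, smul_eq_mul]
  simp [Matrix.col_apply]

theorem contMDiff_gradient (hg : ContMDiff (𝓡 7) 𝓘(ℝ, ℝ) ∞ g) :
    ContMDiff (𝓡 7) (𝓡 7).tangent ∞
      (fun m => (⟨m, P.gradient g m⟩ : TangentBundle (𝓡 7) M)) := by
  intro x
  have h1 : ContMDiffAt (𝓡 7) 𝓘(ℝ, E7) ∞ (fun m => P.chartGradient g x (extChartAt (𝓡 7) x m)) x :=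
    ContMDiffAt.comp x
      ((contDiffOn_chartGradient hg x).contDiffAt (target_mem_nhds (mem_extChartAt_target x))).contMDiffAt
      contMDiffAt_extChartAt
  refine (Bundle.contMDiffAt_section x).2 (h1.congr_of_eventuallyEq ?_)
  filter_upwards [extChartAt_source_mem_nhds (I := 𝓡 7) x] with m hm
  have hm' : m ∈ (chartAt E7 x).source := by rwa [← extChartAt_source (𝓡 7)]
  have hb : m ∈ (trivializationAt E7 (TangentSpace (𝓡 7) : M → Type) x).baseSet := by
    rwa [TangentBundle.trivializationAt_baseSet]
  have h2 := DFunLike.congr_fun (TangentBundle.continuousLinearMapAt_trivializationAt (I := 𝓡 7) hm')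
    (P.gradient g m)
  rw [Bundle.Trivialization.continuousLinearMapAt_apply,
    Bundle.Trivialization.coe_linearMapAt_of_mem _ hb] at h2
  refine h2.trans ?_
  rw [chartGradient, (extChartAt (𝓡 7) x).left_inv hm]
  rfl

end G2Structure
end Gradient

/-! ### Uniqueness and maximality of integral curves. -/

section IntegralCurves
variable {E : Type*} [NormedAddCommGroup E] [NormedSpace ℝ E] [CompleteSpace E]
  {H : Type*} [TopologicalSpace H] {I : ModelWithCorners ℝ E H}
  {M : Type*} [TopologicalSpace M] [ChartedSpace H M] [IsManifold I 1 M] [BoundarylessManifold I M]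
  [T2Space M] {v : (x : M) → TangentSpace I x} {γ γ' : ℝ → M} {s J : Set ℝ} {t₀ : ℝ}

/-- Integral curves on an open interval are determined by their value at one point. -/
theorem IsMIntegralCurveOn.eqOn_of_ordConnected
    (hv : ContMDiff I I.tangent 1 (fun x => (⟨x, v x⟩ : TangentBundle I M)))
    (hs : IsOpen s) (hc : s.OrdConnected) (hγ : IsMIntegralCurveOn γ v s)
    (hγ' : IsMIntegralCurveOn γ' v s) (ht₀ : t₀ ∈ s) (h : γ t₀ = γ' t₀) : EqOn γ γ' s := by
  intro t ht
  have hmin : min t₀ t ∈ s := by rcases min_choice t₀ t with h | h <;> rwa [h]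
  have hmax : max t₀ t ∈ s := by rcases max_choice t₀ t with h | h <;> rwa [h]
  obtain ⟨a, ha, has⟩ := exists_Ioc_subset_of_mem_nhds (hs.mem_nhds hmin) (exists_lt _)
  obtain ⟨b, hb, hbs⟩ := exists_Ico_subset_of_mem_nhds (hs.mem_nhds hmax) (exists_gt _)
  have hsub : Ioo a b ⊆ s := by
    intro u hu
    rcases le_total u (min t₀ t) with h1 | h1
    · exact has ⟨hu.1, h1⟩
    rcases le_total (max t₀ t) u with h2 | h2
    · exact hbs ⟨h2, hu.2⟩
    exact hc.out hmin hmax ⟨h1, h2⟩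
  exact isMIntegralCurveOn_Ioo_eqOn_of_contMDiff_boundaryless (t₀ := t₀)
    ⟨ha.trans_le (min_le_left _ _), (le_max_left _ _).trans_lt hb⟩ hv (hγ.mono hsub) (hγ'.mono hsub) h
    ⟨ha.trans_le (min_le_right _ _), (le_max_right _ _).trans_lt hb⟩

/-- The maximal integral curve with a given initial value. -/
theorem exists_maximal_isMIntegralCurveOn
    (hv : ContMDiff I I.tangent 1 (fun x => (⟨x, v x⟩ : TangentBundle I M))) (t₀ : ℝ) (x : M) :
    ∃ (γ : ℝ → M) (s : Set ℝ), IsOpen s ∧ s.OrdConnected ∧ t₀ ∈ s ∧ γ t₀ = x ∧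
      IsMIntegralCurveOn γ v s ∧ ∀ (δ : ℝ → M) (J : Set ℝ), IsOpen J → J.OrdConnected → t₀ ∈ J →
        δ t₀ = x → IsMIntegralCurveOn δ v J → J ⊆ s ∧ EqOn γ δ J := by
  classical
  let C : (ℝ → M) → Set ℝ → Prop := fun δ J =>
    IsOpen J ∧ J.OrdConnected ∧ t₀ ∈ J ∧ δ t₀ = x ∧ IsMIntegralCurveOn δ v J
  let S : Set ℝ := {t | ∃ δ J, C δ J ∧ t ∈ J}
  let γ : ℝ → M := fun t => if h : t ∈ S then h.choose t else x
  have hγ : ∀ δ J, C δ J → EqOn γ δ J := by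
    intro δ J hC t ht
    have hS : t ∈ S := ⟨δ, J, hC, ht⟩
    obtain ⟨J', hC', ht'⟩ := hS.choose_spec
    have h1 : γ t = hS.choose t := dif_pos hS
    rw [h1]
    obtain ⟨a1, a2, a3, a4, a5⟩ := hC
    obtain ⟨b1, b2, b3, b4, b5⟩ := hC'
    exact IsMIntegralCurveOn.eqOn_of_ordConnected hv (b1.inter a1) (b2.inter a2) (b5.mono inter_subset_left)
      (a5.mono inter_subset_right) ⟨b3, a3⟩ (b4.trans a4.symm) ⟨ht', ht⟩
  have hsub : ∀ δ J, C δ J → J ⊆ S := fun δ J hC t ht => ⟨δ, J, hC, ht⟩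
  have hne : ∃ δ J, C δ J := by
    obtain ⟨δ, h1, h2⟩ := exists_isMIntegralCurveAt_of_contMDiffAt_boundaryless t₀ (hv x)
    obtain ⟨ε, hε, h3⟩ := isMIntegralCurveAt_iff'.1 h2
    exact ⟨δ, Metric.ball t₀ ε, Metric.isOpen_ball, (convex_ball t₀ ε).ordConnected,
      Metric.mem_ball_self hε, h1, h3⟩
  have hSo : IsOpen S := by
    refine isOpen_iff_mem_nhds.2 fun t ⟨δ, J, hC, ht⟩ => ?_
    exact Filter.mem_of_superset (hC.1.mem_nhds ht) (hsub δ J hC)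
  obtain ⟨δ₀, J₀, h0⟩ := hne
  refine ⟨γ, S, hSo, ?_, hsub _ _ h0 h0.2.2.1, ?_, ?_, ?_⟩
  · have h1 : S = ⋃₀ {J | ∃ δ, C δ J} := by
      ext t
      exact ⟨fun ⟨δ, J, hC, ht⟩ => ⟨J, ⟨δ, hC⟩, ht⟩, fun ⟨J, ⟨δ, hC⟩, ht⟩ => ⟨δ, J, hC, ht⟩⟩
    rw [h1]
    exact (isPreconnected_sUnion t₀ _ (by rintro J ⟨δ, hC⟩; exact hC.2.2.1)
      (by rintro J ⟨δ, hC⟩; exact hC.2.1.isPreconnected)).ordConnected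
  · rw [hγ _ _ h0 h0.2.2.1, h0.2.2.2.1]
  · refine IsMIntegralCurveAt.isMIntegralCurveOn fun t ⟨δ, J, hC, ht⟩ => ?_
    have h1 : ∀ᶠ u in 𝓝 t, u ∈ J := hC.1.mem_nhds ht
    have h2 := hC.2.2.2.2.isMIntegralCurveAt (hC.1.mem_nhds ht)
    filter_upwards [h2, eventually_eventually_nhds.2 h1, h1] with u hu hu2 hu3
    have h3 : γ =ᶠ[𝓝 u] δ := by
      filter_upwards [hu2] with w hw using hγ δ J hC hw
    rw [hγ δ J hC hu3]
    exact hu.congr_of_eventuallyEq h3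
  · intro δ J a1 a2 a3 a4 a5
    exact ⟨hsub δ J ⟨a1, a2, a3, a4, a5⟩, hγ δ J ⟨a1, a2, a3, a4, a5⟩⟩

/-- An integral curve through a zero of the vector field is constant. -/
theorem IsMIntegralCurveOn.eqOn_const
    (hv : ContMDiff I I.tangent 1 (fun x => (⟨x, v x⟩ : TangentBundle I M)))
    (hs : IsOpen s) (hc : s.OrdConnected) (hγ : IsMIntegralCurveOn γ v s) (ht₀ : t₀ ∈ s)
    (h0 : v (γ t₀) = 0) : EqOn γ (fun _ => γ t₀) s := by
  refine hγ.eqOn_of_ordConnected hv hs hc (fun t _ => ?_) ht₀ rfl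
  have h1 : (1 : ℝ →L[ℝ] ℝ).smulRight (v (γ t₀)) = 0 := by
    rw [h0, ContinuousLinearMap.smulRight_zero]
  exact (hasMFDerivWithinAt_const (γ t₀) s t).congr_mfderiv h1.symm

end IntegralCurves

/-! ### Gradient lines and the sets they sweep out. -/

section GradientCurves
variable {M : Type*} [TopologicalSpace M] [ChartedSpace E7 M] {P : G2Structure M} {g : M → ℝ}
  {γ : ℝ → M} {I : Set ℝ} {t : ℝ}

theorem hasMFDerivAt_of_isMIntegralCurveOn (hI : IsOpen I)
    (hγ : IsMIntegralCurveOn (I := 𝓡 7) γ (P.gradient g) I) (ht : t ∈ I) :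
    HasMFDerivAt 𝓘(ℝ, ℝ) (𝓡 7) γ t ((1 : ℝ →L[ℝ] ℝ).smulRight (P.gradE g (γ t)) : ℝ →L[ℝ] E7) :=
  (hγ t ht).hasMFDerivAt (hI.mem_nhds ht)

theorem hasDerivAt_comp_gradientCurve (hg : ContMDiff (𝓡 7) 𝓘(ℝ, ℝ) ∞ g) (hI : IsOpen I)
    (hγ : IsMIntegralCurveOn (I := 𝓡 7) γ (P.gradient g) I) (ht : t ∈ I) :
    HasDerivAt (g ∘ γ) (diffE g (γ t) (P.gradE g (γ t))) t := by
  have h := (hasMFDerivAt_diffE hg (γ t)).comp t (hasMFDerivAt_of_isMIntegralCurveOn hI hγ ht)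
  have hk := comp_one_smulRight (diffE g (γ t)) (P.gradE g (γ t))
  have h2 : HasFDerivAt (g ∘ γ)
      ((1 : ℝ →L[ℝ] ℝ).smulRight (diffE g (γ t) (P.gradE g (γ t))) : ℝ →L[ℝ] ℝ) t :=
    hasMFDerivAt_iff_hasFDerivAt.1 (h.congr_mfderiv hk)
  simpa using h2.hasDerivAt

end GradientCurves

section GradientLines
variable {M : Type*} [TopologicalSpace M] [ChartedSpace E7 M] [MulAction SO3 M]
  [IsManifold (𝓡 7) ∞ M] [ContMDiffSMul (𝓡 3) (𝓡 7) ∞ SO3 M] {P : G2Structure M} {g : M → ℝ}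
  {γ δ : ℝ → M} {I J : Set ℝ} {t : ℝ}

namespace G2Structure.IsMoment
variable (hg : P.IsMoment g)
include hg

/-- The derivative of `g` along the curve is `|∇g|²`, positive at regular points. -/
theorem strictMonoOn (h0 : ∀ m, P.formOnFields m = 0) (hI : IsOpen I) (hc : I.OrdConnected)
    (hγ : IsMIntegralCurveOn (I := 𝓡 7) γ (P.gradient g) I) (hr : ∀ t ∈ I, IsRegularPoint (γ t)) :
    StrictMonoOn (g ∘ γ) I := by
  refine strictMonoOn_of_deriv_pos hc.convex ?_ ?_
  · exact fun t ht => (hasDerivAt_comp_gradientCurve hg.smooth hI hγ ht).continuousAt.continuousWithinAt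
  · intro t ht
    have ht' := interior_subset ht
    rw [(hasDerivAt_comp_gradientCurve hg.smooth hI hγ ht').deriv]
    exact hg.diffE_gradE_pos h0 (hr t ht')

theorem smul_isMIntegralCurveOn (h : P.IsInvariant) (A : SO3) (hI : IsOpen I)
    (hγ : IsMIntegralCurveOn (I := 𝓡 7) γ (P.gradient g) I) :
    IsMIntegralCurveOn (I := 𝓡 7) (fun t => A • γ t) (P.gradient g) I := by
  intro t ht
  have h1 := (hasMFDerivAt_act A (γ t)).comp t (hasMFDerivAt_of_isMIntegralCurveOn hI hγ ht)
  have hk := comp_one_smulRight (actD A (γ t)) (P.gradE g (γ t))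
  rw [hg.actD_gradE h] at hk
  exact (h1.congr_mfderiv hk).hasMFDerivWithinAt

variable [T2Space M]

theorem contMDiff_gradient_one : ContMDiff (𝓡 7) (𝓡 7).tangent 1
    (fun m => (⟨m, P.gradient g m⟩ : TangentBundle (𝓡 7) M)) :=
  (contMDiff_gradient hg.smooth).of_le (by norm_cast)

/-- At a non-regular point the gradient vanishes, and a trajectory through a zero of the field is
constant. -/
theorem isRegularPoint_of_isGradientLine (hl : P.IsGradientLine g γ I) (ht : t ∈ I) :
    IsRegularPoint (γ t) := by
  by_contra h
  have h1 : P.gradient g (γ t) = 0 := hg.gradE_eq_zero h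
  have h2 := hl.integralCurve.eqOn_const hg.contMDiff_gradient_one hl.isOpen hl.ordConnected ht h1
  obtain ⟨a, ha, b, hb, hab⟩ := hl.nonconstant
  exact hab ((h2 ha).trans (h2 hb).symm)

/-- Maximality in `IsGradientLine` concerns only extensions of `γ`. Comparison with the union of all
integral curves through the same point upgrades it to every curve meeting `γ` at the same time. -/
theorem maximal_strong (hl : P.IsGradientLine g γ I) (hJ : IsOpen J) (hc : J.OrdConnected)
    (hδ : IsMIntegralCurveOn (I := 𝓡 7) δ (P.gradient g) J) (ht : t ∈ I) (ht' : t ∈ J)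
    (h : δ t = γ t) : J ⊆ I ∧ EqOn γ δ J := by
  obtain ⟨Γ, S, h1, h2, h3, h4, h5, h6⟩ :=
    exists_maximal_isMIntegralCurveOn hg.contMDiff_gradient_one t (γ t)
  obtain ⟨a1, a2⟩ := h6 γ I hl.isOpen hl.ordConnected ht rfl hl.integralCurve
  obtain ⟨b1, b2⟩ := h6 δ J hJ hc ht' h hδ
  have h7 : S = I := hl.maximal Γ S h1 h2 a1 a2.symm h5
  subst h7
  exact ⟨b1, fun u hu => (a2 (b1 hu)).symm.trans (b2 hu)⟩

theorem exists_isGradientLine (h0 : ∀ m, P.formOnFields m = 0) {m : M} (hm : IsRegularPoint m) :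
    ∃ (γ : ℝ → M) (I : Set ℝ), P.IsGradientLine g γ I ∧ ∃ t ∈ I, γ t = m := by
  obtain ⟨γ, S, h1, h2, h3, h4, h5, h6⟩ :=
    exists_maximal_isMIntegralCurveOn hg.contMDiff_gradient_one 0 m
  refine ⟨γ, S, ⟨h1, h2, h5, ?_, ?_⟩, 0, h3, h4⟩
  · intro γ' I' a1 a2 a3 a4 a5
    exact (h6 γ' I' a1 a2 (a3 h3) ((a4 h3).symm.trans h4) a5).1.antisymm a3
  · by_contra! hcon
    -- A constant trajectory would stay at the regular point `m`, where `g` must increase strictly.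
    have h7 := hg.strictMonoOn h0 h1 h2 h5 fun t ht => by rwa [hcon t ht 0 h3, h4]
    obtain ⟨b, hb, hbs⟩ := exists_Ico_subset_of_mem_nhds (h1.mem_nhds h3) (exists_gt _)
    obtain ⟨c, hc1, hc2⟩ := exists_between hb
    have hcS : c ∈ S := hbs ⟨hc1.le, hc2⟩
    exact (h7 h3 hcS hc1).ne (congrArg g (hcon 0 h3 c hcS))

theorem sweep_subset_of_mem (h : P.IsInvariant) (hl : P.IsGradientLine g γ I)
    (hl' : P.IsGradientLine g δ J) {x : M} (hx : x ∈ sweep γ I) (hx' : x ∈ sweep δ J) :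
    sweep δ J ⊆ sweep γ I := by
  obtain ⟨A, t, ht, rfl⟩ := hx
  obtain ⟨B, s, hs, hAB⟩ := hx'
  -- From `A • γ t = B • δ s`: the rotated and time-shifted `δ` is a trajectory equal to `γ` at time
  -- `t`, so its domain lies in `I`.
  have h1 := (hg.smul_isMIntegralCurveOn h (A⁻¹ * B) hl'.isOpen hl'.integralCurve).comp_add (s - t)
  have h2 : IsOpen {u | u + (s - t) ∈ J} := hl'.isOpen.preimage (by fun_prop)
  have h3 : {u | u + (s - t) ∈ J}.OrdConnected :=
    ⟨fun a ha b hb c hc => hl'.ordConnected.out ha hb ⟨by linarith [hc.1], by linarith [hc.2]⟩⟩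
  obtain ⟨h4, h5⟩ := hg.maximal_strong hl h2 h3 h1 ht (by simpa using hs)
    (by simp [mul_smul, ← hAB])
  rintro _ ⟨C, u, hu, rfl⟩
  have hu' : u - (s - t) ∈ {u | u + (s - t) ∈ J} := by simpa using hu
  refine ⟨C * (A⁻¹ * B)⁻¹, u - (s - t), h4 hu', ?_⟩
  rw [h5 hu', mul_smul]
  simp [smul_smul, mul_assoc]

theorem pairwiseDisjoint_sweptFamily (h : P.IsInvariant) :
    (P.sweptFamily g).PairwiseDisjoint id := by
  rintro _ ⟨γ, I, hl, rfl⟩ _ ⟨δ, J, hl', rfl⟩ hne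
  refine Set.disjoint_left.2 fun x hx hx' => hne ?_
  exact (hg.sweep_subset_of_mem h hl' hl hx' hx).antisymm (hg.sweep_subset_of_mem h hl hl' hx hx')

theorem sUnion_sweptFamily (h0 : ∀ m, P.formOnFields m = 0) :
    ⋃₀ P.sweptFamily g = {m : M | IsRegularPoint m} := by
  ext m
  constructor
  · rintro ⟨_, ⟨γ, I, hl, rfl⟩, A, t, ht, rfl⟩
    exact isRegularPoint_smul (hg.isRegularPoint_of_isGradientLine hl ht) A
  · intro hm
    obtain ⟨γ, I, hl, t, ht, rfl⟩ := hg.exists_isGradientLine h0 hm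
    exact ⟨_, ⟨γ, I, hl, rfl⟩, 1, t, ht, (one_smul _ _).symm⟩

end G2Structure.IsMoment
end GradientLines

/-! ### Smooth trajectories, open intervals and an embedding criterion. -/

/-- Solutions of a smooth autonomous differential equation are smooth. -/
theorem contDiffOn_of_hasDerivAt_comp {V : Type*} [NormedAddCommGroup V] [NormedSpace ℝ V]
    {X : V → V} {U : Set V} {c : ℝ → V} {W : Set ℝ} (hX : ContDiffOn ℝ ∞ X U) (hW : IsOpen W)
    (hc : MapsTo c W U) (hd : ∀ t ∈ W, HasDerivAt c (X (c t)) t) : ContDiffOn ℝ ∞ c W := by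
  refine contDiffOn_infty.2 fun n => ?_
  induction n with
  | zero => exact contDiffOn_zero.2 fun t ht => (hd t ht).continuousAt.continuousWithinAt
  | succ n ih =>
    refine (contDiffOn_succ_iff_deriv_of_isOpen (n := n) hW).2
      ⟨fun t ht => (hd t ht).differentiableAt.differentiableWithinAt, by simp, ?_⟩
    -- Bootstrapping: the derivative `X ∘ c` is as smooth as `c` is already known to be.
    exact ((hX.of_le (by exact_mod_cast le_top)).comp ih hc).congr fun t ht => (hd t ht).deriv

/-- A nonempty open interval is parametrised by the real line. -/
theorem exists_contDiff_range_eq {I : Set ℝ} (hI : IsOpen I) (hc : I.OrdConnected) (hne : I.Nonempty) :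
    ∃ r r' : ℝ → ℝ, ContDiff ℝ ∞ r ∧ (∀ s, HasDerivAt r (r' s) s) ∧ (∀ s, 0 < r' s) ∧ range r = I := by
  have hIoo : ∀ a b : ℝ, I = Ioo a b → ∃ r r' : ℝ → ℝ, ContDiff ℝ ∞ r ∧ (∀ s, HasDerivAt r (r' s) s) ∧
      (∀ s, 0 < r' s) ∧ range r = I := by
    rintro a b rfl
    have hab : 0 < b - a := sub_pos.2 (nonempty_Ioo.1 hne)
    refine ⟨fun s => a + (b - a) * Real.sigmoid s,
      fun s => (b - a) * (Real.sigmoid s * (1 - Real.sigmoid s)), ?_, fun s => ?_, fun s => ?_, ?_⟩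
    · exact contDiff_const.add (contDiff_const.mul (contDiff_sigmoid.of_le le_top))
    · exact ((Real.hasDerivAt_sigmoid s).const_mul _).const_add _
    · have := Real.sigmoid_pos s
      have := sub_pos.2 (Real.sigmoid_lt_one s)
      positivity
    · have h1 : (fun s => a + (b - a) * Real.sigmoid s) = (fun x => a + (b - a) * x) ∘ Real.sigmoid := rfl
      rw [h1, range_comp, Real.range_sigmoid]
      ext x
      constructor
      · rintro ⟨y, hy, rfl⟩
        exact ⟨by nlinarith [hy.1], by nlinarith [hy.2]⟩
      · intro hx
        refine ⟨(x - a) / (b - a), ⟨div_pos (sub_pos.2 hx.1) hab, (div_lt_one hab).2 (by linarith [hx.2])⟩, ?_⟩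
        field_simp
        ring
  have hIoi : ∀ a : ℝ, I = Ioi a → ∃ r r' : ℝ → ℝ, ContDiff ℝ ∞ r ∧ (∀ s, HasDerivAt r (r' s) s) ∧
      (∀ s, 0 < r' s) ∧ range r = I := by
    rintro a rfl
    refine ⟨fun s => a + Real.exp s, Real.exp, by fun_prop, fun s => (Real.hasDerivAt_exp s).const_add a,
      Real.exp_pos, ?_⟩
    ext x
    constructor
    · rintro ⟨s, rfl⟩
      exact lt_add_of_pos_right a (Real.exp_pos s)
    · intro hx
      exact ⟨Real.log (x - a), by simp [Real.exp_log (sub_pos.2 hx)]⟩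
  have hIio : ∀ b : ℝ, I = Iio b → ∃ r r' : ℝ → ℝ, ContDiff ℝ ∞ r ∧ (∀ s, HasDerivAt r (r' s) s) ∧
      (∀ s, 0 < r' s) ∧ range r = I := by
    rintro b rfl
    refine ⟨fun s => b - Real.exp (-s), fun s => Real.exp (-s), by fun_prop, fun s => ?_,
      fun s => Real.exp_pos _, ?_⟩
    · have h := ((Real.hasDerivAt_exp (-s)).comp s (hasDerivAt_neg s)).const_sub b
      refine h.congr_deriv (by ring)
    ext x
    constructor
    · rintro ⟨s, rfl⟩
      exact sub_lt_self b (Real.exp_pos _)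
    · intro hx
      exact ⟨-Real.log (b - x), by simp [Real.exp_log (sub_pos.2 hx)]⟩
  have huniv : I = univ → ∃ r r' : ℝ → ℝ, ContDiff ℝ ∞ r ∧ (∀ s, HasDerivAt r (r' s) s) ∧
      (∀ s, 0 < r' s) ∧ range r = I := by
    rintro rfl
    exact ⟨id, fun _ => 1, contDiff_id, hasDerivAt_id, fun _ => one_pos, range_id⟩
  have h1 := hc.isPreconnected.mem_intervals
  simp only [mem_insert_iff, mem_singleton_iff] at h1
  -- Since `I` is open, taking interiors reduces the ten kinds of interval to the four treated above
  -- and the empty set.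
  rcases h1 with h | h | h | h | h | h | h | h | h | h <;> have h2 := congrArg interior h <;>
    rw [hI.interior_eq] at h2 <;> simp only [interior_Icc, interior_Ico, interior_Ioc, interior_Ioo,
      interior_Ici, interior_Ioi, interior_Iic, interior_Iio, interior_univ, interior_empty] at h2
  · exact hIoo _ _ h2
  · exact hIoo _ _ h2
  · exact hIoo _ _ h2
  · exact hIoo _ _ h2
  · exact hIoi _ h2
  · exact hIoi _ h2
  · exact hIio _ h2
  · exact hIio _ h2
  · exact huniv h2
  · exact absurd h2 hne.ne_empty

/-- A continuous injective map from a product with compact first factor is an embedding if it is fibred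
over an embedding of the second factor. -/
theorem isEmbedding_of_comp_eq_snd {K X Y Z : Type*} [TopologicalSpace K] [CompactSpace K]
    [TopologicalSpace X] [TopologicalSpace Y] [T2Space X] [T2Space Y] [TopologicalSpace Z] {F : K × X → Y}
    {g : Y → Z} {G : X → Z} (hF : Continuous F) (hinj : Injective F) (hg : Continuous g)
    (hG : IsEmbedding G) (h : ∀ p, g (F p) = G p.2) : IsEmbedding F := by
  -- The second component alone is proper because `K` is compact; hence the pair is proper and,
  -- being injective, a closed embedding.
  have hproper : IsProperMap (fun p : K × X => (F p, p.2)) :=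
    isProperMap_of_comp_of_t2 (g := Prod.snd) (hF.prodMk continuous_snd) continuous_snd
      isProperMap_snd_of_compactSpace
  have hemb : IsInducing (fun p : K × X => (F p, p.2)) :=
    (IsClosedEmbedding.of_continuous_injective_isClosedMap hproper.continuous
      (fun p q hpq => hinj (Prod.ext_iff.1 hpq).1) hproper.isClosedMap).isInducing
  refine ⟨isInducing_iff_nhds.2 fun p => le_antisymm hF.continuousAt.tendsto.le_comap ?_, hinj⟩
  rw [hemb.nhds_eq_comap, nhds_prod_eq, Filter.comap_prod]
  refine le_inf le_rfl ?_
  change _ ≤ Filter.comap Prod.snd (𝓝 p.2)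
  -- The second coordinate can be dropped: its topology is induced by `G`, and `G ∘ Prod.snd = g ∘
  -- F` is already controlled by `F`.
  rw [hG.isInducing.nhds_eq_comap, Filter.comap_comap, ← h p]
  have h1 : G ∘ Prod.snd = g ∘ F := funext fun q => (h q).symm
  rw [h1, ← Filter.comap_comap]
  exact Filter.comap_mono hg.continuousAt.tendsto.le_comap

section
variable {M : Type*} [TopologicalSpace M] [ChartedSpace E7 M]
  [IsManifold (𝓡 7) ∞ M] {P : G2Structure M} {g : M → ℝ} {γ : ℝ → M} {I : Set ℝ}

theorem contMDiffOn_gradientCurve (hg : ContMDiff (𝓡 7) 𝓘(ℝ, ℝ) ∞ g) (hI : IsOpen I)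
    (hγ : IsMIntegralCurveOn (I := 𝓡 7) γ (P.gradient g) I) : ContMDiffOn 𝓘(ℝ, ℝ) (𝓡 7) ∞ γ I := by
  intro t₀ ht₀
  set x := γ t₀
  have hcont : ContinuousOn γ I := hγ.continuousOn
  obtain ⟨W, hWs, hW, htW⟩ := mem_nhds_iff.1 (Filter.inter_mem (hI.mem_nhds ht₀)
    ((hcont.continuousAt (hI.mem_nhds ht₀)).preimage_mem_nhds (extChartAt_source_mem_nhds (I := 𝓡 7) x)))
  have h1 : ContDiffOn ℝ ∞ (extChartAt (𝓡 7) x ∘ γ) W := by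
    refine contDiffOn_of_hasDerivAt_comp (P.contDiffOn_chartGradient hg x) hW
      (fun t ht => (extChartAt (𝓡 7) x).map_source (hWs ht).2) fun t ht => ?_
    have h2 := (hasMFDerivAt_chart (hWs ht).2).comp t (hasMFDerivAt_of_isMIntegralCurveOn hI hγ (hWs ht).1)
    have hk := comp_one_smulRight (chartD x (γ t)) (P.gradE g (γ t))
    have h3 : HasFDerivAt (extChartAt (𝓡 7) x ∘ γ)
        ((1 : ℝ →L[ℝ] ℝ).smulRight (chartD x (γ t) (P.gradE g (γ t))) : ℝ →L[ℝ] E7) t :=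
      hasMFDerivAt_iff_hasFDerivAt.1 (h2.congr_mfderiv hk)
    have h4 : P.chartGradient g x ((extChartAt (𝓡 7) x ∘ γ) t) = chartD x (γ t) (P.gradE g (γ t)) := by
      rw [G2Structure.chartGradient, comp_apply, (extChartAt (𝓡 7) x).left_inv (hWs ht).2]
    rw [h4]
    simpa using h3.hasDerivAt
  have h5 : ContMDiffOn 𝓘(ℝ, ℝ) (𝓡 7) ∞ ((extChartAt (𝓡 7) x).symm ∘ (extChartAt (𝓡 7) x ∘ γ)) W :=
    (contMDiffOn_extChartAt_symm x).comp h1.contMDiffOn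
      fun t ht => (extChartAt (𝓡 7) x).map_source (hWs ht).2
  refine ((h5.congr fun t ht => ?_).contMDiffAt (hW.mem_nhds htW)).contMDiffWithinAt
  exact ((extChartAt (𝓡 7) x).left_inv (hWs ht).2).symm

end

/-! ### The swept sets: tangent spaces and embedding. -/

section Sweep
variable {M : Type*} [TopologicalSpace M] [ChartedSpace E7 M] [MulAction SO3 M]
  [IsManifold (𝓡 7) ∞ M] [ContMDiffSMul (𝓡 3) (𝓡 7) ∞ SO3 M] {P : G2Structure M} {g : M → ℝ}
  {γ : ℝ → M} {I : Set ℝ} {r r' : ℝ → ℝ}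

/-- The generators of the action together with the gradient. -/
noncomputable def G2Structure.sweepFrame (P : G2Structure M) (g : M → ℝ) (m : M) : Fin 4 → E7 :=
  ![fieldE 2 m, fieldE 1 m, fieldE 0 m, P.gradE g m]

theorem G2Structure.IsMoment.frameE_comp_sweepFrame (hg : P.IsMoment g) (m : M) :
    P.frameE m ∘ P.sweepFrame g m =
      ![P.frameE m (fieldE 2 m), P.frameE m (fieldE 1 m), P.frameE m (fieldE 0 m), P.momentVector m] := by
  ext1 i
  fin_cases i
  · rfl
  · rfl
  · rfl
  · exact hg.frameE_gradE m

theorem G2Structure.IsMoment.linearIndependent_sweepFrame (hg : P.IsMoment g) {m : M}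
    (h0 : P.formOnFields m = 0) (hm : IsRegularPoint m) : LinearIndependent ℝ (P.sweepFrame g m) := by
  have h := (coassociative_tripleCross ((P.form_frame_eq m).trans h0)
    (G2Structure.momentVector_ne_zero h0 hm)).1
  refine LinearIndependent.of_comp (P.frameE m : E7 →ₗ[ℝ] E7) ?_
  exact (hg.frameE_comp_sweepFrame m).symm ▸ h

theorem G2Structure.IsMoment.calibrated_sweepFrame (hg : P.IsMoment g) {m : M}
    (h0 : P.formOnFields m = 0) (hm : IsRegularPoint m) (e : Fin 4 → E7)
    (he : ∀ i, e i ∈ Submodule.span ℝ (range (P.sweepFrame g m)))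
    (ho : ∀ i j, inner ℝ (P.frameE m (e i)) (P.frameE m (e j)) = if i = j then (1 : ℝ) else 0) :
    |P.starForm.valE m e| = 1 := by
  have h := (coassociative_tripleCross ((P.form_frame_eq m).trans h0)
    (G2Structure.momentVector_ne_zero h0 hm)).2 (fun i => P.frameE m (e i)) (fun i => ?_) ho
  · exact h
  · have h1 := Submodule.mem_map_of_mem (f := (P.frameE m : E7 →ₗ[ℝ] E7)) (he i)
    rw [Submodule.map_span, ← range_comp] at h1
    exact (hg.frameE_comp_sweepFrame m) ▸ h1

/-- The parametrisation `(A, s) ↦ A • γ (r s)` of the set swept out by a curve. -/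
def sweepMap (γ : ℝ → M) (r : ℝ → ℝ) (p : SO3 × ℝ) : M := p.1 • γ (r p.2)

/-- The derivative of `sweepMap`. -/
noncomputable def sweepD (γ : ℝ → M) (r : ℝ → ℝ) (p : SO3 × ℝ) : E3 × ℝ →L[ℝ] E7 :=
  mfderiv ((𝓡 3).prod 𝓘(ℝ, ℝ)) (𝓡 7) (sweepMap γ r) p

theorem range_sweepMap (h : range r = I) : range (sweepMap γ r) = sweep γ I := by
  subst h
  ext x
  constructor
  · rintro ⟨⟨A, s⟩, rfl⟩
    exact ⟨A, r s, ⟨s, rfl⟩, rfl⟩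
  · rintro ⟨A, _, ⟨s, rfl⟩, rfl⟩
    exact ⟨(A, s), rfl⟩

theorem contMDiff_sweepMap (hγ : ContMDiffOn 𝓘(ℝ, ℝ) (𝓡 7) ∞ γ I) (hr : ContDiff ℝ ∞ r)
    (h : range r = I) : ContMDiff ((𝓡 3).prod 𝓘(ℝ, ℝ)) (𝓡 7) ∞ (sweepMap γ r) := by
  have h1 : ContMDiff 𝓘(ℝ, ℝ) (𝓡 7) ∞ (γ ∘ r) := by
    rw [← contMDiffOn_univ]
    exact hγ.comp hr.contMDiff.contMDiffOn fun s _ => h ▸ mem_range_self s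
  exact (contMDiff_smul (I := 𝓡 3) (I' := 𝓡 7) (n := ∞) (G := SO3) (M := M)).comp
    (contMDiff_fst.prodMk (h1.comp contMDiff_snd))

theorem hasMFDerivAt_sweepMap (h : ContMDiff ((𝓡 3).prod 𝓘(ℝ, ℝ)) (𝓡 7) ∞ (sweepMap γ r)) (p : SO3 × ℝ) :
    HasMFDerivAt ((𝓡 3).prod 𝓘(ℝ, ℝ)) (𝓡 7) (sweepMap γ r) p (sweepD γ r p) :=
  (h.mdifferentiableAt (by simp)).hasMFDerivAt

theorem sweepD_inl (h : ContMDiff ((𝓡 3).prod 𝓘(ℝ, ℝ)) (𝓡 7) ∞ (sweepMap γ r)) (p : SO3 × ℝ) (u : E3) :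
    sweepD γ r p (u, 0) = actD p.1 (γ (r p.2)) (orbitD (γ (r p.2)) u) := by
  have h1 : HasMFDerivAt (𝓡 3) ((𝓡 3).prod 𝓘(ℝ, ℝ)) (fun C : SO3 => (C, p.2)) p.1
      (ContinuousLinearMap.inl ℝ E3 ℝ) :=
    (hasMFDerivAt_id p.1).prodMk (hasMFDerivAt_const p.2 p.1)
  have h2 := (hasMFDerivAt_sweepMap h (p.1, p.2)).comp p.1 h1
  exact DFunLike.congr_fun (hasMFDerivAt_unique h2 (hasMFDerivAt_smul_at p.1 (γ (r p.2)))) u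

theorem sweepD_inr (h : ContMDiff ((𝓡 3).prod 𝓘(ℝ, ℝ)) (𝓡 7) ∞ (sweepMap γ r)) (p : SO3 × ℝ)
    (hI : IsOpen I) (hγ : IsMIntegralCurveOn (I := 𝓡 7) γ (P.gradient g) I)
    (hr : HasDerivAt r (r' p.2) p.2) (hI' : r p.2 ∈ I) :
    sweepD γ r p (0, 1) = r' p.2 • actD p.1 (γ (r p.2)) (P.gradE g (γ (r p.2))) := by
  have h1 : HasMFDerivAt 𝓘(ℝ, ℝ) ((𝓡 3).prod 𝓘(ℝ, ℝ)) (fun s : ℝ => (p.1, s)) p.2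
      (ContinuousLinearMap.inr ℝ E3 ℝ) :=
    (hasMFDerivAt_const p.1 p.2).prodMk (hasMFDerivAt_id p.2)
  have h2 := (hasMFDerivAt_sweepMap h (p.1, p.2)).comp p.2 h1
  have h3 : HasMFDerivAt 𝓘(ℝ, ℝ) 𝓘(ℝ, ℝ) r p.2 ((1 : ℝ →L[ℝ] ℝ).smulRight (r' p.2) : ℝ →L[ℝ] ℝ) :=
    hr.hasFDerivAt.hasMFDerivAt
  have h4 := (hasMFDerivAt_act p.1 (γ (r p.2))).comp p.2
    ((hasMFDerivAt_of_isMIntegralCurveOn hI hγ hI').comp p.2 h3)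
  have h5 := DFunLike.congr_fun (hasMFDerivAt_unique h2 h4) (1 : ℝ)
  refine Eq.trans h5 ?_
  change actD p.1 (γ (r p.2)) (((1 : ℝ →L[ℝ] ℝ).smulRight (r' p.2) (1 : ℝ)) • P.gradE g (γ (r p.2))) = _
  simp

/-- The group directions map to the rotated generators, which span the generators at the image point
by `actD_fieldE`; the real direction maps to a positive multiple of the invariant gradient. -/
theorem range_sweepD (h : ContMDiff ((𝓡 3).prod 𝓘(ℝ, ℝ)) (𝓡 7) ∞ (sweepMap γ r)) (p : SO3 × ℝ)
    (hg : P.IsMoment g) (hinv : P.IsInvariant)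
    (hI : IsOpen I) (hγ : IsMIntegralCurveOn (I := 𝓡 7) γ (P.gradient g) I)
    (hr : HasDerivAt r (r' p.2) p.2) (hr0 : 0 < r' p.2) (hI' : r p.2 ∈ I) :
    LinearMap.range (sweepD γ r p).toLinearMap =
      Submodule.span ℝ (range (P.sweepFrame g (sweepMap γ r p))) := by
  have hgrad := sweepD_inr (r' := r') h p hI hγ hr hI'
  rw [hg.actD_gradE hinv] at hgrad
  set y := γ (r p.2) with hy
  have hF : sweepMap γ r p = p.1 • y := rfl
  rw [hF]
  have hmem : ∀ k, fieldE k (p.1 • y) ∈ Submodule.span ℝ (range (P.sweepFrame g (p.1 • y))) := fun k => by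
    refine Submodule.subset_span ?_
    fin_cases k
    · exact ⟨2, rfl⟩
    · exact ⟨1, rfl⟩
    · exact ⟨0, rfl⟩
  have hmem' : P.gradE g (p.1 • y) ∈ Submodule.span ℝ (range (P.sweepFrame g (p.1 • y))) :=
    Submodule.subset_span ⟨3, rfl⟩
  have hact : ∀ j, sweepD γ r p ((2 : ℝ)⁻¹ • EuclideanSpace.single j 1, 0) = actD p.1 y (fieldE j y) :=
    fun j => by rw [sweepD_inl h, fieldE_eq]
  refine le_antisymm ?_ (Submodule.span_le.2 ?_)
  · rintro _ ⟨⟨u, t⟩, rfl⟩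
    have h1 : ((u, t) : E3 × ℝ) = ∑ j, (2 * u j) • (((2 : ℝ)⁻¹ • EuclideanSpace.single j (1 : ℝ) : E3), (0 : ℝ)) +
        t • ((0 : E3), (1 : ℝ)) := by
      refine Prod.ext ?_ ?_
      · simp only [Prod.fst_add, Prod.fst_sum, Prod.smul_fst, smul_zero, add_zero]
        ext l
        simp [Fin.sum_univ_three]
        fin_cases l <;> simp <;> ring
      · simp [Prod.snd_sum]
    change sweepD γ r p (u, t) ∈ _
    rw [h1, map_add, map_sum, map_smul, hgrad]
    refine Submodule.add_mem _ (Submodule.sum_mem _ fun j _ => ?_)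
      (Submodule.smul_mem _ _ (Submodule.smul_mem _ _ hmem'))
    rw [map_smul, hact, actD_fieldE]
    exact Submodule.smul_mem _ _ (Submodule.sum_mem _ fun k _ => Submodule.smul_mem _ _ (hmem k))
  · have hin : ∀ k, fieldE k (p.1 • y) ∈ LinearMap.range (sweepD γ r p).toLinearMap := fun k => by
      have h1 : actD p.1 y (actD p.1⁻¹ (p.1 • y) (fieldE k (p.1 • y))) = fieldE k (p.1 • y) := by
        have h2 := actD_comp p.1 p.1⁻¹ (p.1 • y)
        rw [mul_inv_cancel, actD_one, inv_smul_smul] at h2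
        exact (DFunLike.congr_fun h2 _).symm
      rw [← h1, actD_fieldE, inv_smul_smul, map_sum]
      refine Submodule.sum_mem _ fun j _ => ?_
      rw [map_smul, ← hact]
      exact Submodule.smul_mem _ _ ⟨_, rfl⟩
    rintro _ ⟨i, rfl⟩
    fin_cases i
    · exact hin 2
    · exact hin 1
    · exact hin 0
    · refine ⟨(r' p.2)⁻¹ • ((0 : E3), (1 : ℝ)), ?_⟩
      change sweepD γ r p _ = P.gradE g (p.1 • y)
      rw [map_smul, hgrad, smul_smul, inv_mul_cancel₀ hr0.ne', one_smul]

end Sweep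

theorem injective_of_range_eq_span {V W : Type*} [AddCommGroup V] [Module ℝ V] [FiniteDimensional ℝ V]
    [AddCommGroup W] [Module ℝ W] {n : ℕ} {L : V →ₗ[ℝ] W} {b : Fin n → W} (hb : LinearIndependent ℝ b)
    (hV : Module.finrank ℝ V = n) (h : LinearMap.range L = Submodule.span ℝ (range b)) : Injective L := by
  rw [← LinearMap.ker_eq_bot, ← Submodule.finrank_eq_zero (R := ℝ)]
  have h1 := L.finrank_range_add_finrank_ker
  rw [h, finrank_span_eq_card hb, Fintype.card_fin, hV] at h1
  omega

section SweepEmbedding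
variable {M : Type*} [TopologicalSpace M] [ChartedSpace E7 M] [MulAction SO3 M]
  [IsManifold (𝓡 7) ∞ M] [ContMDiffSMul (𝓡 3) (𝓡 7) ∞ SO3 M] [T2Space M] {P : G2Structure M} {g : M → ℝ}
  {γ : ℝ → M} {I : Set ℝ} {r r' : ℝ → ℝ}

/-- The map is fibred by `g` over the strictly increasing embedding `g ∘ γ ∘ r` of the line, with
compact fibre `SO(3)`. Equal images thus have the same real parameter. -/
theorem G2Structure.IsMoment.isEmbedding_sweepMap (hg : P.IsMoment g) (h0 : ∀ m, P.formOnFields m = 0)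
    (hfree : ∀ m : M, IsRegularPoint m → ∀ A : SO3, A • m = m → A = 1)
    (hl : P.IsGradientLine g γ I) (hr : StrictMono r) (hrc : Continuous r) (hrI : range r = I)
    (hF : Continuous (sweepMap γ r)) : IsEmbedding (sweepMap γ r) := by
  have hmem : ∀ s, r s ∈ I := fun s => hrI ▸ mem_range_self s
  have hreg : ∀ t ∈ I, IsRegularPoint (γ t) := fun t ht => hg.isRegularPoint_of_isGradientLine hl ht
  have hmono : StrictMono (g ∘ γ ∘ r) := fun s t hst =>
    hg.strictMonoOn h0 hl.isOpen hl.ordConnected hl.integralCurve hreg (hmem s) (hmem t) (hr hst)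
  have hgF : ∀ p, g (sweepMap γ r p) = (g ∘ γ ∘ r) p.2 := fun p => hg.smul_eq _ _
  have hcont : Continuous (g ∘ γ ∘ r) :=
    hg.smooth.continuous.comp (hl.integralCurve.continuousOn.comp_continuous hrc hmem)
  refine isEmbedding_of_comp_eq_snd hF ?_ hg.smooth.continuous
    (hmono.isEmbedding_of_ordConnected (isPreconnected_range hcont).ordConnected) hgF
  rintro ⟨A, s⟩ ⟨B, t⟩ h
  have h1 : s = t := hmono.injective ((hgF (A, s)).symm.trans ((congrArg g h).trans (hgF (B, t))))
  subst h1
  have h2 : A • γ (r s) = B • γ (r s) := h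
  -- The rotation `B⁻¹ * A` fixes a regular point, so freeness gives `A = B`.
  have h3 := hfree _ (hreg _ (hmem s)) (B⁻¹ * A) (by rw [mul_smul, h2, inv_smul_smul])
  rw [inv_mul_eq_one.1 h3]

end SweepEmbedding

theorem mainTheorem8 {M : Type*} [TopologicalSpace M] [ChartedSpace E7 M]
    [IsManifold (𝓡 7) ∞ M] [T2Space M] [SecondCountableTopology M] [ConnectedSpace M]
    (P : G2Structure M) (hP : P.TorsionFree) (hb : FirstBettiNumberVanishes M)
    [MulAction SO3 M] [ContMDiffSMul (𝓡 3) (𝓡 7) ∞ SO3 M] (hinv : P.IsInvariant)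
    (hnonreg : ∃ m : M, ¬ IsRegularPoint m)
    (hfree : ∀ m : M, IsRegularPoint m → ∀ A : SO3, A • m = m → A = 1) :
    ∃ g : M → ℝ, ContMDiff (𝓡 7) 𝓘(ℝ, ℝ) ∞ g ∧
      (∀ (A : SO3) (m : M), g (A • m) = g m) ∧
      -- `dg = i_{X₁} i_{X₂} i_{X₃} (∗φ)`
      (∀ (m : M) (w : TangentSpace (𝓡 7) m), differential g m w =
        P.starForm m ![actionField 2 m, actionField 1 m, actionField 0 m, w]) ∧
      (∀ m : M, IsRegularPoint m ↔ differential g m ≠ 0) ∧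
      -- the sets `SO(3) · ℓ` are pairwise disjoint and their union is the regular set
      (P.sweptFamily g).PairwiseDisjoint id ∧
      ⋃₀ P.sweptFamily g = {m : M | IsRegularPoint m} ∧
      -- each of them is an embedded coassociative submanifold diffeomorphic to `SO(3) × ℝ`,
      -- through the action and a parametrisation of `ℓ`
      ∀ (γ : ℝ → M) (I : Set ℝ), P.IsGradientLine g γ I →
        ∃ F : SO3 × ℝ → M,
          range F = sweep γ I ∧
          (range fun s => F (1, s)) = γ '' I ∧
          (∀ A s, F (A, s) = A • F (1, s)) ∧
          ContMDiff ((𝓡 3).prod 𝓘(ℝ, ℝ)) (𝓡 7) ∞ F ∧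
          IsEmbedding F ∧
          (∀ p, Injective (mfderiv ((𝓡 3).prod 𝓘(ℝ, ℝ)) (𝓡 7) F p)) ∧
          ∀ p, P.IsCoassociative
            (LinearMap.range (mfderiv ((𝓡 3).prod 𝓘(ℝ, ℝ)) (𝓡 7) F p).toLinearMap) := by
  obtain ⟨g, hg⟩ := G2Structure.exists_isMoment hP hinv hb
  have h0 := G2Structure.formOnFields_eq_zero hP hinv hnonreg
  refine ⟨g, hg.smooth, hg.smul_eq, fun m w => ?_, hg.isRegularPoint_iff_differential_ne h0,
    hg.pairwiseDisjoint_sweptFamily hinv, hg.sUnion_sweptFamily h0, fun γ I hl => ?_⟩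
  · exact (hg.diffE_apply m w).trans (P.momentLinear_apply m w)
  obtain ⟨s₀, hs₀, -⟩ := hl.nonconstant
  obtain ⟨r, r', hr, hrd, hrpos, hrI⟩ := exists_contDiff_range_eq hl.isOpen hl.ordConnected ⟨s₀, hs₀⟩
  have hmem : ∀ s, r s ∈ I := fun s => hrI ▸ mem_range_self s
  have hmono : StrictMono r := strictMono_of_deriv_pos fun s => by rw [(hrd s).deriv]; exact hrpos s
  have hF := contMDiff_sweepMap (contMDiffOn_gradientCurve hg.smooth hl.isOpen hl.integralCurve) hr hrI
  have hreg : ∀ p, IsRegularPoint (sweepMap γ r p) := fun p =>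
    isRegularPoint_smul (hg.isRegularPoint_of_isGradientLine hl (hmem p.2)) p.1
  have hind := fun p => hg.linearIndependent_sweepFrame (h0 (sweepMap γ r p)) (hreg p)
  have hrange := fun p => range_sweepD hF p hg hinv hl.isOpen hl.integralCurve (hrd p.2) (hrpos p.2) (hmem p.2)
  refine ⟨sweepMap γ r, range_sweepMap hrI, ?_, fun A s => ?_, hF,
    hg.isEmbedding_sweepMap h0 hfree hl hmono hr.continuous hrI hF.continuous, fun p => ?_, fun p => ?_⟩
  · rw [← hrI, ← range_comp]
    exact congrArg range (funext fun s => one_smul SO3 (γ (r s)))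
  · exact congrArg (A • ·) (one_smul SO3 (γ (r s))).symm
  · exact injective_of_range_eq_span (L := (sweepD γ r p).toLinearMap) (hind p) (by simp) (hrange p)
  · have h1 : Module.finrank ℝ (LinearMap.range (sweepD γ r p).toLinearMap) = 4 := by
      rw [hrange p, finrank_span_eq_card (hind p), Fintype.card_fin]
    refine ⟨h1, fun e he ho => ?_⟩
    refine hg.calibrated_sweepFrame (h0 _) (hreg p) e (fun i => ?_) ho
    rw [← hrange p]
    exact he i
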